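/- Let $k$ be an algebraically closed field of characteristic $2$. Let $\overline X$ be a projective variety over $k$ of even dimension $n>0$, $\mathcal L$ a line bundle on $\overline X$, and $M\subset H^0(\overline X,\mathcal L)$ a linear subspace of dimension $m+1$ with $m>n$. Let $\mathbf P=\mathbf P_*(M)$ be the projective space of lines $[f]$ in $M$ (an $m$-dimensional linear system). Points are closed points. Let $X\subset\overline X$ be the complement of the singular locus and of the base locus of $M$, let $\Psi:X\to\mathbf P^\vee$ be the morphism defined by $M$, and let $X^\circ=\{p\in X : d_p\Psi \text{ is injective}\}$; assume that $X^\circ$ is dense in $\overline X$. For $0\ne f\in M$ put $D_{[f]}=\{f=0\}\cap X$. Let $\mathcal D\subset X\times\mathbf P$ be the universal family of the divisors $D_{[f]}$, and let $\mathcal C$ be the critical subscheme of the projection $\mathcal D\to\mathbf P$ (the degeneracy subscheme of its differential), restricted to $X^\circ\times\mathbf P$. If $\Phi$ is a local equation of $\mathcal D$ and $\partial_1,\dots,\partial_n$ is a local frame of the tangent bundle of $X^\circ$, then the matrix $\mathcal H=(\partial_i\partial_j\Phi)$ is symmetric with zero diagonal on $\mathcal C$ (the universal Hessian), and $\det\mathcal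 H$ is the square of a unique function on $\mathcal C$. Let $\mathcal R\subset\mathcal C$ be the closed subscheme defined locally by the vanishing of this square root of $\det\mathcal H$. Let $\mathcal R^{\mathrm{sm}}$ be the set of points of $\mathcal R$ at which $\mathcal R$ is smooth over $k$ of dimension $m-2$, an open subscheme of $\mathcal R$, and let $\varpi_2^{\mathrm{sm}}:\mathcal R^{\mathrm{sm}}\to\mathbf P$ be the projection. Let $P=(p,[f])$ be a point of $\mathcal R$; thus $D_{[f]}$ is singular at $p$. (1) If $P\in\mathcal R^{\mathrm{sm}}$, then the Hessian matrix at $p$ of a local equation of $D_{[f]}$, in any local parameter system at $p$, has rank $n-2$. Conversely, suppose that this rank is $n-2$. Let $b_0=f,b_1,\dots,b_m$ be any basis of $M$ such that, with $D_i=\{b_i=0\}$ and $\phi_i=b_i/b_m$: $p\in D_i$ for $i<m$ and $p\notin D_m$; $D_1,\dots,D_n$ are smooth and intersect transversely at $p$; $D_{n+1},\dots,D_{m-1}$ are singular at $p$; and, in the parameter system $(x_1,\dots,x_n)=(\phi_1,\dots,\phi_n)$, the Hessian matrix of $\phi_0$ at $p$ is block diagonal with $(n-2)/2$ blocks $\begin{pmatrix}0&1\\-1&0\end{pmatrix}$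 followed by a zero block. Write $\xi_1=x_{n-1}$, $\xi_2=x_n$, let $d_i$ ($1\le i\le n-2$) be the coefficient of $x_i\xi_1\xi_2$ in the power series expansion of $\phi_0$ in $x_1,\dots,x_n$, and let $e_j$ ($n+1\le j\le m-1$) be the coefficient of $\xi_1\xi_2$ in that of $\phi_j$. Then $P\in\mathcal R^{\mathrm{sm}}$ if and only if at least one of $d_1,\dots,d_{n-2},e_{n+1},\dots,e_{m-1}$ is not zero. (2) The kernel of the homomorphism $d\varpi_2^{\mathrm{sm}}:T(\mathcal R^{\mathrm{sm}})\to(\varpi_2^{\mathrm{sm}})^*T(\mathbf P)$ is a subbundle of rank $2$ of the tangent bundle $T(\mathcal R^{\mathrm{sm}})$ (locally a free direct summand of rank $2$), and at every point $P$ of $\mathcal R^{\mathrm{sm}}$ the kernel of $d_P\varpi_2^{\mathrm{sm}}:T_P(\mathcal R^{\mathrm{sm}})\to T_{[f]}(\mathbf P)$ has dimension $2$. -/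

import Mathlib

open AlgebraicGeometry CategoryTheory Opposite

universe u

noncomputable section

namespace DualVariety

/-! ## Schemes over a field, line bundles, linear systems -/

section Geometry

variable (k : Type u) [Field k] (X : Scheme.{u}) [X.Over (Spec (CommRingCat.of k))]

/-- Sections of the structure sheaf of a `k`-scheme form a `k`-algebra. -/
instance sectionsAlgebra (U : X.Opens) : Algebra k Γ(X, U) :=
  ((Scheme.ΓSpecIso (CommRingCat.of k)).inv ≫
    (X ↘ Spec (CommRingCat.of k)).appLE ⊤ U (fun _ _ => trivial)).hom.toAlgebra

/-- The local rings of a `k`-scheme are `k`-algebras. -/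
instance stalkAlgebra (p : X) : Algebra k (X.presheaf.stalk p) :=
  ((X.presheaf.germ ⊤ p trivial).hom.comp (algebraMap k Γ(X, ⊤))).toAlgebra

/-- Sections of an `𝒪_X`-module on a `k`-scheme form a `k`-vector space. -/
instance sectionsModule (L : X.Modules) (U : X.Opens) : Module k Γ(L, U) :=
  Module.compHom _ (algebraMap k Γ(X, U))

attribute [local instance] MvPolynomial.gradedAlgebra

/-- `X` is a projective variety over `k`: an integral scheme that admits a closed immersion over
`k` into some projective space `ℙ^N = Proj k[T_0, …, T_N]`. -/
structure IsProjectiveVariety : Prop where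
  integral : AlgebraicGeometry.IsIntegral X
  projective : ∃ (N : ℕ) (i : X ⟶ Proj (MvPolynomial.homogeneousSubmodule (Fin (N + 1)) k)),
    IsClosedImmersion i ∧
      i ≫ Proj.toSpecZero (MvPolynomial.homogeneousSubmodule (Fin (N + 1)) k) ≫
        Spec.map (CommRingCat.ofHom
          (algebraMap k (MvPolynomial.homogeneousSubmodule (Fin (N + 1)) k 0))) =
      X ↘ Spec (CommRingCat.of k)

variable {X}

/-- Restriction to `U` of a global section of an `𝒪_X`-module. -/
def res (L : X.Modules) (U : X.Opens) (s : Γ(L, ⊤)) : Γ(L, U) :=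
  L.presheaf.map (homOfLE (le_top : U ≤ ⊤)).op s

/-- `b` is a frame (nowhere vanishing section) of `L` on `U`:
`a ↦ a • b` identifies `𝒪_U` with `L|_U`. -/
def IsFrame (L : X.Modules) (U : X.Opens) (b : Γ(L, U)) : Prop :=
  ∀ (V : X.Opens) (h : V ≤ U),
    Function.Bijective (fun a : Γ(X, V) => a • (L.presheaf.map (homOfLE h).op b : Γ(L, V)))

/-- `L` is a line bundle: it has a frame near every point. -/
def IsLineBundle (L : X.Modules) : Prop :=
  ∀ p : X, ∃ (U : X.Opens) (_ : p ∈ U) (b : Γ(L, U)), IsFrame L U b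

variable {k}

/-- The (closed) points of the open subset `X°` of `X` attached to the linear system `M`:
closed points that are smooth on `X`, are not base points of `M`, and at which the differential
of the morphism `Ψ : p ↦ {s ∈ M | s(p) = 0}` to the dual projective space is injective.
With a frame `b` of `L` near `p`, a tangent vector `v ∈ (𝔪_p/𝔪_p²)^∨` is sent by `d_pΨ` to the
linear form `s ↦ v(s/b)` on `{s ∈ M | s(p) = 0}`. -/
structure IsGoodPoint (L : X.Modules) (M : Submodule k Γ(L, ⊤)) (p : X) : Prop where
  closed : IsClosed ({p} : Set X)
  smooth : ∃ W : X.Opens, p ∈ W ∧ Smooth (W.ι ≫ (X ↘ Spec (CommRingCat.of k)))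
  not_base : ∃ (W : X.Opens) (_ : p ∈ W) (s : Γ(L, ⊤)), s ∈ M ∧ IsFrame L W (res L W s)
  immersive : ∀ (W : X.Opens) (hp : p ∈ W) (b : Γ(L, W)), IsFrame L W b →
    ∀ v : Module.Dual (IsLocalRing.ResidueField (X.presheaf.stalk p))
        (IsLocalRing.CotangentSpace (X.presheaf.stalk p)),
      (∀ s ∈ M, ∀ (h : Γ(X, W))
        (h0 : X.presheaf.germ W p hp h ∈ IsLocalRing.maximalIdeal (X.presheaf.stalk p)),
        res L W s = h • b →
          v ((IsLocalRing.maximalIdeal (X.presheaf.stalk p)).toCotangent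
            ⟨X.presheaf.germ W p hp h, h0⟩) = 0) →
      v = 0

end Geometry

/-! ## Parameter systems, power series expansions, Hessians -/

section PowerSeries

variable {k : Type*} [Field k] {O : Type*} [CommRing O] [IsLocalRing O] [Algebra k O] {n : ℕ}

/-- `x` is a local parameter system of `O` (used with `n = dim O`). -/
def IsParameterSystem (x : Fin n → O) : Prop :=
  Ideal.span (Set.range x) = IsLocalRing.maximalIdeal O

/-- `ψ ∈ k[[x_1, …, x_n]]` is the expansion of `h ∈ O` in the parameters `x`. -/
def IsExpansion (x : Fin n → O) (h : O) (ψ : MvPowerSeries (Fin n) k) : Prop :=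
  ∀ d : ℕ, h - MvPolynomial.aeval x (MvPowerSeries.truncTotal d ψ) ∈
    IsLocalRing.maximalIdeal O ^ d

/-- The matrix of the formal second partial derivatives `∂²ψ/∂x_i∂x_j` at the origin. -/
def hessianAtOrigin (ψ : MvPowerSeries (Fin n) k) : Matrix (Fin n) (Fin n) k :=
  Matrix.of fun i j => (if i = j then 2 else 1) *
    MvPowerSeries.coeff (Finsupp.single i 1 + Finsupp.single j 1) ψ

/-- The `n × n` matrix with `r` blocks `[[0, 1], [-1, 0]]` along the diagonal, followed by `0`. -/
def standardAlt (k : Type*) [Field k] (n r : ℕ) : Matrix (Fin n) (Fin n) k :=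
  Matrix.of fun i j =>
    if (i : ℕ) < 2 * r ∧ (j : ℕ) < 2 * r then
      if Even (i : ℕ) ∧ (j : ℕ) = i + 1 then 1
      else if Even (j : ℕ) ∧ (i : ℕ) = j + 1 then -1 else 0
    else 0

/-- The coefficient in `ψ` of the product of the distinct variables `x_i`, `i ∈ S ⊆ {1, …, n}`
(the variables being numbered from `1`). -/
def squarefreeCoeff (S : Finset ℕ) (ψ : MvPowerSeries (Fin n) k) : k :=
  MvPowerSeries.coeff (Finsupp.equivFunOnFinite.symm
    (fun i : Fin n => if (i : ℕ) + 1 ∈ S then 1 else 0)) ψ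

end PowerSeries

/-! ## Local equations

`A` is the coordinate ring of an affine open subset `U` of `X`, `φ_0, …, φ_m` are the functions
`s_i / s_m` on `U` attached to a basis `s_0, …, s_m` of `M`, and `∂_1, …, ∂_n` is a frame of the
tangent bundle of `U`. The variable `X j` (`j : Fin m`) of `A[y_1, …, y_m]` is the affine
coordinate `y_{j+1} = Y_{j+1} / Y_0` of the projective space `P = ℙ_*(M)`, so that `A[y]` is the
coordinate ring of `U × {Y_0 ≠ 0}`, an affine open subset of `X × P`. -/

section LocalEquations

variable (k : Type*) [Field k] {A : Type*} [CommRing A] [Algebra k A] {n m : ℕ}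

/-- The polynomial `g_0 + y_1 g_1 + ⋯ + y_m g_m` over `A`. For `g = φ` this is the local equation
`Φ = σ / (s_m ⊗ Y_0)` of the universal family. Derivations of `A`, extended to `A[y]`
by `y ↦ 0`, act on such polynomials through the coefficients `g_i`. -/
def linearForm (g : Fin (m + 1) → A) : MvPolynomial (Fin m) A :=
  MvPolynomial.C (g 0) + ∑ j : Fin m, MvPolynomial.X j * MvPolynomial.C (g j.succ)

/-- The coordinate ring of the universal family `𝒟 = {Φ = 0}`. -/
abbrev FamilyRing (φ : Fin (m + 1) → A) : Type _ :=
  MvPolynomial (Fin m) A ⧸ Ideal.span {linearForm φ}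

/-- The ideal of the critical subscheme `𝒞` of the projection `p_2 : 𝒟 → P`, that is, of the
degeneracy subscheme of `dp_2 : T(𝒟) → p_2^* T(P)`, `Θ ↦ (Θ(y_1), …, Θ(y_m))`: it is generated by
the maximal minors of `dp_2` (the rank `n + m - 1` of `T(𝒟)` is at least the rank `m` of `T(P)`). -/
def criticalIdeal (φ : Fin (m + 1) → A) : Ideal (MvPolynomial (Fin m) A) :=
  Ideal.comap (Ideal.Quotient.mk (Ideal.span {linearForm φ}))
    (Ideal.span {δ : FamilyRing φ | ∃ Θ : Fin m → Derivation k (FamilyRing φ) (FamilyRing φ),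
      δ = Matrix.det (Matrix.of fun a b : Fin m =>
        Θ a (Ideal.Quotient.mk (Ideal.span {linearForm φ}) (MvPolynomial.X b)))})

variable {k}

/-- The matrix `(∂_i ∂_j Φ)` which, modulo the ideal of `𝒞`, represents the universal Hessian. -/
def universalHessian (φ : Fin (m + 1) → A) (D : Fin n → Derivation k A A) :
    Matrix (Fin n) (Fin n) (MvPolynomial (Fin m) A) :=
  Matrix.of fun i j => linearForm fun l => D i (D j (φ l))

/-- The ideal of the degeneracy subscheme `ℛ ⊆ 𝒞` of the universal Hessian `ℋ`, an anti-symmetric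
form on `𝒞`: the function `f` on `𝒞` with `f ^ 2 = det ℋ` is set to zero. (Over `X°` the scheme
`𝒞` is smooth, hence reduced, so in characteristic `2` this square root is unique on `𝒞`.) -/
def degeneracyIdeal (φ : Fin (m + 1) → A) (D : Fin n → Derivation k A A) :
    Ideal (MvPolynomial (Fin m) A) :=
  criticalIdeal k φ ⊔
    Ideal.span {f | f ^ 2 - (universalHessian φ D).det ∈ criticalIdeal k φ}

end LocalEquations

section Bundles

variable {k : Type*} [Field k] {B : Type*} [CommRing B] [Algebra k B] {m : ℕ}

/-- `Spec B` is smooth over `k` of dimension `d` at the point `P` of `Spec B`: this holds on a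
basic open neighbourhood of `P`. -/
def IsSmoothOfDimAt (k : Type*) [Field k] {B : Type*} [CommRing B] [Algebra k B]
    (P : Ideal B) (d : ℕ) : Prop :=
  ∃ g : B, g ∉ P ∧ Algebra.IsStandardSmoothOfRelativeDimension d k (Localization.Away g)

/-- The differential of the morphism `y = (y_1, …, y_m) : Spec B → 𝔸^m`, in the frame
`∂/∂y_1, …, ∂/∂y_m`, on derivations of `B` into a `B`-module `N`: on vector fields if `N = B`, on
tangent vectors at the point `P` if `N = B ⧸ P`. -/
def differential (y : Fin m → B) (N : Type*) [AddCommGroup N] [Module B N] [Module k N]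
    [IsScalarTower k B N] :
    Derivation k B N →ₗ[B] (Fin m → N) where
  toFun v j := v (y j)
  map_add' _ _ := rfl
  map_smul' _ _ := rfl

/-- On a basic open neighbourhood of `P` in `Spec B` that is smooth of dimension `d`, the kernel of
the differential of `y : Spec B → 𝔸^m` is a subbundle of rank `r` of the tangent bundle: a free
module of rank `r` which is a direct summand of the module of vector fields. -/
def KernelIsSubbundleNear (k : Type*) [Field k] {B : Type*} [CommRing B] [Algebra k B]
    (y : Fin m → B) (P : Ideal B) (d r : ℕ) : Prop :=
  ∃ g : B, g ∉ P ∧ Algebra.IsStandardSmoothOfRelativeDimension d k (Localization.Away g) ∧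
    Nonempty (Module.Basis (Fin r) (Localization.Away g) (LinearMap.ker
      (differential (k := k) (fun j => algebraMap B (Localization.Away g) (y j))
        (Localization.Away g)))) ∧
    ∃ K : Submodule (Localization.Away g)
        (Derivation k (Localization.Away g) (Localization.Away g)),
      IsCompl (LinearMap.ker
        (differential (k := k) (fun j => algebraMap B (Localization.Away g) (y j))
          (Localization.Away g))) K

end Bundles

/-! ## Affine charts of `X° × P` and the subscheme `ℛ` -/

section Charts

variable {k : Type u} [Field k] {X : Scheme.{u}} [X.Over (Spec (CommRingCat.of k))]

/-- The data that define an affine chart `U × {Y_0 ≠ 0}` of `X° × P`, where `P = ℙ_*(M)`: a basis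
`s_0, …, s_m` of `M`, with dual coordinates `Y_0, …, Y_m` on `P`, an affine open subset `U` of `X°`
on which `s_m` has no zeros, and a frame of the tangent bundle of `U`. A chart is said to be at
`(p, [f])` if `s_0 = f` and `p ∈ U`. As `X°` is open in the smooth locus, every point
`(p, [f])` of `X° × P` with `f(p) = 0` has a chart at it. -/
structure Chart (n m : ℕ) (L : X.Modules) (M : Submodule k Γ(L, ⊤)) where
  s : Module.Basis (Fin (m + 1)) k M
  U : X.Opens
  isAffineOpen : IsAffineOpen U
  good : ∀ p ∈ U, IsClosed ({p} : Set X) → IsGoodPoint L M p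
  isFrame : IsFrame L U (res L U (s (Fin.last m)))
  frame : Module.Basis (Fin n) Γ(X, U) (Derivation k Γ(X, U) Γ(X, U))

namespace Chart

variable {n m : ℕ} {L : X.Modules} {M : Submodule k Γ(L, ⊤)} (c : Chart n m L M)

theorem exists_phi (i : Fin (m + 1)) :
    ∃ a : Γ(X, c.U), a • res L c.U (c.s (Fin.last m)) = res L c.U (c.s i) := by
  obtain ⟨a, ha⟩ := (c.isFrame c.U le_rfl).2 (res L c.U (c.s i))
  refine ⟨a, ?_⟩
  rw [← ha]
  simp

/-- The function `φ_i = s_i / s_m` on `U`. -/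
def phi (i : Fin (m + 1)) : Γ(X, c.U) := (c.exists_phi i).choose

/-- The coordinate ring of the part of `ℛ` in the chart: the closed subscheme
`Spec c.R` of `U × {Y_0 ≠ 0} = Spec Γ(X, U)[y_1, …, y_m]`. -/
abbrev R : Type u :=
  MvPolynomial (Fin m) Γ(X, c.U) ⧸ degeneracyIdeal c.phi c.frame

/-- The coordinates `y_1, …, y_m` of `P`, as functions on `ℛ`; they describe the projection
`ϖ_2 : ℛ → P` in the chart. -/
def y (j : Fin m) : c.R := Ideal.Quotient.mk _ (MvPolynomial.X j)

/-- The maximal ideal of the point `(p, [s_0])`, i.e. `y_1 = ⋯ = y_m = 0`, in the coordinate ring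
of the chart. -/
def pointIdeal (p : X) (hp : p ∈ c.U) : Ideal (MvPolynomial (Fin m) Γ(X, c.U)) :=
  Ideal.comap ((X.presheaf.germ c.U p hp).hom.comp
      (MvPolynomial.aeval (R := Γ(X, c.U)) (fun _ : Fin m => (0 : Γ(X, c.U)))).toRingHom)
    (IsLocalRing.maximalIdeal (X.presheaf.stalk p))

/-- The point `(p, [s_0])` lies on `ℛ`. -/
def MemR (p : X) (hp : p ∈ c.U) : Prop :=
  degeneracyIdeal c.phi c.frame ≤ c.pointIdeal p hp

/-- The ideal of the point `(p, [s_0])` in the coordinate ring of `ℛ`. -/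
def pointOnR (p : X) (hp : p ∈ c.U) : Ideal c.R :=
  (c.pointIdeal p hp).map (Ideal.Quotient.mk (degeneracyIdeal c.phi c.frame))

/-- The point `(p, [s_0])` lies on `ℛ^sm`: it is a point of `ℛ` at which `ℛ` is smooth of
dimension `m - 2`. -/
def MemRsm (p : X) (hp : p ∈ c.U) : Prop :=
  c.MemR p hp ∧ IsSmoothOfDimAt k (c.pointOnR p hp) (m - 2)

/-- The germ of `φ_i` at `p`. -/
def phiAt (p : X) (hp : p ∈ c.U) (i : Fin (m + 1)) : X.presheaf.stalk p :=
  X.presheaf.germ c.U p hp (c.phi i)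

/-- The functions `x_i = φ_i`, `1 ≤ i ≤ n`, at `p`. -/
def coords (hnm : n < m) (p : X) (hp : p ∈ c.U) (i : Fin n) : X.presheaf.stalk p :=
  c.phiAt p hp ⟨i + 1, by omega⟩

/-- The basis `s_0, …, s_m` is adapted to the point `(p, [s_0])`: with `D_i = {s_i = 0}` (so that
`p ∉ D_m`), `p` lies on `D_0, …, D_{m-1}`, the divisors `D_1, …, D_n` are smooth and transverse at
`p` (their equations form a parameter system), the divisors `D_0` and `D_{n+1}, …, D_{m-1}` are
singular at `p`, and the parameter system `(φ_1, …, φ_n)` is admissible with respect to `φ_0`,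
whose expansion is `ψ`: the Hessian matrix is in standard form. -/
structure IsAdapted (hnm : n < m) (p : X) (hp : p ∈ c.U) (ψ : MvPowerSeries (Fin n) k) :
    Prop where
  vanish : ∀ i : Fin (m + 1), (i : ℕ) < m →
    c.phiAt p hp i ∈ IsLocalRing.maximalIdeal (X.presheaf.stalk p)
  transverse : IsParameterSystem (c.coords hnm p hp)
  singular : ∀ i : Fin (m + 1), ((i : ℕ) = 0 ∨ (n < (i : ℕ) ∧ (i : ℕ) < m)) →
    c.phiAt p hp i ∈ IsLocalRing.maximalIdeal (X.presheaf.stalk p) ^ 2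
  admissible : ∃ r : ℕ, 2 * r ≤ n ∧ hessianAtOrigin ψ = standardAlt k n r

end Chart

end Charts

end DualVariety

end

/-! The critical scheme `𝒞` has the equations `Φ = ∂_1Φ = ⋯ = ∂_nΦ = 0` (`criticalIdeal_eq`). They
are linear in `y_1, …, y_m`, and immersivity of `Ψ` makes their differentials at `P` independent. So
`T_P𝒞` has dimension `m - 1`, and near `P` the scheme `𝒞` is the graph of a solution of linear
equations, hence reduced (`IsCriticalPoint.exists_reduced`). Modulo these equations the Hessian `H =
(∂_i∂_jΦ)` is alternating, because `[∂_i, ∂_j]` and, in characteristic two, `∂_i²` are again vector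
fields. Hence `det H` is the square of a Pfaffian (`det_eq_pfaffian_sq`). By reducedness two roots
agree near `P`, so a single root `f` cuts `ℛ` out of `𝒞`, and `ℛ` is smooth of dimension `m - 2` at
`P` exactly when `df` is nonzero on `T_P𝒞` (`isSmoothOfDimAt_iff`).

Rank. At `P` the form `H` is alternating and degenerate, so its corank is even and positive. If it
exceeds two, then in a suitable frame at least three rows vanish at `P`; every term of the Pfaffian
has two factors vanishing at `P`, and `df = 0` (`rank_add_two_eq`).

Criterion. If the corank is two, block elimination trades `f` for the border form `u`, the value of
`H` on two explicit vectors `z_0, z_1` that span the kernel of `H` where `u = 0`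
(`border_relation`). When the last two rows of `H` vanish at `P`, `df` is zero on the same tangent
vectors as `dH_{n-1,n}` (`derivation_root_eq_zero_iff`). In an adapted basis, `T_P𝒞` is parametrized
by the displacement of `p` and by the components along `y_j`, `n < j < m`. In these coordinates
`dH_{n-1,n}` has the coefficients `d_i` and `e_j`; those along `ξ_1` and `ξ_2` are multiples of two
(`exists_apply_hessian_ne_zero_iff`).

Kernel. A tangent vector of `𝒞` without component along `P` is a vector `c` with `Hc = 0`. It is
automatically tangent to `ℛ`: the derivative of `u` along `c` is `T(c, z_0, z_1)`, where `T` is the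
form of third derivatives. Since `c` is a combination of `z_0` and `z_1`, one argument is repeated,
and `T(x, x, z) = 0` for `z` in the kernel (`derivation_borderForm_eq_zero`). So the kernel of the
projection is free of rank two wherever a block of size `n - 2` is invertible, with the fields whose
last two frame coordinates vanish as a complement. The statements about derivations take values in
an arbitrary algebra `N` over the coordinate ring: a localization gives the bundle, the residue
field gives the tangent space. -/

noncomputable section
namespace DualVariety

/-! ## Determinants of alternating matrices in characteristic two -/

section Alternating

variable {R : Type*} [CommRing R] {ι : Type*} [Fintype ι] [DecidableEq ι]

/-- The fixed point free involutions of a finite type. -/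
def freeInvolutions (ι : Type*) [Fintype ι] [DecidableEq ι] : Finset (Equiv.Perm ι) :=
  Finset.univ.filter fun σ => σ⁻¹ = σ ∧ ∀ i, σ i ≠ i

theorem apply_apply_of_mem_freeInvolutions {σ : Equiv.Perm ι} (hσ : σ ∈ freeInvolutions ι)
    (i : ι) : σ (σ i) = i := by
  have h := (Finset.mem_filter.1 hσ).2.1
  calc σ (σ i) = σ⁻¹ (σ i) := by rw [h]
    _ = i := by simp

/-- The Pfaffian of a symmetric matrix with zero diagonal, in characteristic two. -/
def pfaffian [LinearOrder ι] (M : Matrix ι ι R) : R :=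
  ∑ σ ∈ freeInvolutions ι, ∏ i ∈ Finset.univ.filter (fun i => i < σ i), M i (σ i)

/-- Signs disappear in characteristic two and, by symmetry, `σ` and `σ⁻¹` give equal terms. So
permutations different from their inverse cancel in pairs, while an involution with a fixed point
contributes a diagonal entry, which is zero. -/
theorem det_eq_sum_freeInvolutions (h2 : (2 : R) = 0) {M : Matrix ι ι R} (hM : M.IsSymm)
    (h0 : ∀ i, M i i = 0) :
    M.det = ∑ σ ∈ freeInvolutions ι, ∏ i, M i (σ i) := by
  have hdet : M.det = ∑ σ : Equiv.Perm ι, ∏ i, M i (σ i) := by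
    rw [← Matrix.det_transpose, Matrix.det_apply]
    refine Finset.sum_congr rfl fun σ _ => ?_
    rcases Int.units_eq_one_or (Equiv.Perm.sign σ) with h | h
    · simp [h]
    · have : ∀ x : R, -x = x := fun x => by linear_combination (-x) * h2
      simp [h, Units.smul_def, this]
  rw [hdet, ← Finset.sum_filter_add_sum_filter_not Finset.univ
    (fun σ : Equiv.Perm ι => σ⁻¹ = σ ∧ ∀ i, σ i ≠ i)]
  rw [freeInvolutions, add_eq_left]
  have hinv : ∀ σ : Equiv.Perm ι, ∏ i, M i (σ⁻¹ i) = ∏ i, M i (σ i) := by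
    intro σ
    rw [← Equiv.prod_comp σ]
    refine Finset.prod_congr rfl fun i _ => ?_
    simp [hM.apply]
  refine Finset.sum_involution (fun σ _ => σ⁻¹) ?_ ?_ ?_ ?_
  · intro σ _
    rw [hinv, ← two_mul, h2, zero_mul]
  · intro σ hσ hne heq
    refine (Finset.mem_filter.1 hσ).2 ⟨heq, fun i hi => hne ?_⟩
    exact Finset.prod_eq_zero (Finset.mem_univ i) (by rw [hi, h0])
  · intro σ hσ
    simp only [Finset.mem_filter, Finset.mem_univ, true_and, inv_inv] at hσ ⊢
    rintro ⟨h, h'⟩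
    exact hσ ⟨h.symm, fun i hi => h' i (by rw [← h, hi])⟩
  · intro σ _
    simp

theorem sum_sq_of_two_eq_zero (h2 : (2 : R) = 0) {κ : Type*} (s : Finset κ) (f : κ → R) :
    ∑ i ∈ s, f i ^ 2 = (∑ i ∈ s, f i) ^ 2 := by
  classical
  induction s using Finset.induction_on with
  | empty => simp
  | insert a s ha ih =>
    rw [Finset.sum_insert ha, Finset.sum_insert ha, ih]
    linear_combination (-(f a * ∑ i ∈ s, f i)) * h2

/-- In characteristic two, the determinant of an alternating matrix is the square of its
Pfaffian. -/
theorem det_eq_pfaffian_sq [LinearOrder ι] (h2 : (2 : R) = 0) {M : Matrix ι ι R} (hM : M.IsSymm)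
    (h0 : ∀ i, M i i = 0) : M.det = pfaffian M ^ 2 := by
  rw [det_eq_sum_freeInvolutions h2 hM h0, pfaffian, ← sum_sq_of_two_eq_zero h2]
  refine Finset.sum_congr rfl fun σ hσ => ?_
  -- The involution `σ` exchanges the indices with `i < σ i` and those with `σ i < i`, and by
  -- symmetry the corresponding entries agree. So the product over all indices is the square of the
  -- product over the first half.
  rw [← Finset.prod_filter_mul_prod_filter_not Finset.univ (fun i => i < σ i), sq]
  congr 1
  have hi := apply_apply_of_mem_freeInvolutions hσ
  have hf := (Finset.mem_filter.1 hσ).2.2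
  refine Finset.prod_nbij' (fun i => σ i) (fun i => σ i) ?_ ?_ ?_ ?_ ?_
  · intro i hi'
    simp only [Finset.mem_filter, Finset.mem_univ, true_and, hi, not_lt] at hi' ⊢
    exact lt_of_le_of_ne hi' (hf i)
  · intro i hi'
    simp only [Finset.mem_filter, Finset.mem_univ, true_and, hi, not_lt] at hi' ⊢
    exact hi'.le
  · intro i _; exact hi i
  · intro i _; exact hi i
  · intro i _
    rw [hi, hM.apply]

/-- A set of odd cardinality has no fixed point free involution, so the sum over these involutions
is empty. -/
theorem det_eq_zero_of_odd_card (h2 : (2 : R) = 0) {M : Matrix ι ι R} (hM : M.IsSymm)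
    (h0 : ∀ i, M i i = 0) (hodd : Odd (Fintype.card ι)) : M.det = 0 := by
  rw [det_eq_sum_freeInvolutions h2 hM h0]
  refine Finset.sum_eq_zero fun σ hσ => ?_
  exfalso
  have hf := (Finset.mem_filter.1 hσ).2.2
  have hi := apply_apply_of_mem_freeInvolutions hσ
  have hpow : σ ^ 2 ^ 1 = 1 := by
    ext i
    simp [sq, hi]
  have : Fact (Nat.Prime 2) := ⟨Nat.prime_two⟩
  obtain ⟨a, ha⟩ := Equiv.Perm.exists_fixed_point_of_prime (p := 2)
    (by rw [Nat.two_dvd_ne_zero]; exact Nat.odd_iff.1 hodd) hpow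
  exact hf a ha

/-- If all entries of an alternating matrix in at least three rows lie in an ideal, then the
Pfaffian lies in the square of the ideal. -/
theorem pfaffian_mem_sq [LinearOrder ι] {I : Ideal R} {M : Matrix ι ι R} (s : Finset ι)
    (hs : 3 ≤ s.card) (hl : ∀ i ∈ s, ∀ j, M i j ∈ I) (hr : ∀ i, ∀ j ∈ s, M i j ∈ I) :
    pfaffian M ∈ I ^ 2 := by
  refine Ideal.sum_mem _ fun σ hσ => ?_
  have hf := (Finset.mem_filter.1 hσ).2.2
  have hi := apply_apply_of_mem_freeInvolutions hσ
  -- Each `a` in `s` belongs to a pair `{b, σ b}` whose factor lies in `I`. Three indices do not fit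
  -- into one pair, so every product has two different factors in `I`.
  have key : ∀ a ∈ s, ∃ b, (b < σ b) ∧ M b (σ b) ∈ I ∧ (a = b ∨ a = σ b) := by
    intro a ha
    rcases lt_or_gt_of_ne (hf a).symm with h | h
    · exact ⟨a, h, hl a ha _, Or.inl rfl⟩
    · exact ⟨σ a, by rwa [hi], hr _ _ (by rwa [hi]), Or.inr (hi a).symm⟩
  obtain ⟨a, ha⟩ : s.Nonempty := Finset.card_pos.1 (by omega)
  obtain ⟨b, hb, hbI, -⟩ := key a ha
  obtain ⟨c, hc, hc'⟩ : ∃ c ∈ s, c ∉ ({b, σ b} : Finset ι) := by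
    by_contra! h
    have := (Finset.card_le_card (show s ⊆ {b, σ b} from h)).trans Finset.card_le_two
    omega
  obtain ⟨b', hb', hbI', hcb⟩ := key c hc
  have hne : b' ≠ b := by
    rintro rfl
    simp only [Finset.mem_insert, Finset.mem_singleton] at hc'
    exact hc' hcb
  rw [← Finset.mul_prod_erase _ _ (Finset.mem_filter.2 ⟨Finset.mem_univ b, hb⟩),
    ← Finset.mul_prod_erase _ _ (Finset.mem_erase.2 ⟨hne,
      Finset.mem_filter.2 ⟨Finset.mem_univ b', hb'⟩⟩), ← mul_assoc, sq]
  exact Ideal.mul_mem_right _ _ (Ideal.mul_mem_mul hbI hbI')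

end Alternating

end DualVariety
end

noncomputable section
namespace DualVariety

/-! ## Block elimination for alternating matrices with an invertible block -/

section Border

variable {R : Type*} [CommRing R] {κ : Type*} [Fintype κ] [DecidableEq κ]

/-- Two columns `z₀, z₁` with `M *ᵥ z_a` supported on the last two indices (in characteristic two):
`z_a` is the vector with components `adj(α) β_a` and `det α` times the unit vector `e_a`, where
`α` and `β` are the upper blocks of `M`. -/
def borderVec (M : Matrix (κ ⊕ Fin 2) (κ ⊕ Fin 2) R) (a : Fin 2) : κ ⊕ Fin 2 → R :=
  Sum.elim (fun i => (M.toBlocks₁₁.adjugate * M.toBlocks₁₂) i a)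
    (fun b => if b = a then M.toBlocks₁₁.det else 0)

/-- The value of the bilinear form `M` on the two vectors `borderVec M`. -/
def borderForm (M : Matrix (κ ⊕ Fin 2) (κ ⊕ Fin 2) R) : R :=
  borderVec M 0 ⬝ᵥ M.mulVec (borderVec M 1)

/-- The first components give `α adj(α) β = det(α) β` and the unit vector gives `det(α) β` once
more; the sum is zero in characteristic two. -/
theorem mulVec_borderVec_inl (h2 : (2 : R) = 0) (M : Matrix (κ ⊕ Fin 2) (κ ⊕ Fin 2) R)
    (a : Fin 2) (i : κ) : M.mulVec (borderVec M a) (Sum.inl i) = 0 := by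
  have h : (M.toBlocks₁₁ * (M.toBlocks₁₁.adjugate * M.toBlocks₁₂)) i a =
      M.toBlocks₁₁.det * M.toBlocks₁₂ i a := by
    rw [← Matrix.mul_assoc, Matrix.mul_adjugate, Matrix.smul_mul, Matrix.one_mul,
      Matrix.smul_apply, smul_eq_mul]
  rw [Matrix.mul_apply] at h
  simp only [Matrix.mulVec, dotProduct, Fintype.sum_sum_type, borderVec, Sum.elim_inl,
    Sum.elim_inr, mul_ite, mul_zero, Finset.sum_ite_eq', Finset.mem_univ, if_true]
  simp only [Matrix.toBlocks₁₁, Matrix.toBlocks₁₂, Matrix.of_apply] at h ⊢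
  rw [h]
  linear_combination (M (Sum.inl i) (Sum.inr a) *
    (Matrix.of fun i j => M (Sum.inl i) (Sum.inl j)).det) * h2

theorem borderVec_dotProduct (M : Matrix (κ ⊕ Fin 2) (κ ⊕ Fin 2) R) (a : Fin 2)
    {w : κ ⊕ Fin 2 → R} (hw : ∀ i, w (Sum.inl i) = 0) :
    borderVec M a ⬝ᵥ w = M.toBlocks₁₁.det * w (Sum.inr a) := by
  simp [dotProduct, Fintype.sum_sum_type, borderVec, hw]

theorem dotProduct_mulVec_comm_of_isSymm {ι : Type*} [Fintype ι] {M : Matrix ι ι R}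
    (hM : M.IsSymm) (x y : ι → R) : x ⬝ᵥ M.mulVec y = y ⬝ᵥ M.mulVec x := by
  rw [Matrix.dotProduct_mulVec, dotProduct_comm, ← Matrix.mulVec_transpose, hM.eq]

theorem dotProduct_mulVec_self_of_isSymm {ι : Type*} [Fintype ι] [DecidableEq ι]
    (h2 : (2 : R) = 0) {M : Matrix ι ι R}
    (hM : M.IsSymm) (h0 : ∀ i, M i i = 0) (x : ι → R) : x ⬝ᵥ M.mulVec x = 0 := by
  simp only [dotProduct, Matrix.mulVec, Finset.mul_sum]
  rw [← Finset.sum_product']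
  refine Finset.sum_involution (fun p _ => (p.2, p.1)) ?_ ?_ ?_ ?_
  · rintro ⟨i, j⟩ _
    rw [hM.apply i j]
    linear_combination (x i * (M i j * x j)) * h2
  · rintro ⟨i, j⟩ _ hne heq
    obtain rfl : j = i := congrArg Prod.fst heq
    exact hne (by rw [h0]; ring)
  · simp
  · simp

/-- Block elimination without division. Let the columns of `E` be the upper unit vectors and the two
border vectors. Then `Eᵀ M E` is block diagonal with blocks `α` and an alternating `2 × 2` matrix
`Z` with off-diagonal entry `borderForm M`. Now compare determinants, using `det E = det(α)²`. -/
theorem det_mul_borderForm_sq (h2 : (2 : R) = 0) {M : Matrix (κ ⊕ Fin 2) (κ ⊕ Fin 2) R}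
    (hM : M.IsSymm) (h0 : ∀ i, M i i = 0) :
    M.toBlocks₁₁.det * borderForm M ^ 2 = M.toBlocks₁₁.det ^ 4 * M.det := by
  set α := M.toBlocks₁₁ with hα
  set β := M.toBlocks₁₂ with hβ
  set d := α.det
  set C := α.adjugate * β
  let E : Matrix (κ ⊕ Fin 2) (κ ⊕ Fin 2) R := Matrix.fromBlocks 1 C 0 (d • 1)
  let Z : Matrix (Fin 2) (Fin 2) R :=
    Matrix.of fun a b => borderVec M a ⬝ᵥ M.mulVec (borderVec M b)
  have hcol : ∀ a i, E i (Sum.inr a) = borderVec M a i := by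
    rintro a (i | b)
    · rfl
    · simp [E, borderVec, Matrix.one_apply, d, hα]
  have hME : ∀ i a, (M * E) i (Sum.inr a) = M.mulVec (borderVec M a) i := by
    intro i a
    simp only [Matrix.mul_apply, hcol, Matrix.mulVec, dotProduct]
  have hEl : ∀ i j, E i (Sum.inl j) = (1 : Matrix (κ ⊕ Fin 2) (κ ⊕ Fin 2) R) i (Sum.inl j) := by
    rintro (i | i) j <;> simp [E, Matrix.one_apply]
  have hkey : E.transpose * (M * E) = Matrix.fromBlocks α 0 0 Z := by
    ext i j
    rcases i with i | a <;> rcases j with j | b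
    · simp [Matrix.mul_apply, hEl, Matrix.one_apply, hα, Matrix.toBlocks₁₁]
    · simp only [Matrix.mul_apply (M := E.transpose), hME, Matrix.transpose_apply, hEl,
        Matrix.one_apply, ite_mul, one_mul, zero_mul, Finset.sum_ite_eq', Finset.mem_univ,
        if_true, mulVec_borderVec_inl h2, Matrix.fromBlocks_apply₁₂, Matrix.zero_apply]
    · have : ∀ i, (M * E) i (Sum.inl j) = M i (Sum.inl j) := fun i => by
        simp [Matrix.mul_apply, hEl, Matrix.one_apply]
      simp only [Matrix.mul_apply (M := E.transpose), this, Matrix.transpose_apply, hcol,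
        Matrix.fromBlocks_apply₂₁, Matrix.zero_apply]
      rw [← mulVec_borderVec_inl h2 M a j]
      exact Finset.sum_congr rfl fun i _ => by rw [mul_comm, hM.apply]
    · simp only [Matrix.mul_apply (M := E.transpose), hME, Matrix.transpose_apply, hcol]
      rfl
  have hdet := congrArg Matrix.det hkey
  rw [Matrix.det_mul, Matrix.det_mul, Matrix.det_transpose, Matrix.det_fromBlocks_zero₂₁,
    Matrix.det_fromBlocks_zero₂₁, Matrix.det_one, one_mul, Matrix.det_smul, Matrix.det_one,
    Fintype.card_fin, mul_one, Matrix.det_fin_two] at hdet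
  have hZ : ∀ a, Z a a = 0 := fun a => dotProduct_mulVec_self_of_isSymm h2 hM h0 _
  have hZ' : Z 1 0 = Z 0 1 := dotProduct_mulVec_comm_of_isSymm hM _ _
  rw [hZ, hZ'] at hdet
  have hb : borderForm M = Z 0 1 := rfl
  rw [hb]
  linear_combination -hdet + (d * Z 0 1 ^ 2) * h2

/-- Pairing `M z_a` with `z_b` isolates its lower component `b`, multiplied by the unit `det α`. All
these pairings vanish: those with `a = b` because the form is alternating, the others by the
hypothesis on the border form. -/
theorem mulVec_borderVec_eq_zero (h2 : (2 : R) = 0) {M : Matrix (κ ⊕ Fin 2) (κ ⊕ Fin 2) R}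
    (hM : M.IsSymm) (h0 : ∀ i, M i i = 0) (hd : IsUnit M.toBlocks₁₁.det)
    (hb : borderForm M = 0) (a : Fin 2) : M.mulVec (borderVec M a) = 0 := by
  have key : ∀ b : Fin 2, M.mulVec (borderVec M a) (Sum.inr b) = 0 := by
    intro b
    have h := borderVec_dotProduct M b (mulVec_borderVec_inl h2 M a)
    have hz : borderVec M b ⬝ᵥ M.mulVec (borderVec M a) = 0 := by
      fin_cases a <;> fin_cases b
      · exact dotProduct_mulVec_self_of_isSymm h2 hM h0 _
      · exact (dotProduct_mulVec_comm_of_isSymm hM _ _).trans hb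
      · exact hb
      · exact dotProduct_mulVec_self_of_isSymm h2 hM h0 _
    rw [hz] at h
    exact (hd.mul_right_eq_zero).1 h.symm
  ext (i | b)
  · exact mulVec_borderVec_inl h2 M a i
  · exact key b

/-- A vector in the kernel of `M` is determined by its last two components. -/
theorem det_smul_eq_of_mulVec_eq_zero {M : Matrix (κ ⊕ Fin 2) (κ ⊕ Fin 2) R}
    (h2 : (2 : R) = 0) (hd : IsUnit M.toBlocks₁₁.det) {x : κ ⊕ Fin 2 → R}
    (hx : M.mulVec x = 0) :
    M.toBlocks₁₁.det • x = x (Sum.inr 0) • borderVec M 0 + x (Sum.inr 1) • borderVec M 1 := by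
  set d := M.toBlocks₁₁.det
  let y : κ ⊕ Fin 2 → R :=
    d • x - (x (Sum.inr 0) • borderVec M 0 + x (Sum.inr 1) • borderVec M 1)
  have hyr : ∀ b, y (Sum.inr b) = 0 := by
    intro b
    fin_cases b <;> simp [y, borderVec, d, mul_comm]
  have hyM : ∀ i, M.mulVec y (Sum.inl i) = 0 := by
    intro i
    simp [y, Matrix.mulVec_sub, Matrix.mulVec_add, Matrix.mulVec_smul, hx,
      mulVec_borderVec_inl h2]
  have hyl : M.toBlocks₁₁.mulVec (fun i => y (Sum.inl i)) = 0 := by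
    ext i
    rw [Pi.zero_apply, ← hyM i]
    simp [Matrix.mulVec, dotProduct, Fintype.sum_sum_type, hyr, Matrix.toBlocks₁₁]
  have hz : (fun i => y (Sum.inl i)) = 0 :=
    Matrix.mulVec_injective_of_isUnit ((Matrix.isUnit_iff_isUnit_det _).2 hd) (by simpa using hyl)
  have : y = 0 := by
    ext (i | b)
    · exact congrFun hz i
    · exact hyr b
  exact sub_eq_zero.1 this

end Border

end DualVariety
end

noncomputable section
namespace DualVariety

/-! ## Derivations and dual numbers -/

section DualNumbers

open TrivSqZeroExt

variable {k : Type*} [CommRing k] {B N : Type*} [CommRing B] [CommRing N] [Algebra k B]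
  [Algebra k N] [Algebra B N] [IsScalarTower k B N]

/-- The algebra homomorphism `b ↦ b + d b ε` attached to a derivation `d : B → N`. -/
def homOfDerivation (d : Derivation k B N) : B →ₐ[k] TrivSqZeroExt N N where
  toFun b := inl (algebraMap B N b) + inr (d b)
  map_one' := by ext <;> simp
  map_mul' a b := by
    ext
    · simp
    · simp only [Derivation.leibniz, Algebra.smul_def, map_mul, snd_add, snd_inl, snd_inr, snd_mul,
        fst_add, fst_inl, fst_inr, zero_add, add_zero, MulOpposite.smul_eq_mul_unop,
        MulOpposite.unop_op, Algebra.algebraMap_self, RingHom.id_apply]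
      ring
  map_zero' := by ext <;> simp
  map_add' a b := by ext <;> simp
  commutes' r := by
    ext
    · simp [← IsScalarTower.algebraMap_apply, TrivSqZeroExt.algebraMap_eq_inl']
    · simp [TrivSqZeroExt.algebraMap_eq_inl']

@[simp] theorem fst_homOfDerivation (d : Derivation k B N) (b : B) :
    (homOfDerivation d b).fst = algebraMap B N b := by
  simp [homOfDerivation]

@[simp] theorem snd_homOfDerivation (d : Derivation k B N) (b : B) :
    (homOfDerivation d b).snd = d b := by
  simp [homOfDerivation]

/-- The derivation `b ↦ snd (f b)` attached to a lift of `B → N` to the dual numbers. -/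
def derivationOfHom (f : B →+* TrivSqZeroExt N N)
    (hk : ∀ r : k, (f (algebraMap k B r)).snd = 0)
    (hf : ∀ b, (f b).fst = algebraMap B N b) :
    Derivation k B N :=
  Derivation.mk'
    { toFun := fun b => (f b).snd
      map_add' := fun a b => by simp
      map_smul' := fun r b => by
        simp [Algebra.smul_def, hf, hk, ← IsScalarTower.algebraMap_apply] }
    fun a b => by
      simp [hf, Algebra.smul_def, mul_comm]

@[simp] theorem derivationOfHom_apply (f : B →+* TrivSqZeroExt N N)
    (hk : ∀ r : k, (f (algebraMap k B r)).snd = 0)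
    (hf : ∀ b, (f b).fst = algebraMap B N b) (b : B) :
    derivationOfHom f hk hf b = (f b).snd := rfl

/-- Derivations extend to localizations. -/
theorem exists_derivation_of_isLocalization (M : Submonoid B) (B' : Type*) [CommRing B']
    [Algebra B B'] [IsLocalization M B'] [Algebra k B'] [IsScalarTower k B B'] [Algebra B' N]
    [IsScalarTower B B' N] [IsScalarTower k B' N] (d : Derivation k B N) :
    ∃ d' : Derivation k B' N, ∀ b, d' (algebraMap B B' b) = d b := by
  have hu : ∀ y : M, IsUnit ((homOfDerivation d : B →+* TrivSqZeroExt N N) y) := by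
    intro y
    rw [TrivSqZeroExt.isUnit_iff_isUnit_fst]
    simp only [RingHom.coe_coe, fst_homOfDerivation]
    rw [IsScalarTower.algebraMap_apply B B' N]
    exact (IsLocalization.map_units B' y).map _
  let f : B' →+* TrivSqZeroExt N N := IsLocalization.lift hu
  have hf : ∀ b, f (algebraMap B B' b) = homOfDerivation d b := fun b =>
    IsLocalization.lift_eq hu b
  have hfst : (TrivSqZeroExt.fstHom N N N).toRingHom.comp f = algebraMap B' N := by
    refine IsLocalization.ringHom_ext M ?_
    ext b
    simp [hf, ← IsScalarTower.algebraMap_apply]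
  refine ⟨derivationOfHom f (fun r => ?_) (fun b => congr($hfst b)), fun b => ?_⟩
  · rw [IsScalarTower.algebraMap_apply k B B', hf, snd_homOfDerivation, d.map_algebraMap]
  · simp [hf]

theorem derivation_ext_of_isLocalization {N : Type*} [AddCommGroup N] [Module k N]
    (M : Submonoid B) (B' : Type*) [CommRing B']
    [Algebra B B'] [IsLocalization M B'] [Algebra k B'] [IsScalarTower k B B'] [Module B' N]
    {d d' : Derivation k B' N} (h : ∀ b, d (algebraMap B B' b) = d' (algebraMap B B' b)) :
    d = d' := by
  ext x
  obtain ⟨b, s, rfl⟩ := IsLocalization.exists_mk'_eq M x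
  have hx := IsLocalization.mk'_spec B' b s
  set x := IsLocalization.mk' B' b s
  have h1 := congrArg d hx
  have h2 := congrArg d' hx
  rw [Derivation.leibniz] at h1 h2
  rw [h b, ← h2, h s, add_right_inj] at h1
  exact ((IsLocalization.map_units B' s).smul_left_cancel).1 h1

/-- A derivation which vanishes on an ideal descends to the quotient. -/
theorem exists_derivation_quotient (I : Ideal B) [Algebra (B ⧸ I) N] [IsScalarTower B (B ⧸ I) N]
    [IsScalarTower k (B ⧸ I) N] (d : Derivation k B N) (hd : ∀ b ∈ I, d b = 0) :
    ∃ d' : Derivation k (B ⧸ I) N, ∀ b, d' (Ideal.Quotient.mk I b) = d b := by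
  have hI : ∀ b ∈ I, (homOfDerivation d : B →+* TrivSqZeroExt N N) b = 0 := by
    intro b hb
    ext
    · simp [IsScalarTower.algebraMap_apply B (B ⧸ I) N, Ideal.Quotient.eq_zero_iff_mem.2 hb]
    · simp [hd b hb]
  refine ⟨derivationOfHom (Ideal.Quotient.lift I _ hI) (fun r => ?_) (fun b => ?_), fun b => ?_⟩
  · exact (snd_homOfDerivation d _).trans (d.map_algebraMap r)
  · obtain ⟨b, rfl⟩ := Ideal.Quotient.mk_surjective b
    simp [IsScalarTower.algebraMap_apply B (B ⧸ I) N]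
  · exact snd_homOfDerivation d b

/-- Derivations of a polynomial ring with prescribed values on coefficients and variables. -/
theorem exists_derivation_mvPolynomial {A : Type*} [CommRing A] [Algebra k A] {σ : Type*}
    {N : Type*} [CommRing N] [Algebra k N] [Algebra A N] [IsScalarTower k A N]
    [Algebra (MvPolynomial σ A) N] [IsScalarTower A (MvPolynomial σ A) N]
    [IsScalarTower k (MvPolynomial σ A) N]
    (d : Derivation k A N) (b : σ → N) :
    ∃ v : Derivation k (MvPolynomial σ A) N,
      (∀ a, v (MvPolynomial.C a) = d a) ∧ ∀ j, v (MvPolynomial.X j) = b j := by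
  let f : MvPolynomial σ A →+* TrivSqZeroExt N N :=
    MvPolynomial.eval₂Hom (homOfDerivation d : A →+* TrivSqZeroExt N N)
      (fun j => inl (algebraMap (MvPolynomial σ A) N (MvPolynomial.X j)) + inr (b j))
  have hfst : (TrivSqZeroExt.fstHom N N N).toRingHom.comp f =
      algebraMap (MvPolynomial σ A) N := by
    refine MvPolynomial.ringHom_ext (fun a => ?_) (fun j => ?_)
    · simp [f, IsScalarTower.algebraMap_apply A (MvPolynomial σ A) N, MvPolynomial.algebraMap_eq]
    · simp [f]
  refine ⟨derivationOfHom f (fun r => ?_) (fun b => congr($hfst b)), fun a => ?_, fun j => ?_⟩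
  · rw [IsScalarTower.algebraMap_apply k A (MvPolynomial σ A), MvPolynomial.algebraMap_eq]
    simp only [f, MvPolynomial.coe_eval₂Hom, MvPolynomial.eval₂_C, RingHom.coe_coe,
      snd_homOfDerivation, d.map_algebraMap]
  · simp [f]
  · simp [f]

end DualNumbers

/-! ## Frames of the tangent bundle of a smooth algebra -/

section Frames

variable {k : Type*} [CommRing k] {A : Type*} [CommRing A] [Algebra k A]

variable {ι : Type*} [Fintype ι]

/-- The derivation with given coefficients in a frame. -/
def combination (D : ι → Derivation k A A) {N : Type*} [AddCommGroup N]
    [Module A N] [Module k N] [IsScalarTower k A N] (c : ι → N) : Derivation k A N :=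
  ∑ i, (LinearMap.toSpanSingleton A N (c i)).compDer (D i)

theorem combination_apply (D : ι → Derivation k A A) {N : Type*} [AddCommGroup N]
    [Module A N] [Module k N] [IsScalarTower k A N] (c : ι → N) (a : A) :
    combination D c a = ∑ i, D i a • c i := by
  have : ∀ s : Finset ι, (∑ i ∈ s, (LinearMap.toSpanSingleton A N (c i)).compDer (D i)) a =
      ∑ i ∈ s, D i a • c i := by
    classical
    intro s
    induction s using Finset.induction_on with
    | empty => simp
    | insert i s hi ih => 
      rw [Finset.sum_insert hi, Finset.sum_insert hi, Derivation.add_apply, ih]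
      simp
  exact this _

variable [Algebra.FormallySmooth k A] [Algebra.FiniteType k A]

/-- A frame of the tangent bundle is dual to a basis of the module of differentials. -/
theorem exists_dual_basis (D : Module.Basis ι A (Derivation k A A)) :
    ∃ ω : ι → Ω[A⁄k], (∀ x : Ω[A⁄k], x = ∑ i, (D i).liftKaehlerDifferential x • ω i) ∧
      ∀ i, (∀ j, j ≠ i → (D j).liftKaehlerDifferential (ω i) = 0) ∧
        (D i).liftKaehlerDifferential (ω i) = 1 := by
  classical
  have : Algebra.EssFiniteType k A := inferInstance
  have : Module.Finite A Ω[A⁄k] := inferInstance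
  have : Module.Projective A Ω[A⁄k] := inferInstance
  have : Module.IsReflexive A Ω[A⁄k] := inferInstance
  let D' : Module.Basis ι A (Module.Dual A Ω[A⁄k]) :=
    D.map (KaehlerDifferential.linearMapEquivDerivation k A).symm
  -- The basis dual to the frame lives in the double dual of the module of differentials. That
  -- module is finite projective, hence reflexive, so the dual basis consists of differentials.
  let ev := Module.evalEquiv A Ω[A⁄k]
  have hD' : ∀ i x, D' i x = (D i).liftKaehlerDifferential x := fun i x => rfl
  have hev : ∀ i j, (D j).liftKaehlerDifferential (ev.symm (D'.dualBasis i)) =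
      if j = i then 1 else 0 := by
    intro i j
    have h : ev (ev.symm (D'.dualBasis i)) (D' j) = if j = i then 1 else 0 := by
      rw [LinearEquiv.apply_symm_apply, Module.Basis.dualBasis_apply_self]
    exact h
  refine ⟨fun i => ev.symm (D'.dualBasis i), fun x => ?_,
    fun i => ⟨fun j hj => by rw [hev, if_neg hj], by rw [hev, if_pos rfl]⟩⟩
  apply ev.injective
  rw [map_sum]
  refine D'.ext fun i => ?_
  simp [ev, hD', Finsupp.single_apply]

theorem derivation_eq_sum (D : Module.Basis ι A (Derivation k A A)) {N : Type*} [AddCommGroup N]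
    [Module A N] [Module k N] [IsScalarTower k A N] (d : Derivation k A N) :
    ∃ c : ι → N, ∀ a, d a = ∑ i, D i a • c i := by
  obtain ⟨ω, hω, -⟩ := exists_dual_basis D
  refine ⟨fun i => d.liftKaehlerDifferential (ω i), fun a => ?_⟩
  have h := congrArg d.liftKaehlerDifferential (hω (KaehlerDifferential.D k A a))
  simpa using h

/-- The coefficients of a derivation in a frame are unique. -/
theorem eq_zero_of_sum_smul_eq_zero (D : Module.Basis ι A (Derivation k A A)) {N : Type*}
    [AddCommGroup N] [Module A N] {c : ι → N} (hc : ∀ a, ∑ i, D i a • c i = 0) : c = 0 := by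
  classical
  obtain ⟨ω, -, hdual⟩ := exists_dual_basis D
  let l : Ω[A⁄k] →ₗ[A] N :=
    ∑ i, (LinearMap.toSpanSingleton A N (c i)).comp (D i).liftKaehlerDifferential
  have hl : l = 0 := by
    refine LinearMap.ext_on (KaehlerDifferential.span_range_derivation k A) ?_
    rintro _ ⟨a, rfl⟩
    simpa [l] using hc a
  ext i
  have := congr($hl (ω i))
  simp only [l, LinearMap.sum_apply, LinearMap.comp_apply, LinearMap.toSpanSingleton_apply,
    LinearMap.zero_apply] at this
  rw [Finset.sum_eq_single i (fun j _ hj => by rw [(hdual i).1 j hj, zero_smul]) (by simp),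
    (hdual i).2, one_smul] at this
  exact this

end Frames

end DualVariety
end

noncomputable section
namespace DualVariety

/-! ## The critical ideal and the universal Hessian -/

section LinearForm

variable {A : Type*} [CommRing A] {m : ℕ}

theorem linearForm_add (g h : Fin (m + 1) → A) :
    linearForm (fun l => g l + h l) = linearForm g + linearForm h := by
  simp only [linearForm, map_add, mul_add, Finset.sum_add_distrib]
  ring

theorem linearForm_sub (g h : Fin (m + 1) → A) :
    linearForm (fun l => g l - h l) = linearForm g - linearForm h := by
  simp only [linearForm, map_sub, mul_sub, Finset.sum_sub_distrib]
  ring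

theorem linearForm_mul (a : A) (g : Fin (m + 1) → A) :
    linearForm (fun l => a * g l) = MvPolynomial.C a * linearForm g := by
  simp only [linearForm, map_mul, mul_add, Finset.mul_sum]
  congr 1
  exact Finset.sum_congr rfl fun j _ => by ring

theorem linearForm_zero : linearForm (fun _ : Fin (m + 1) => (0 : A)) = 0 := by
  simp [linearForm]

theorem linearForm_sum {ι : Type*} (s : Finset ι) (g : ι → Fin (m + 1) → A) :
    linearForm (fun l => ∑ i ∈ s, g i l) = ∑ i ∈ s, linearForm (g i) := by
  classical
  induction s using Finset.induction_on with
  | empty => simp [linearForm_zero]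
  | insert i s hi ih => simp only [Finset.sum_insert hi, linearForm_add, ih]

variable {k : Type*} [CommRing k] [Algebra k A] {N : Type*} [AddCommGroup N]
  [Module (MvPolynomial (Fin m) A) N] [Module k N]

theorem derivation_linearForm (v : Derivation k (MvPolynomial (Fin m) A) N)
    (g : Fin (m + 1) → A) :
    v (linearForm g) = v (MvPolynomial.C (g 0)) +
      ∑ j : Fin m, ((MvPolynomial.X j : MvPolynomial (Fin m) A) • v (MvPolynomial.C (g j.succ)) +
        (MvPolynomial.C (g j.succ) : MvPolynomial (Fin m) A) • v (MvPolynomial.X j)) := by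
  simp [linearForm]

theorem derivation_linearForm_eq_sum {ι : Type*} [Fintype ι] {D : ι → Derivation k A A}
    {v : Derivation k (MvPolynomial (Fin m) A) N} {c : ι → N}
    (hc : ∀ a, v (MvPolynomial.C a) =
      ∑ i, (MvPolynomial.C (D i a) : MvPolynomial (Fin m) A) • c i)
    (g : Fin (m + 1) → A) :
    v (linearForm g) = ∑ i, linearForm (fun l => D i (g l)) • c i +
      ∑ j : Fin m, (MvPolynomial.C (g j.succ) : MvPolynomial (Fin m) A) • v (MvPolynomial.X j) := by
  rw [derivation_linearForm, Finset.sum_add_distrib, ← add_assoc]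
  congr 1
  simp only [hc, linearForm, add_smul, Finset.sum_add_distrib, Finset.sum_smul, mul_smul,
    Finset.smul_sum]
  rw [Finset.sum_comm]

end LinearForm

section CharTwo

variable {k : Type*} [CommRing k] {A : Type*} [CommRing A] [Algebra k A]

/-- In characteristic two, the square of a derivation is a derivation. -/
def derivationSq (h2 : (2 : A) = 0) (d : Derivation k A A) : Derivation k A A :=
  Derivation.mk' (d.toLinearMap.comp d.toLinearMap) fun a b => by
    simp only [LinearMap.comp_apply, Derivation.coeFn_coe, Derivation.leibniz, smul_eq_mul,
      map_add]
    linear_combination (d a * d b) * h2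

@[simp] theorem derivationSq_apply (h2 : (2 : A) = 0) (d : Derivation k A A) (a : A) :
    derivationSq h2 d a = d (d a) := rfl

end CharTwo

section CriticalIdeal

variable {k : Type*} [Field k] {A : Type*} [CommRing A] [Algebra k A] {m : ℕ}
  {φ : Fin (m + 1) → A}

/-- The ideal generated by the local equation of the family and its derivatives along a frame. -/
def jacobianIdeal {ι : Type*} (φ : Fin (m + 1) → A) (D : ι → Derivation k A A) :
    Ideal (MvPolynomial (Fin m) A) :=
  Ideal.span (insert (linearForm φ) (Set.range fun i => linearForm fun l => D i (φ l)))

theorem linearForm_mem_jacobianIdeal {ι : Type*} (D : ι → Derivation k A A) :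
    linearForm φ ∈ jacobianIdeal φ D :=
  Ideal.subset_span (Set.mem_insert _ _)

theorem linearForm_derivation_mem_jacobianIdeal {ι : Type*} (D : ι → Derivation k A A) (i : ι) :
    (linearForm fun l => D i (φ l)) ∈ jacobianIdeal φ D :=
  Ideal.subset_span (Set.mem_insert_of_mem _ ⟨i, rfl⟩)

theorem jacobianIdeal_le {ι : Type*} (D : ι → Derivation k A A)
    {I : Ideal (MvPolynomial (Fin m) A)} (h0 : linearForm φ ∈ I)
    (h : ∀ i, (linearForm fun l => D i (φ l)) ∈ I) : jacobianIdeal φ D ≤ I := by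
  refine Ideal.span_le.2 (Set.insert_subset h0 ?_)
  rintro _ ⟨i, rfl⟩
  exact h i

/-- As `φ_m = 1`, the coordinate `y_m` can absorb any condition for tangency to the family. The
fields `∂/∂y_j - φ_j ∂/∂y_m` for `j < m` and `∂_i - (∂_iΦ) ∂/∂y_m` are tangent to it, and their
values on `y_1, …, y_m` form a triangular matrix of determinant `-∂_iΦ`. -/
theorem jacobianIdeal_le_criticalIdeal {ι : Type*} (D : ι → Derivation k A A)
    (hm : 0 < m) (hφ : φ (Fin.last m) = 1) :
    jacobianIdeal φ D ≤ criticalIdeal k φ := by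
  obtain ⟨m, rfl⟩ : ∃ m', m = m' + 1 := ⟨m - 1, by omega⟩
  refine jacobianIdeal_le D ?_ fun i => ?_
  · rw [criticalIdeal, Ideal.mem_comap,
      Ideal.Quotient.eq_zero_iff_mem.2 (Ideal.mem_span_singleton_self _)]
    exact Ideal.zero_mem _
  let S := MvPolynomial (Fin (m + 1)) A
  let F := FamilyRing φ
  let q : S →+* F := Ideal.Quotient.mk _
  have hq : q (linearForm φ) = 0 :=
    Ideal.Quotient.eq_zero_iff_mem.2 (Ideal.mem_span_singleton_self _)
  have hlast : ∀ {N : Type _} [AddCommGroup N] [Module S N] (f : Fin (m + 1) → N),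
      ∑ j : Fin (m + 1), (MvPolynomial.C (φ j.succ) : S) • f j =
        ∑ j : Fin m, (MvPolynomial.C (φ j.castSucc.succ) : S) • f j.castSucc + f (Fin.last m) := by
    intro N _ _ f
    rw [Fin.sum_univ_castSucc, Fin.succ_last, hφ, map_one, one_smul]
  -- the vector fields of the family
  have hder : ∀ (d : Derivation k A F) (b : Fin (m + 1) → F),
      d (φ 0) + ∑ j, (q (MvPolynomial.X j) * d (φ j.succ) +
        q (MvPolynomial.C (φ j.succ)) * b j) = 0 →
      ∃ Θ : Derivation k F F, ∀ j, Θ (q (MvPolynomial.X j)) = b j := by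
    intro d b h
    obtain ⟨v, hvC, hvX⟩ := exists_derivation_mvPolynomial d b
    obtain ⟨Θ, hΘ⟩ := exists_derivation_quotient (Ideal.span {linearForm φ}) v (fun s hs => by
      obtain ⟨t, rfl⟩ := Ideal.mem_span_singleton'.1 hs
      have h1 : v (linearForm φ) = 0 := by
        rw [derivation_linearForm]
        simp only [hvC, hvX]
        exact h
      rw [Derivation.leibniz, h1, smul_zero, zero_add]
      change q (linearForm φ) * _ = 0
      rw [hq, zero_mul])
    exact ⟨Θ, fun j => (hΘ _).trans (hvX j)⟩
  -- the last row
  let δ : F := q (linearForm fun l => D i (φ l))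
  let row : Fin (m + 1) → Fin (m + 1) → F := fun a b =>
    if a = Fin.last m then (if b = Fin.last m then -δ else 0)
    else if b = Fin.last m then -q (MvPolynomial.C (φ a.succ)) else if a = b then 1 else 0
  have hrow : ∀ a, ∃ Θ : Derivation k F F, ∀ j, Θ (q (MvPolynomial.X j)) = row a j := by
    intro a
    by_cases ha : a = Fin.last m
    · let d : Derivation k A F := (Algebra.linearMap A F).compDer (D i)
      have hd : ∀ a, d a = q (MvPolynomial.C (D i a)) := fun a => rfl
      refine hder d (row a) ?_
      simp only [Finset.sum_add_distrib, hd, ← add_assoc]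
      have h1 : q (MvPolynomial.C (D i (φ 0))) +
          ∑ j : Fin (m + 1), q (MvPolynomial.X j) * q (MvPolynomial.C (D i (φ j.succ))) = δ := by
        simp only [δ, linearForm, map_add, map_sum, map_mul]
      have h2 := hlast (row a)
      simp only [row, ha, if_true, Fin.castSucc_ne_last, if_false, smul_zero,
        Finset.sum_const_zero, zero_add] at h2
      rw [h1, ha]
      change δ + ∑ j : Fin (m + 1), (MvPolynomial.C (φ j.succ) : S) • row (Fin.last m) j = 0
      simp only [row, if_true]
      rw [h2]
      ring
    · refine hder 0 (row a) ?_
      simp only [Derivation.zero_apply, mul_zero, zero_add]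
      change ∑ j : Fin (m + 1), (MvPolynomial.C (φ j.succ) : S) • row a j = 0
      obtain ⟨a, rfl⟩ := Fin.exists_castSucc_eq.2 ha
      rw [hlast (row a.castSucc)]
      simp only [row, Fin.castSucc_ne_last, if_false, if_true, Fin.castSucc_inj, smul_ite,
        smul_zero, Finset.sum_ite_eq, Finset.mem_univ]
      change q _ * 1 + -q _ = 0
      ring
  choose Θ hΘ using hrow
  have hdet : Matrix.det (Matrix.of fun a b => Θ a (q (MvPolynomial.X b))) = -δ := by
    have : (Matrix.of fun a b => Θ a (q (MvPolynomial.X b))) = Matrix.of row := by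
      ext a b
      exact hΘ a b
    rw [this, Matrix.det_of_isUpperTriangular]
    · rw [Fin.prod_univ_castSucc]
      simp [row, Fin.castSucc_ne_last]
    · intro a b hab
      change b < a at hab
      have hb : b ≠ Fin.last m := (hab.trans_le (Fin.le_last a)).ne
      simp [row, hb, hab.ne']
  rw [criticalIdeal, Ideal.mem_comap]
  have : -δ ∈ Ideal.span {δ : FamilyRing φ | ∃ Θ : Fin (m + 1) → Derivation k F F,
      δ = Matrix.det (Matrix.of fun a b => Θ a (q (MvPolynomial.X b)))} :=
    Ideal.subset_span ⟨Θ, hdet.symm⟩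
  exact (neg_mem_iff).1 this

variable [Algebra.FormallySmooth k A] [Algebra.FiniteType k A] {ι : Type*} [Fintype ι]

/-- A vector field `Θ` of the family kills `Φ`; modulo the Jacobian ideal the contribution of the
directions along `X` is zero, and there remains `∑ φ_j Θ(y_j) = 0`. So the matrix of any `m` fields
kills the vector `(φ_1, …, φ_m)`. Multiplication by the adjugate shows that its determinant kills
the last component of this vector, which is `1`. -/
theorem criticalIdeal_le_jacobianIdeal (D : Module.Basis ι A (Derivation k A A))
    (hm : 0 < m) (hφ : φ (Fin.last m) = 1) :
    criticalIdeal k φ ≤ jacobianIdeal φ D := by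
  obtain ⟨m, rfl⟩ : ∃ m', m = m' + 1 := ⟨m - 1, by omega⟩
  let S := MvPolynomial (Fin (m + 1)) A
  let F := FamilyRing φ
  let J := jacobianIdeal φ D
  let q : S →+* F := Ideal.Quotient.mk _
  have hle : Ideal.span {linearForm φ} ≤ J :=
    (Ideal.span_singleton_le_iff_mem _).2 (linearForm_mem_jacobianIdeal _)
  let ρ : F →ₐ[S] S ⧸ J := Ideal.Quotient.factorₐ S hle
  have hρ : ∀ s : S, ρ (q s) = Ideal.Quotient.mk J s := fun s => rfl
  have key : Ideal.span {δ : FamilyRing φ | ∃ Θ : Fin (m + 1) → Derivation k F F,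
      δ = Matrix.det (Matrix.of fun a b => Θ a (q (MvPolynomial.X b)))} ≤
      RingHom.ker (ρ : F →+* S ⧸ J) := by
    refine Ideal.span_le.2 ?_
    rintro _ ⟨Θ, rfl⟩
    rw [SetLike.mem_coe, RingHom.mem_ker, RingHom.map_det]
    let w : Fin (m + 1) → S ⧸ J := fun j => Ideal.Quotient.mk J (MvPolynomial.C (φ j.succ))
    set M := (ρ : F →+* S ⧸ J).mapMatrix (Matrix.of fun a b => Θ a (q (MvPolynomial.X b)))
    have hM : M.mulVec w = 0 := by
      ext a
      let v : Derivation k S (S ⧸ J) :=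
        (ρ.toLinearMap.restrictScalars S).compDer ((Θ a).compAlgebraMap S)
      have hv : ∀ s, v s = ρ (Θ a (q s)) := fun s => rfl
      obtain ⟨c, hc⟩ := derivation_eq_sum D (v.compAlgebraMap A)
      have h0 : v (linearForm φ) = 0 := by
        have : q (linearForm φ) = 0 :=
          Ideal.Quotient.eq_zero_iff_mem.2 (Ideal.mem_span_singleton_self _)
        rw [hv, this, map_zero, map_zero]
      rw [derivation_linearForm_eq_sum (D := D) (c := c) (fun a => ?_)] at h0
      · rw [Finset.sum_eq_zero, zero_add] at h0
        · rw [Pi.zero_apply, ← h0]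
          change ∑ j, M a j * w j = ∑ j, w j * M a j
          exact Finset.sum_congr rfl fun j _ => mul_comm _ _
        · intro i _
          change Ideal.Quotient.mk J (linearForm fun l => D i (φ l)) * c i = 0
          rw [Ideal.Quotient.eq_zero_iff_mem.2 (linearForm_derivation_mem_jacobianIdeal _ i),
            zero_mul]
      · have h := hc a
        change v (MvPolynomial.C a) = _ at h
        rw [h]
        exact Finset.sum_congr rfl fun i _ => (algebraMap_smul S (D i a) (c i)).symm
    have h := congrArg (M.adjugate.mulVec) hM
    rw [Matrix.mulVec_mulVec, Matrix.adjugate_mul, Matrix.mulVec_zero, Matrix.smul_mulVec,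
      Matrix.one_mulVec] at h
    have h' := congrFun h (Fin.last m)
    simpa [w, hφ] using h'
  intro f hf
  have := key hf
  exact Ideal.Quotient.eq_zero_iff_mem.1 this

theorem criticalIdeal_eq (D : Module.Basis ι A (Derivation k A A))
    (hm : 0 < m) (hφ : φ (Fin.last m) = 1) :
    criticalIdeal k φ = jacobianIdeal φ D :=
  le_antisymm (criticalIdeal_le_jacobianIdeal D hm hφ) (jacobianIdeal_le_criticalIdeal D hm hφ)

end CriticalIdeal

end DualVariety
end

noncomputable section
namespace DualVariety

/-! ## The universal Hessian on the critical scheme -/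

section Hessian

variable {k : Type*} [Field k] {A : Type*} [CommRing A] [Algebra k A] {m : ℕ}
  {ι : Type*}

/-- The matrix `(∂_i ∂_j Φ)` for a family of derivations with an arbitrary index type. -/
def hessian (φ : Fin (m + 1) → A) (D : ι → Derivation k A A) :
    Matrix ι ι (MvPolynomial (Fin m) A) :=
  Matrix.of fun i j => linearForm fun l => D i (D j (φ l))

/-- The third derivatives `∂_l ∂_i ∂_j Φ`. -/
def thirdDerivative (φ : Fin (m + 1) → A) (D : ι → Derivation k A A) (l i j : ι) :
    MvPolynomial (Fin m) A :=
  linearForm fun s => D l (D i (D j (φ s)))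

variable {φ : Fin (m + 1) → A} [Fintype ι] (D : Module.Basis ι A (Derivation k A A))
  {N : Type*} [CommRing N] [Algebra (MvPolynomial (Fin m) A) N]

theorem linearForm_derivation_eq_sum (d : Derivation k A A) (g : Fin (m + 1) → A) :
    linearForm (fun l => d (g l)) =
      ∑ i, MvPolynomial.C (D.repr d i) * linearForm (fun l => D i (g l)) := by
  simp only [← linearForm_mul, ← linearForm_sum]
  congr 1
  ext l
  conv_lhs => rw [← D.sum_repr d]
  have : ∀ s : Finset ι, (∑ i ∈ s, D.repr d i • D i) (g l) =
      ∑ i ∈ s, D.repr d i * D i (g l) := by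
    classical
    intro s
    induction s using Finset.induction_on with
    | empty => simp
    | insert i s hi ih =>
      rw [Finset.sum_insert hi, Finset.sum_insert hi, Derivation.add_apply, ih]
      simp
  exact this _

theorem linearForm_any_derivation_mem (d : Derivation k A A) :
    (linearForm fun l => d (φ l)) ∈ jacobianIdeal φ D := by
  rw [linearForm_derivation_eq_sum D]
  exact Ideal.sum_mem _ fun i _ =>
    Ideal.mul_mem_left _ _ (linearForm_derivation_mem_jacobianIdeal D i)

/-- The commutator of two derivations is a derivation, and derivatives of `Φ` along any vector field
lie in the ideal. -/
theorem hessian_sub_mem (i j : ι) :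
    hessian φ D i j - hessian φ D j i ∈ jacobianIdeal φ D := by
  have h := linearForm_any_derivation_mem (φ := φ) D ⁅D i, D j⁆
  simp only [Derivation.commutator_apply, linearForm_sub] at h
  exact h

/-- In characteristic two `∂_i²` is a derivation, so this is again a first derivative of `Φ`. -/
theorem hessian_self_mem (h2 : (2 : A) = 0) (i : ι) :
    hessian φ D i i ∈ jacobianIdeal φ D :=
  linearForm_any_derivation_mem (φ := φ) D (derivationSq h2 (D i))

variable (hN : ∀ s ∈ jacobianIdeal φ D, algebraMap (MvPolynomial (Fin m) A) N s = 0)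

include hN in
theorem hessian_map_isSymm :
    ((hessian φ D).map (algebraMap (MvPolynomial (Fin m) A) N)).IsSymm := by
  refine Matrix.IsSymm.ext fun i j => ?_
  have h := hN _ (hessian_sub_mem D j i)
  rw [map_sub, sub_eq_zero] at h
  exact h

include hN in
theorem hessian_map_self (h2 : (2 : A) = 0) (i : ι) :
    (hessian φ D).map (algebraMap (MvPolynomial (Fin m) A) N) i i = 0 :=
  hN _ (hessian_self_mem D h2 i)

/-- The trilinear form of third derivatives, with values in an algebra over the coordinate
ring. -/
def tripleForm (φ : Fin (m + 1) → A) (D : ι → Derivation k A A) (x y z : ι → N) : N :=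
  ∑ l, ∑ i, ∑ j, x l * (y i *
    (z j * algebraMap (MvPolynomial (Fin m) A) N (thirdDerivative φ D l i j)))

variable {x y z : ι → N}

/-- Expanding `d` in the frame makes the second derivatives `d ∂_j Φ` a combination of rows of the
Hessian, and each row is orthogonal to `z`. -/
theorem sum_mul_linearForm_derivation_eq_zero (d : Derivation k A A)
    (hz : ((hessian φ D).map (algebraMap (MvPolynomial (Fin m) A) N)).mulVec z = 0) :
    ∑ j, z j * algebraMap (MvPolynomial (Fin m) A) N (linearForm fun l => d (D j (φ l))) = 0 := by
  simp only [linearForm_derivation_eq_sum D d, map_sum, map_mul, Finset.mul_sum]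
  rw [Finset.sum_comm]
  refine Finset.sum_eq_zero fun i _ => ?_
  have h := congrFun hz i
  simp only [Matrix.mulVec, dotProduct, Matrix.map_apply, Pi.zero_apply] at h
  rw [← mul_zero (algebraMap (MvPolynomial (Fin m) A) N (MvPolynomial.C (D.repr d i))), ← h,
    Finset.mul_sum]
  refine Finset.sum_congr rfl fun j _ => ?_
  change _ = _ * (algebraMap _ N (linearForm fun l => D i (D j (φ l))) * z j)
  ring

include hN in
theorem sum_mul_linearForm_derivation_eq_zero' (d : Derivation k A A)
    (hz : ((hessian φ D).map (algebraMap (MvPolynomial (Fin m) A) N)).mulVec z = 0) :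
    ∑ j, z j * algebraMap (MvPolynomial (Fin m) A) N (linearForm fun l => D j (d (φ l))) = 0 := by
  rw [← sum_mul_linearForm_derivation_eq_zero D d hz]
  refine Finset.sum_congr rfl fun j _ => ?_
  have h := hN _ (linearForm_any_derivation_mem (φ := φ) D ⁅D j, d⁆)
  simp only [Derivation.commutator_apply, linearForm_sub, map_sub, sub_eq_zero] at h
  rw [h]

include hN in
-- Exchanging the two inner derivatives changes the form by terms `∑ x_l ∂_l [∂_i, ∂_j] Φ`. The
-- commutator is a vector field, so these terms vanish for `x` in the kernel of the Hessian.
theorem tripleForm_swap_right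
    (hx : ((hessian φ D).map (algebraMap (MvPolynomial (Fin m) A) N)).mulVec x = 0) :
    tripleForm φ D x y z = tripleForm φ D x z y := by
  have h : ∀ i j, ∑ l, x l * algebraMap (MvPolynomial (Fin m) A) N (thirdDerivative φ D l i j) =
      ∑ l, x l * algebraMap (MvPolynomial (Fin m) A) N (thirdDerivative φ D l j i) := by
    intro i j
    rw [← sub_eq_zero, ← Finset.sum_sub_distrib,
      ← sum_mul_linearForm_derivation_eq_zero' D hN ⁅D i, D j⁆ hx]
    refine Finset.sum_congr rfl fun l _ => ?_
    simp only [Derivation.commutator_apply, map_sub, linearForm_sub, mul_sub, thirdDerivative]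
  have e : ∀ y z : ι → N, tripleForm φ D x y z = ∑ i, ∑ j, y i * (z j *
      ∑ l, x l * algebraMap (MvPolynomial (Fin m) A) N (thirdDerivative φ D l i j)) := by
    intro y z
    rw [tripleForm, Finset.sum_comm]
    refine Finset.sum_congr rfl fun i _ => ?_
    rw [Finset.sum_comm]
    refine Finset.sum_congr rfl fun j _ => ?_
    rw [Finset.mul_sum, Finset.mul_sum]
    exact Finset.sum_congr rfl fun l _ => by ring
  rw [e, e, Finset.sum_comm]
  refine Finset.sum_congr rfl fun i _ => Finset.sum_congr rfl fun j _ => ?_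
  rw [h]
  ring

/-- For `z` in the kernel, the bilinear form obtained by fixing the last argument is alternating:
its failure of symmetry involves `[∂_i, ∂_l]`, its diagonal involves `∂_i²`. Both are vector fields,
and second derivatives along a vector field pair to zero with `z`. -/
theorem tripleForm_self (h2 : (2 : A) = 0)
    (hz : ((hessian φ D).map (algebraMap (MvPolynomial (Fin m) A) N)).mulVec z = 0) :
    tripleForm φ D x x z = 0 := by
  classical
  have h2N : (2 : N) = 0 := by
    have := congrArg (fun a => algebraMap (MvPolynomial (Fin m) A) N (MvPolynomial.C a)) h2
    simpa only [map_ofNat, map_zero] using this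
  let G : Matrix ι ι N := Matrix.of fun l i =>
    ∑ j, z j * algebraMap (MvPolynomial (Fin m) A) N (thirdDerivative φ D l i j)
  have hG : G.IsSymm := by
    refine Matrix.IsSymm.ext fun l i => ?_
    change ∑ j, _ = ∑ j, _
    rw [← sub_eq_zero, ← Finset.sum_sub_distrib,
      ← sum_mul_linearForm_derivation_eq_zero D ⁅D i, D l⁆ hz]
    refine Finset.sum_congr rfl fun j _ => ?_
    simp only [Derivation.commutator_apply, linearForm_sub, map_sub, mul_sub, thirdDerivative]
  have hG0 : ∀ i, G i i = 0 := fun i =>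
    sum_mul_linearForm_derivation_eq_zero D (derivationSq h2 (D i)) hz
  rw [← dotProduct_mulVec_self_of_isSymm h2N hG hG0 x]
  simp only [tripleForm, dotProduct, Matrix.mulVec, G, Matrix.of_apply, Finset.mul_sum,
    Finset.sum_mul]
  refine Finset.sum_congr rfl fun l _ => Finset.sum_congr rfl fun i _ =>
    Finset.sum_congr rfl fun j _ => ?_
  ring

end Hessian

/-! ## Derivatives of the local equation -/

section BorderDerivative

theorem map_borderVec {R R' : Type*} [CommRing R] [CommRing R'] (f : R →+* R') {κ : Type*}
    [Fintype κ] [DecidableEq κ] (M : Matrix (κ ⊕ Fin 2) (κ ⊕ Fin 2) R) (a : Fin 2)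
    (i : κ ⊕ Fin 2) : borderVec (M.map f) a i = f (borderVec M a i) := by
  have h1 : (M.map f).toBlocks₁₁ = f.mapMatrix M.toBlocks₁₁ := rfl
  have h2 : (M.map f).toBlocks₁₂ = M.toBlocks₁₂.map f := rfl
  rcases i with i | b
  · simp only [borderVec, Sum.elim_inl, h1, h2, ← RingHom.map_adjugate]
    rw [RingHom.mapMatrix_apply, ← Matrix.map_mul, Matrix.map_apply]
  · simp only [borderVec, Sum.elim_inr, h1, ← RingHom.map_det]
    split_ifs <;> simp

theorem map_borderForm {R R' : Type*} [CommRing R] [CommRing R'] (f : R →+* R') {κ : Type*}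
    [Fintype κ] [DecidableEq κ] (M : Matrix (κ ⊕ Fin 2) (κ ⊕ Fin 2) R) :
    borderForm (M.map f) = f (borderForm M) := by
  simp only [borderForm, dotProduct, Matrix.mulVec, map_borderVec, map_sum, map_mul,
    Matrix.map_apply]

variable {k : Type*} [CommRing k] {S N : Type*} [CommRing S] [CommRing N] [Algebra k S]
  [Module k N] [Algebra S N] {κ : Type*} [Fintype κ] [DecidableEq κ]

/-- If the border vectors lie in the kernel of `M` over `N`, then the derivative of the border form
of `M` is the border form of the derivative. -/
theorem derivation_borderForm (v : Derivation k S N) {M : Matrix (κ ⊕ Fin 2) (κ ⊕ Fin 2) S}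
    (hM : (M.map (algebraMap S N)).IsSymm)
    (hz : ∀ a, (M.map (algebraMap S N)).mulVec (borderVec (M.map (algebraMap S N)) a) = 0) :
    v (borderForm M) = ∑ i, ∑ j, borderVec (M.map (algebraMap S N)) 0 i *
      (borderVec (M.map (algebraMap S N)) 1 j * v (M i j)) := by
  set z := borderVec (M.map (algebraMap S N)) with hzdef
  have hz' : ∀ a i, z a i = algebraMap S N (borderVec M a i) := fun a i => map_borderVec _ M a i
  have h1 : ∀ i, ∑ j, algebraMap S N (M i j) * z 1 j = 0 := fun i => congrFun (hz 1) i
  have h0 : ∀ j, ∑ i, z 0 i * algebraMap S N (M i j) = 0 := by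
    intro j
    rw [← show (M.map (algebraMap S N)).mulVec (z 0) j = 0 from congrFun (hz 0) j]
    refine Finset.sum_congr rfl fun i _ => ?_
    rw [mul_comm]
    exact congrArg (· * z 0 i) (hM.apply j i)
  simp only [borderForm, dotProduct, Matrix.mulVec, map_sum, Derivation.leibniz,
    Algebra.smul_def, Finset.mul_sum, Finset.sum_add_distrib, mul_add, map_mul, ← hz']
  -- By the product rule, `v` may also hit one of the two border vectors. Such terms contain `M`
  -- applied to the other border vector, which is zero.
  have e1 : ∑ i, ∑ j, z 0 i * (algebraMap S N (M i j) * v (borderVec M 1 j)) = 0 := by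
    rw [Finset.sum_comm]
    refine Finset.sum_eq_zero fun j _ => ?_
    rw [← zero_mul (v (borderVec M 1 j)), ← h0 j, Finset.sum_mul]
    exact Finset.sum_congr rfl fun i _ => by ring
  have e2 : ∑ i, (∑ j, algebraMap S N (M i j) * z 1 j) * v (borderVec M 0 i) = 0 :=
    Finset.sum_eq_zero fun i _ => by rw [h1, zero_mul]
  simp only [Finset.sum_mul] at e2
  rw [e1, e2, zero_add, add_zero]

end BorderDerivative

section KernelDerivative

variable {k : Type*} [Field k] {A : Type*} [CommRing A] [Algebra k A] {m : ℕ}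
  {κ : Type*} [Fintype κ] [DecidableEq κ] {φ : Fin (m + 1) → A}
  (D : Module.Basis (κ ⊕ Fin 2) A (Derivation k A A))
  {N : Type*} [CommRing N] [Algebra (MvPolynomial (Fin m) A) N] [Module k N]

/-- The local equation of the degeneracy scheme is constant along the kernel of the Hessian. -/
theorem derivation_borderForm_eq_zero (h2 : (2 : A) = 0)
    (hN : ∀ s ∈ jacobianIdeal φ D, algebraMap (MvPolynomial (Fin m) A) N s = 0)
    (hd : IsUnit ((hessian φ D).map (algebraMap (MvPolynomial (Fin m) A) N)).toBlocks₁₁.det)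
    (hb : borderForm ((hessian φ D).map (algebraMap (MvPolynomial (Fin m) A) N)) = 0)
    (v : Derivation k (MvPolynomial (Fin m) A) N) {c : κ ⊕ Fin 2 → N}
    (hc : ∀ a, v (MvPolynomial.C a) =
      ∑ i, (MvPolynomial.C (D i a) : MvPolynomial (Fin m) A) • c i)
    (hX : ∀ j, v (MvPolynomial.X j) = 0)
    (hH : ((hessian φ D).map (algebraMap (MvPolynomial (Fin m) A) N)).mulVec c = 0) :
    v (borderForm (hessian φ D)) = 0 := by
  have h2N : (2 : N) = 0 := by
    have := congrArg (fun a => algebraMap (MvPolynomial (Fin m) A) N (MvPolynomial.C a)) h2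
    simpa only [map_ofNat, map_zero] using this
  set H := (hessian φ D).map (algebraMap (MvPolynomial (Fin m) A) N) with hHdef
  have hsymm : H.IsSymm := hessian_map_isSymm D hN
  have hz := mulVec_borderVec_eq_zero h2N hsymm (hessian_map_self D hN h2) hd hb
  rw [derivation_borderForm v hsymm hz]
  have hv : ∀ i j, v (hessian φ D i j) = ∑ l,
      algebraMap (MvPolynomial (Fin m) A) N (thirdDerivative φ D l i j) * c l := by
    intro i j
    have := derivation_linearForm_eq_sum hc fun l => D i (D j (φ l))
    simp only [hX, mul_zero, Finset.sum_const_zero, add_zero, Algebra.smul_def] at this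
    exact this
  have e : ∑ i, ∑ j, borderVec H 0 i * (borderVec H 1 j * v (hessian φ D i j)) =
      tripleForm φ D c (borderVec H 0) (borderVec H 1) := by
    simp only [hv, Finset.mul_sum, tripleForm]
    conv_rhs => rw [Finset.sum_comm]
    refine Finset.sum_congr rfl fun i _ => ?_
    conv_rhs => rw [Finset.sum_comm]
    exact Finset.sum_congr rfl fun j _ => Finset.sum_congr rfl fun l _ => by ring
  rw [e]
  have hadd : ∀ x x' y z : κ ⊕ Fin 2 → N,
      tripleForm φ D (x + x') y z = tripleForm φ D x y z + tripleForm φ D x' y z := by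
    intro x x' y z
    simp only [tripleForm, Pi.add_apply, add_mul, Finset.sum_add_distrib]
  have hsmul : ∀ (r : N) (x y z : κ ⊕ Fin 2 → N),
      tripleForm φ D (r • x) y z = r * tripleForm φ D x y z := by
    intro r x y z
    simp only [tripleForm, Finset.mul_sum, smul_eq_mul, Pi.smul_apply, mul_assoc]
  -- Up to the unit `det α`, `c` is a combination of `z_0` and `z_1`. Only `T(z_0, z_0, z_1)` and
  -- `T(z_1, z_0, z_1) = T(z_1, z_1, z_0)` occur, and both have a repeated argument and a kernel
  -- vector at the end.
  refine (hd.smul_left_cancel).1 ?_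
  rw [smul_zero, smul_eq_mul, ← hsmul, det_smul_eq_of_mulVec_eq_zero h2N hd hH, hadd, hsmul, hsmul,
    tripleForm_self D h2 (hz 1), tripleForm_swap_right D hN (hz 1),
    tripleForm_self D h2 (hz 0), mul_zero, mul_zero, add_zero]

end KernelDerivative

end DualVariety
end

noncomputable section
namespace DualVariety

/-! ## Reducedness of the critical scheme -/

section Reduced

theorem sum_eq_sum_compl_range_add {R σ M : Type*} [Fintype R] [Fintype σ] [DecidableEq σ]
    [AddCommMonoid M] {t : R → σ} (ht : Function.Injective t) (F : σ → M) :
    ∑ j, F j = ∑ j ∈ (Finset.univ.image t)ᶜ, F j + ∑ r, F (t r) := by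
  rw [← Finset.sum_compl_add_sum (Finset.univ.image t) F, Finset.sum_image fun _ _ _ _ h => ht h]

variable {A : Type*} [CommRing A] {m : ℕ} {R : Type*} [Fintype R] [DecidableEq R]

/-- Where a maximal minor of a system of inhomogeneous linear equations is invertible, the
subscheme of affine space over an integral domain that it defines is reduced. -/
theorem exists_pow_mul_mem_of_sq_mem [IsDomain A] (g : R → Fin (m + 1) → A) {t : R → Fin m}
    (ht : Function.Injective t) {f : MvPolynomial (Fin m) A}
    (hf : f ^ 2 ∈ Ideal.span (Set.range fun r => linearForm (g r))) :
    ∃ N : ℕ, MvPolynomial.C (Matrix.det (Matrix.of fun r r' => g r (t r').succ)) ^ N * f ∈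
      Ideal.span (Set.range fun r => linearForm (g r)) := by
  classical
  set W : Matrix R R A := Matrix.of fun r r' => g r (t r').succ with hW
  set J := Ideal.span (Set.range fun r => linearForm (g r)) with hJ
  by_cases hδ : W.det = 0
  · exact ⟨1, by simp [hδ]⟩
  let A' := Localization.Away W.det
  have : IsDomain A' :=
    IsLocalization.isDomain_localization (powers_le_nonZeroDivisors_of_noZeroDivisors hδ)
  let S' := MvPolynomial (Fin m) A'
  let c : A →+* S' := MvPolynomial.C.comp (algebraMap A A')
  let incl : MvPolynomial (Fin m) A →+* S' := MvPolynomial.map (algebraMap A A')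
  have hinclX : ∀ j, incl (MvPolynomial.X j) = MvPolynomial.X j := fun j =>
    MvPolynomial.map_X _ _
  have hinclC : ∀ a, incl (MvPolynomial.C a) = c a := fun a => MvPolynomial.map_C _ _
  let W' : Matrix R R S' := c.mapMatrix W
  have hW' : IsUnit W'.det := by
    rw [← RingHom.map_det]
    exact (IsLocalization.Away.algebraMap_isUnit (S := A') W.det).map MvPolynomial.C
  let l : R → S' := fun r => c (g r 0) +
    ∑ j ∈ (Finset.univ.image t)ᶜ, MvPolynomial.X j * c (g r j.succ)
  let u : R → S' := -(W'⁻¹.mulVec l)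
  have hlf : ∀ (F : MvPolynomial (Fin m) A →+* S') (_ : ∀ a, F (MvPolynomial.C a) = c a)
      (_ : ∀ j ∉ Finset.univ.image t, F (MvPolynomial.X j) = MvPolynomial.X j) (r : R),
      F (linearForm (g r)) = l r + W'.mulVec (fun r' => F (MvPolynomial.X (t r'))) r := by
    intro F hC hX r
    simp only [linearForm, map_add, map_sum, map_mul, hC]
    rw [sum_eq_sum_compl_range_add ht, ← add_assoc]
    congr 1
    · simp only [l]
      congr 1
      exact Finset.sum_congr rfl fun j hj => by rw [hX j (Finset.mem_compl.1 hj)]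
    · exact Finset.sum_congr rfl fun r' _ => mul_comm _ _
  -- The substitution `θ` replaces the variables selected by `t` with the solution `u` of the linear
  -- system over `A[1 / det W]` and keeps the others. It takes values in a polynomial ring over a
  -- domain, so `θ(f)² = 0` forces `θ(f) = 0`.
  let θ : MvPolynomial (Fin m) A →+* S' := MvPolynomial.eval₂Hom c fun j =>
    if h : ∃ r, t r = j then u h.choose else MvPolynomial.X j
  have hθC : ∀ a, θ (MvPolynomial.C a) = c a := fun a => MvPolynomial.eval₂_C _ _ _
  have hθX : ∀ j ∉ Finset.univ.image t, θ (MvPolynomial.X j) = MvPolynomial.X j := by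
    intro j hj
    have : ¬ ∃ r, t r = j := by simpa using hj
    simp [θ, this]
  have hθt : ∀ r, θ (MvPolynomial.X (t r)) = u r := by
    intro r
    have h : ∃ r', t r' = t r := ⟨r, rfl⟩
    simp only [θ, MvPolynomial.coe_eval₂Hom, MvPolynomial.eval₂_X, dif_pos h]
    rw [ht h.choose_spec]
  have hθJ : J ≤ RingHom.ker θ := by
    refine Ideal.span_le.2 ?_
    rintro _ ⟨r, rfl⟩
    rw [SetLike.mem_coe, RingHom.mem_ker, hlf θ hθC hθX]
    simp only [hθt]
    change l r + W'.mulVec (-(W'⁻¹.mulVec l)) r = 0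
    rw [Matrix.mulVec_neg, Matrix.mulVec_mulVec, Matrix.mul_nonsing_inv _ hW', Matrix.one_mulVec,
      Pi.neg_apply, add_neg_cancel]
  let J' := J.map incl
  -- Modulo the equations the solved variables equal their solutions, so `θ` is congruent to the
  -- inclusion. Hence an `f` killed by `θ` lies in the extended ideal, and clearing denominators
  -- costs a power of `det W`.
  have hcomp : (Ideal.Quotient.mk J').comp θ = (Ideal.Quotient.mk J').comp incl := by
    refine MvPolynomial.ringHom_ext (fun a => ?_) (fun j => ?_)
    · simp only [RingHom.comp_apply, hθC, hinclC]
    · by_cases hj : j ∈ Finset.univ.image t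
      · obtain ⟨r, -, rfl⟩ := Finset.mem_image.1 hj
        simp only [RingHom.comp_apply]
        rw [Ideal.Quotient.eq, hθt]
        have h : (fun r => incl (linearForm (g r))) =
            l + W'.mulVec fun r' => incl (MvPolynomial.X (t r')) := by
          ext1 r
          exact hlf incl hinclC (fun j _ => hinclX j) r
        have h' : u - (fun r' => incl (MvPolynomial.X (t r'))) =
            -(W'⁻¹.mulVec fun r => incl (linearForm (g r))) := by
          rw [h, Matrix.mulVec_add, Matrix.mulVec_mulVec, Matrix.nonsing_inv_mul _ hW',
            Matrix.one_mulVec]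
          simp only [u]
          abel
        have h'' := congrFun h' r
        simp only [Pi.sub_apply, Pi.neg_apply] at h''
        rw [h'']
        refine neg_mem (Ideal.sum_mem _ fun r' _ => Ideal.mul_mem_left _ _ ?_)
        exact Ideal.mem_map_of_mem _ (Ideal.subset_span ⟨r', rfl⟩)
      · simp only [RingHom.comp_apply, hθX j hj, hinclX]
  have hθf : θ f = 0 := by
    have := hθJ hf
    rw [RingHom.mem_ker, map_pow] at this
    exact pow_eq_zero_iff two_ne_zero |>.1 this
  have hmem : incl f ∈ J' := by
    rw [← Ideal.Quotient.eq_zero_iff_mem]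
    have := congr($hcomp f)
    simpa [hθf] using this.symm
  let _ : Algebra (MvPolynomial (Fin m) A) S' := MvPolynomial.algebraMvPolynomial
  have hincl : incl = algebraMap (MvPolynomial (Fin m) A) S' := rfl
  have hloc := MvPolynomial.isLocalization (σ := Fin m) (Submonoid.powers W.det) A'
  simp only [J', hincl] at hmem
  rw [IsLocalization.algebraMap_mem_map_algebraMap_iff
    ((Submonoid.powers W.det).map (MvPolynomial.C : A →+* MvPolynomial (Fin m) A))] at hmem
  obtain ⟨_, ⟨_, ⟨N, rfl⟩, rfl⟩, hs⟩ := hmem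
  exact ⟨N, by simpa using hs⟩

end Reduced

/-! ### Invertible maximal minors -/

section Minors

/-- A spanning family of vectors in `R → K` has an invertible maximal minor. -/
theorem exists_injective_det_ne_zero {K : Type*} [Field K] {R σ : Type*} [Fintype R]
    [DecidableEq R] [Finite σ] (W : Matrix R σ K)
    (hW : ∀ a : R → K, Matrix.vecMul a W = 0 → a = 0) :
    ∃ t : R → σ, Function.Injective t ∧ (Matrix.of fun r r' => W r (t r')).det ≠ 0 := by
  classical
  have := Fintype.ofFinite σ
  -- A nonzero functional vanishing on all columns would be a linear relation between the rows. So
  -- the columns span, and a basis can be chosen among them.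
  have hspan : Submodule.span K (Set.range W.col) = ⊤ := by
    by_contra h
    obtain ⟨f, hf, hle⟩ := Submodule.exists_le_ker_of_lt_top _ (lt_top_iff_ne_top.2 h)
    apply hf
    let a : R → K := fun r => f (Pi.single r 1)
    have hfa : ∀ x, f x = ∑ r, a r * x r := by
      intro x
      rw [LinearMap.pi_apply_eq_sum_univ f x]
      refine Finset.sum_congr rfl fun r _ => ?_
      rw [smul_eq_mul, mul_comm]
      congr 2
      ext r'
      simp [Pi.single_apply, eq_comm]
    have ha : a = 0 := hW a (by
      ext j
      have := hle (Submodule.subset_span ⟨j, rfl⟩)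
      rw [LinearMap.mem_ker, hfa] at this
      exact this)
    refine LinearMap.ext fun x => ?_
    simp [hfa, ha]
  obtain ⟨κ, i, hi, hs, hli⟩ := exists_linearIndependent' K W.col
  rw [hspan] at hs
  let b : Module.Basis κ K (R → K) := Module.Basis.mk hli hs.ge
  have : Finite κ := Finite.of_injective i hi
  have := Fintype.ofFinite κ
  let eq : R ≃ κ := (Pi.basisFun K R).indexEquiv b
  refine ⟨fun r => i (eq r), hi.comp eq.injective, ?_⟩
  let b' := b.reindex eq.symm
  have hb' : ∀ r, b' r = W.col (i (eq r)) := fun r => by simp [b', b]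
  have := (Module.Basis.isUnit_det (Pi.basisFun K R) b').ne_zero
  rw [Module.Basis.det_apply] at this
  convert! this using 2
  ext r r'
  simp [Module.Basis.toMatrix_apply, hb']

end Minors

end DualVariety
end

noncomputable section
namespace DualVariety

/-! ## A Jacobian criterion and the dimension of tangent spaces -/

section Jacobian

open TensorProduct KaehlerDifferential

/-- The base change of the kernel is spanned by the classes of the `h j`. Applying the `v i` to the
image of a combination multiplies its coefficient vector by the invertible matrix `v i (h j)`, so no
nonzero combination is lost. -/
theorem cotangentComplexBaseChange_injective {R S P K : Type*} [CommRing R] [CommRing S]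
    [CommRing P] [Field K] [Algebra R P] [Algebra P S] [Algebra S K] [Algebra P K] [Algebra R K]
    [IsScalarTower P S K] [IsScalarTower R P K] {r : Type*} [Fintype r] [DecidableEq r]
    (h : r → P) (hker : RingHom.ker (algebraMap P S) = Ideal.span (Set.range h))
    (v : r → Derivation R P K) (hv : (Matrix.of fun i j => v i (h j)).det ≠ 0) :
    Function.Injective (cotangentComplexBaseChange R S P K) := by
  have hmem : ∀ j, h j ∈ RingHom.ker (algebraMap P S) := fun j => by
    rw [hker]
    exact Ideal.subset_span ⟨j, rfl⟩
  have hgen : ∀ x : K ⊗[P] RingHom.ker (algebraMap P S),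
      ∃ c : r → K, x = ∑ j, c j ⊗ₜ[P] ⟨h j, hmem j⟩ := by
    intro x
    induction x with
    | zero => exact ⟨0, by simp⟩
    | add x y hx hy =>
      obtain ⟨c, rfl⟩ := hx
      obtain ⟨d, rfl⟩ := hy
      exact ⟨c + d, by simp [TensorProduct.add_tmul, Finset.sum_add_distrib]⟩
    | tmul a s =>
      obtain ⟨s, hs⟩ := s
      obtain ⟨w, hw⟩ := (Ideal.mem_span_range_iff_exists_fun).1 (hker ▸ hs)
      refine ⟨fun j => w j • a, ?_⟩
      have : (⟨s, hs⟩ : RingHom.ker (algebraMap P S)) = ∑ j, w j • ⟨h j, hmem j⟩ := by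
        ext
        simp [hw]
      rw [this, TensorProduct.tmul_sum]
      exact Finset.sum_congr rfl fun j _ => by rw [TensorProduct.tmul_smul, TensorProduct.smul_tmul']
  rw [← LinearMap.ker_eq_bot, LinearMap.ker_eq_bot']
  intro x hx
  obtain ⟨c, rfl⟩ := hgen x
  have hc : (Matrix.of fun i j => v i (h j)).mulVec c = 0 := by
    ext i
    have := congrArg ((v i).liftKaehlerDifferential.liftBaseChange K) hx
    simp only [map_sum, cotangentComplexBaseChange_tmul, map_smul, map_zero,
      KaehlerDifferential.kerToTensor_apply, LinearMap.liftBaseChange_tmul,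
      Derivation.liftKaehlerDifferential_comp_D, one_smul] at this
    rw [Pi.zero_apply, ← this]
    exact Finset.sum_congr rfl fun j _ => mul_comm _ _
  have hc0 : c = 0 := by
    refine Matrix.mulVec_injective_of_isUnit
      ((Matrix.isUnit_iff_isUnit_det _).2 (isUnit_iff_ne_zero.2 hv)) ?_
    rw [hc, Matrix.mulVec_zero]
  simp [hc0]

/-- The Jacobian criterion. `hgen` says that the `h j` generate `I` up to functions nonvanishing at
the point, hence generate the kernel of the map of local rings. For a quotient of a formally smooth
local ring, smoothness is the injectivity of conormal vectors into differentials at `K`, and the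
derivations `v` detect it. -/
theorem isSmoothAt_of_det_ne_zero {k S K : Type*} [Field k] [CommRing S]
    [Field K] [Algebra k S] [Algebra k K] [Algebra.FormallySmooth k S] [Algebra.FiniteType k S]
    {I : Ideal S} [Algebra S K] [Algebra (S ⧸ I) K] [IsScalarTower S (S ⧸ I) K]
    [IsScalarTower k S K] (q : Ideal (S ⧸ I)) [q.IsPrime]
    (hq : RingHom.ker (algebraMap (S ⧸ I) K) = q) {r : Type*} [Fintype r] [DecidableEq r]
    (h : r → S) (hmem : ∀ j, h j ∈ I)
    (hgen : ∀ s ∈ I, ∃ t, algebraMap S K t ≠ 0 ∧ t * s ∈ Ideal.span (Set.range h))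
    (v : r → Derivation k S K) (hv : (Matrix.of fun i j => v i (h j)).det ≠ 0) :
    Algebra.IsSmoothAt k q := by
  let f : S →+* S ⧸ I := Ideal.Quotient.mk I
  let p := q.comap f
  have hp : ∀ s, s ∈ p ↔ algebraMap S K s = 0 := by
    intro s
    rw [Ideal.mem_comap, ← hq, RingHom.mem_ker, IsScalarTower.algebraMap_apply S (S ⧸ I) K]
    rfl
  let Sp := Localization.AtPrime p
  let Bq := Localization.AtPrime q
  let F : Sp →+* Bq := Localization.localRingHom p q f rfl
  have hF : ∀ s, F (algebraMap S Sp s) = algebraMap (S ⧸ I) Bq (f s) := fun s =>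
    Localization.localRingHom_to_map _ _ _ _ _
  let _ : Algebra Sp Bq := F.toAlgebra
  have hFs : Function.Surjective F := RingHom.surjective_localRingHom_of_surjective f
    Ideal.Quotient.mk_surjective q
  have : IsScalarTower k Sp Bq := IsScalarTower.of_algebraMap_eq fun c => by
    rw [IsScalarTower.algebraMap_apply k S Sp, IsScalarTower.algebraMap_apply k (S ⧸ I) Bq]
    exact (hF _).symm
  have hunit : ∀ y : q.primeCompl, IsUnit (algebraMap (S ⧸ I) K y) := fun y =>
    isUnit_iff_ne_zero.2 fun h0 => y.2 (hq.le h0)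
  let G : Bq →+* K := IsLocalization.lift hunit
  have hG : ∀ b, G (algebraMap (S ⧸ I) Bq b) = algebraMap (S ⧸ I) K b := fun b =>
    IsLocalization.lift_eq hunit b
  let _ : Algebra Bq K := G.toAlgebra
  let _ : Algebra Sp K := (G.comp F).toAlgebra
  have : IsScalarTower Sp Bq K := IsScalarTower.of_algebraMap_eq fun _ => rfl
  have hSpK : ∀ s, algebraMap Sp K (algebraMap S Sp s) = algebraMap S K s := by
    intro s
    change G (F _) = _
    rw [hF, hG, IsScalarTower.algebraMap_apply S (S ⧸ I) K]
    rfl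
  have : IsScalarTower S Sp K := IsScalarTower.of_algebraMap_eq fun s => (hSpK s).symm
  have : IsScalarTower k Sp K := IsScalarTower.of_algebraMap_eq fun s => by
    rw [IsScalarTower.algebraMap_apply k S Sp, hSpK, ← IsScalarTower.algebraMap_apply]
  have : Algebra.FormallySmooth S Sp := Algebra.FormallySmooth.of_isLocalization p.primeCompl
  have : Algebra.FormallySmooth k Sp := Algebra.FormallySmooth.comp k S Sp
  have : Algebra.EssFiniteType S Sp := Algebra.EssFiniteType.of_isLocalization Sp p.primeCompl
  have : Algebra.EssFiniteType k Sp := Algebra.EssFiniteType.comp k S Sp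
  have : Module.Finite Sp Ω[Sp⁄k] := inferInstance
  have : Module.Projective Sp Ω[Sp⁄k] := inferInstance
  have : Module.Free Sp Ω[Sp⁄k] := Module.free_of_flat_of_isLocalRing
  have hker : RingHom.ker (algebraMap Sp Bq) =
      Ideal.span (Set.range fun j => algebraMap S Sp (h j)) := by
    apply le_antisymm
    · intro x hx
      obtain ⟨s, t, rfl⟩ := IsLocalization.exists_mk'_eq p.primeCompl x
      have hx' : F (algebraMap S Sp s) = 0 := by
        rw [← IsLocalization.mk'_spec Sp s t, map_mul]
        rw [RingHom.mem_ker] at hx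
        exact (congrArg (· * _) hx).trans (zero_mul _)
      rw [hF, IsLocalization.map_eq_zero_iff q.primeCompl] at hx'
      obtain ⟨⟨b, hb⟩, hbs⟩ := hx'
      obtain ⟨b, rfl⟩ := Ideal.Quotient.mk_surjective b
      have hbI : b * s ∈ I := by
        rw [← Ideal.Quotient.eq_zero_iff_mem, map_mul]
        exact hbs
      obtain ⟨t', ht', hts⟩ := hgen _ hbI
      have hu : IsUnit (algebraMap S Sp (t' * b)) := by
        refine IsLocalization.map_units Sp (⟨t' * b, ?_⟩ : p.primeCompl)
        intro hmem
        have hmem' := (hp _).1 hmem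
        rw [map_mul, mul_eq_zero] at hmem'
        rcases hmem' with h0 | h0
        · exact ht' h0
        · exact hb ((hp b).2 h0)
      have hm : algebraMap S Sp (t' * b) * algebraMap S Sp s ∈
          Ideal.span (Set.range fun j => algebraMap S Sp (h j)) := by
        rw [← map_mul, mul_assoc]
        have := Ideal.mem_map_of_mem (algebraMap S Sp) hts
        rwa [Ideal.map_span, ← Set.range_comp] at this
      rw [IsLocalization.mk'_eq_mul_mk'_one]
      exact Ideal.mul_mem_right _ _ ((Ideal.unit_mul_mem_iff_mem _ hu).1 hm)
    · refine Ideal.span_le.2 ?_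
      rintro _ ⟨j, rfl⟩
      rw [SetLike.mem_coe, RingHom.mem_ker]
      refine (hF _).trans ?_
      rw [show f (h j) = 0 from Ideal.Quotient.eq_zero_iff_mem.2 (hmem j), map_zero]
  have hfg : (RingHom.ker (algebraMap Sp Bq)).FG := by
    rw [hker]
    classical
    exact ⟨Finset.univ.image fun j => algebraMap S Sp (h j), by simp⟩
  have hmax : IsLocalRing.maximalIdeal Bq ≤ RingHom.ker (algebraMap Bq K) := by
    rw [← Localization.AtPrime.map_eq_maximalIdeal, Ideal.map_le_iff_le_comap]
    intro b hb
    rw [Ideal.mem_comap, RingHom.mem_ker]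
    rw [← hq] at hb
    exact (hG b).trans hb
  choose v' hv' using fun i => exists_derivation_of_isLocalization p.primeCompl Sp (v i)
  refine (Algebra.FormallySmooth.iff_injective_cotangentComplexBaseChange Sp K hFs hfg hmax).2 ?_
  refine cotangentComplexBaseChange_injective _ hker v' ?_
  simpa only [hv'] using hv

/-- The dimension of the tangent space at a rational point of a smooth scheme. -/
theorem finrank_derivation_of_isStandardSmooth {k B K : Type*} [Field k] [CommRing B] [Field K]
    [Algebra k B] [Algebra k K] [Algebra B K] [IsScalarTower k B K]
    (hk : Function.Bijective (algebraMap k K)) {d : ℕ} {g : B} (hg : algebraMap B K g ≠ 0)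
    [Algebra.IsStandardSmoothOfRelativeDimension d k (Localization.Away g)] :
    Module.finrank k (Derivation k B K) = d := by
  let Bg := Localization.Away g
  have hu : IsUnit (algebraMap B K g) := isUnit_iff_ne_zero.2 hg
  let G : Bg →+* K := IsLocalization.Away.lift g hu
  have hG : ∀ b, G (algebraMap B Bg b) = algebraMap B K b := fun b =>
    IsLocalization.Away.lift_eq g hu b
  let _ : Algebra Bg K := G.toAlgebra
  have : IsScalarTower B Bg K := IsScalarTower.of_algebraMap_eq fun b => (hG b).symm
  have : IsScalarTower k Bg K := IsScalarTower.of_algebraMap_eq fun s => by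
    rw [IsScalarTower.algebraMap_apply k B Bg, ← IsScalarTower.algebraMap_apply B Bg K,
      ← IsScalarTower.algebraMap_apply]
  have : Nontrivial Bg := G.domain_nontrivial
  have : Algebra.IsStandardSmooth k Bg :=
    Algebra.IsStandardSmoothOfRelativeDimension.isStandardSmooth d
  have hrank : Module.finrank Bg Ω[Bg⁄k] = d := by
    rw [Module.finrank,
      Algebra.IsStandardSmoothOfRelativeDimension.rank_kaehlerDifferential (n := d) (R := k)]
    simp
  have : Module.Free Bg Ω[Bg⁄k] := inferInstance
  have : Module.Finite Bg Ω[Bg⁄k] := inferInstance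
  let b := Module.finBasisOfFinrankEq Bg Ω[Bg⁄k] hrank
  let e1 : Derivation k Bg K ≃ₗ[Bg] (Fin d → K) :=
    (KaehlerDifferential.linearMapEquivDerivation k Bg).symm.trans (b.constr Bg).symm
  -- As `g` is invertible in `K`, derivations of `B` and of its localization into `K` correspond,
  -- and the latter are the dual of a free module of differentials of rank `d`.
  let e2 : Derivation k Bg K →ₗ[k] Derivation k B K :=
    { toFun := fun D => D.compAlgebraMap B
      map_add' := fun _ _ => rfl
      map_smul' := fun _ _ => rfl }
  have he2 : Function.Bijective e2 := by
    constructor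
    · intro D D' h
      refine derivation_ext_of_isLocalization (Submonoid.powers g) Bg fun b => ?_
      exact congr($h b)
    · intro D
      obtain ⟨D', hD'⟩ := exists_derivation_of_isLocalization (Submonoid.powers g) Bg D
      exact ⟨D', Derivation.ext hD'⟩
  rw [← (LinearEquiv.ofBijective e2 he2).finrank_eq, (e1.restrictScalars k).finrank_eq,
    ← (LinearEquiv.piCongrRight fun _ : Fin d =>
      LinearEquiv.ofBijective (Algebra.linearMap k K) hk).finrank_eq]
  simp

end Jacobian

end DualVariety
end

noncomputable section
namespace DualVariety

/-! ## Vector fields on the product of an affine variety and affine space -/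

section PolyFrame

variable {k : Type*} [CommRing k] {A : Type*} [CommRing A] [Algebra k A]
  [Algebra.FormallySmooth k A] [Algebra.FiniteType k A] {ι : Type*} [Fintype ι]
  (D : Module.Basis ι A (Derivation k A A))

/-- Coordinates of derivations of `A` with respect to a frame. -/
def frameEquiv (N : Type*) [AddCommGroup N] [Module A N] [Module k N] [IsScalarTower k A N] :
    (ι → N) ≃ₗ[A] Derivation k A N :=
  LinearEquiv.ofBijective
    { toFun := combination D
      map_add' := fun c c' => by
        ext a
        simp [combination_apply, Finset.sum_add_distrib]
      map_smul' := fun r c => by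
        ext a
        simp only [combination_apply, Pi.smul_apply, Finset.smul_sum, RingHom.id_apply,
          Derivation.smul_apply]
        exact Finset.sum_congr rfl fun i _ => smul_comm _ _ _ }
    ⟨(injective_iff_map_eq_zero _).2 fun c hc => eq_zero_of_sum_smul_eq_zero D fun a => by
        rw [← combination_apply]
        exact congr($hc a),
      fun d => by
        obtain ⟨c, hc⟩ := derivation_eq_sum D d
        exact ⟨c, Derivation.ext fun a => by rw [hc a]; exact combination_apply _ _ _⟩⟩

theorem frameEquiv_apply (N : Type*) [AddCommGroup N] [Module A N] [Module k N]
    [IsScalarTower k A N] (c : ι → N) (a : A) :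
    frameEquiv D N c a = ∑ i, D i a • c i := combination_apply _ _ _

variable {m : ℕ} (N : Type*) [CommRing N] [Algebra k N] [Algebra A N]
  [Algebra (MvPolynomial (Fin m) A) N] [IsScalarTower k A N]
  [IsScalarTower A (MvPolynomial (Fin m) A) N] [IsScalarTower k (MvPolynomial (Fin m) A) N]

/-- Coordinates of derivations of `A[y₁, …, y_m]` with respect to a frame of `A`. -/
def polyFrameEquiv :
    Derivation k (MvPolynomial (Fin m) A) N ≃ₗ[k] (ι → N) × (Fin m → N) :=
  (LinearEquiv.ofBijective
    ({ toFun := fun v => (v.compAlgebraMap A, fun j => v (MvPolynomial.X j))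
       map_add' := fun _ _ => rfl
       map_smul' := fun _ _ => rfl } :
      Derivation k (MvPolynomial (Fin m) A) N →ₗ[k] Derivation k A N × (Fin m → N))
    ⟨fun v w h => by
      have h1 : ∀ a, v (MvPolynomial.C a) = w (MvPolynomial.C a) := fun a =>
        congr($(congrArg Prod.fst h) a)
      have h2 : ∀ j, v (MvPolynomial.X j) = w (MvPolynomial.X j) := fun j =>
        congrFun (congrArg Prod.snd h) j
      ext p
      induction p using MvPolynomial.induction_on with
      | C a => exact h1 a
      | add p q hp hq => rw [map_add, map_add, hp, hq]
      | mul_X p j hp => rw [Derivation.leibniz, Derivation.leibniz, hp, h2],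
    fun ⟨d, b⟩ => by
      obtain ⟨v, hv, hb⟩ := exists_derivation_mvPolynomial d b
      exact ⟨v, Prod.ext (Derivation.ext hv) (funext hb)⟩⟩).trans
    (((frameEquiv D N).symm.restrictScalars k).prodCongr (LinearEquiv.refl k _))

variable {N}

theorem apply_C_eq_sum_polyFrameEquiv (v : Derivation k (MvPolynomial (Fin m) A) N) (a : A) :
    v (MvPolynomial.C a) = ∑ i, (MvPolynomial.C (D i a) : MvPolynomial (Fin m) A) •
      (polyFrameEquiv D N v).1 i := by
  have h := frameEquiv_apply D N (polyFrameEquiv D N v).1 a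
  have h' : frameEquiv D N (polyFrameEquiv D N v).1 = v.compAlgebraMap A :=
    (frameEquiv D N).apply_symm_apply _
  rw [h'] at h
  refine Eq.trans h (Finset.sum_congr rfl fun i _ => ?_)
  exact (algebraMap_smul (MvPolynomial (Fin m) A) (D i a) _).symm

theorem apply_X_eq_polyFrameEquiv (v : Derivation k (MvPolynomial (Fin m) A) N) (j : Fin m) :
    v (MvPolynomial.X j) = (polyFrameEquiv D N v).2 j := rfl

theorem apply_linearForm_eq (v : Derivation k (MvPolynomial (Fin m) A) N)
    (g : Fin (m + 1) → A) :
    v (linearForm g) =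
      ∑ i, algebraMap (MvPolynomial (Fin m) A) N (linearForm fun l => D i (g l)) *
        (polyFrameEquiv D N v).1 i +
      ∑ j : Fin m, algebraMap A N (g j.succ) * (polyFrameEquiv D N v).2 j := by
  rw [derivation_linearForm_eq_sum (apply_C_eq_sum_polyFrameEquiv D v)]
  simp only [Algebra.smul_def, apply_X_eq_polyFrameEquiv D]
  congr 1
  refine Finset.sum_congr rfl fun j _ => ?_
  rw [IsScalarTower.algebraMap_apply A (MvPolynomial (Fin m) A) N, MvPolynomial.algebraMap_eq]

end PolyFrame

/-! ## Vanishing of derivations -/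

section Vanishing

variable {k : Type*} [CommRing k] {S N : Type*} [CommRing S] [CommRing N] [Algebra k S]
  [Module k N] [Algebra S N]

theorem derivation_eq_zero_of_mem_sq (v : Derivation k S N) {s : S}
    (hs : s ∈ RingHom.ker (algebraMap S N) ^ 2) : v s = 0 := by
  rw [sq] at hs
  refine Submodule.mul_induction_on hs (fun a ha b hb => ?_) fun a b ha hb => by
    rw [map_add, ha, hb, add_zero]
  rw [RingHom.mem_ker] at ha hb
  rw [Derivation.leibniz, Algebra.smul_def, Algebra.smul_def, ha, hb, zero_mul, zero_mul, add_zero]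

theorem derivation_eq_zero_of_mem_span (v : Derivation k S N) {G : Set S}
    (hG : ∀ s ∈ G, algebraMap S N s = 0) (hv : ∀ s ∈ G, v s = 0) {s : S}
    (hs : s ∈ Ideal.span G) : v s = 0 := by
  have hle : Ideal.span G ≤ RingHom.ker (algebraMap S N) := Ideal.span_le.2 hG
  refine Submodule.span_induction (p := fun s _ => v s = 0) hv (map_zero v)
    (fun a b _ _ ha hb => by rw [map_add, ha, hb, add_zero]) (fun a b hb hvb => ?_) hs
  have : algebraMap S N b = 0 := hle hb
  rw [smul_eq_mul, Derivation.leibniz, hvb, smul_zero, zero_add, Algebra.smul_def, this, zero_mul]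

theorem eq_zero_of_pow_mul_mem {J : Ideal S} (hJ : ∀ s ∈ J, algebraMap S N s = 0) {t s : S} {e : ℕ}
    (ht : IsUnit (algebraMap S N t)) (h : t ^ e * s ∈ J) : algebraMap S N s = 0 := by
  have := hJ _ h
  rw [map_mul, map_pow] at this
  exact ((ht.pow e).mul_right_eq_zero).1 this

/-- Since `s` maps to zero in `N`, differentiating `t ^ e * s` leaves only the unit `t ^ e` times `v
s`. This transfers identities that hold after multiplication by a power of `t` to tangent vectors.
-/
theorem derivation_eq_zero_of_pow_mul_mem (v : Derivation k S N) {J : Ideal S}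
    (hJ : ∀ s ∈ J, algebraMap S N s = 0) (hv : ∀ s ∈ J, v s = 0) {t s : S} {e : ℕ}
    (ht : IsUnit (algebraMap S N t)) (h : t ^ e * s ∈ J) : v s = 0 := by
  have h0 := hv _ h
  rw [Derivation.leibniz, Algebra.smul_def, Algebra.smul_def, eq_zero_of_pow_mul_mem hJ ht h,
    zero_mul, add_zero, map_pow] at h0
  exact ((ht.pow e).mul_right_eq_zero).1 h0

end Vanishing

/-! ## Critical points -/

section CriticalPoint

variable {k : Type*} [Field k] {A : Type*} [CommRing A] [Algebra k A] {m : ℕ} {ι : Type*}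

/-- The generators of `jacobianIdeal`, as linear forms. -/
def jacobianGenerator (φ : Fin (m + 1) → A) (D : ι → Derivation k A A) :
    Option ι → Fin (m + 1) → A
  | none => φ
  | some i => fun l => D i (φ l)

theorem jacobianIdeal_eq_span (φ : Fin (m + 1) → A) (D : ι → Derivation k A A) :
    jacobianIdeal φ D = Ideal.span (Set.range fun r => linearForm (jacobianGenerator φ D r)) := by
  rw [jacobianIdeal]
  congr 1
  ext s
  constructor
  · rintro (rfl | ⟨i, rfl⟩)
    · exact ⟨none, rfl⟩
    · exact ⟨some i, rfl⟩
  · rintro ⟨_ | i, rfl⟩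
    · exact Or.inl rfl
    · exact Or.inr ⟨i, rfl⟩

/-- A `K`-valued point `(p, [1 : 0 : ⋯ : 0])` of the critical scheme at which the linear system is
immersive. -/
structure IsCriticalPoint [Fintype ι] (φ : Fin (m + 1) → A) (D : ι → Derivation k A A) (K : Type*)
    [Field K] [Algebra A K] [Algebra (MvPolynomial (Fin m) A) K] : Prop where
  last : φ (Fin.last m) = 1
  map_X : ∀ j : Fin m, algebraMap (MvPolynomial (Fin m) A) K (MvPolynomial.X j) = 0
  map_zero : algebraMap A K (φ 0) = 0
  map_derivation_zero : ∀ i, algebraMap A K (D i (φ 0)) = 0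
  immersive : ∀ a : ι → K, (∀ l, ∑ i, a i * algebraMap A K (D i (φ l)) = 0) → a = 0

variable [Fintype ι] {φ : Fin (m + 1) → A} {D : ι → Derivation k A A} {K : Type*} [Field K]
  [Algebra A K] [Algebra (MvPolynomial (Fin m) A) K]

namespace IsCriticalPoint

theorem pos (hP : IsCriticalPoint φ D K) : 0 < m := by
  rcases Nat.eq_zero_or_pos m with rfl | h
  · have := hP.last
    have h0 := hP.map_zero
    rw [show (0 : Fin (0 + 1)) = Fin.last 0 from rfl, this, map_one] at h0
    exact absurd h0 one_ne_zero
  · exact h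

/-- The column of `φ_m = 1`, whose derivatives vanish, isolates the coefficient of `Φ`. The rest is
a relation between the derivatives of all the `φ_l`, those of `φ_0` being zero at the point, and
immersivity excludes it. -/
theorem vecMul_eq_zero (hP : IsCriticalPoint φ D K) (a : Option ι → K)
    (ha : Matrix.vecMul a (Matrix.of fun r (j : Fin m) =>
      algebraMap A K (jacobianGenerator φ D r j.succ)) = 0) : a = 0 := by
  have h : ∀ j : Fin m, a none * algebraMap A K (φ j.succ) +
      ∑ i, a (some i) * algebraMap A K (D i (φ j.succ)) = 0 := by
    intro j
    have := congrFun ha j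
    simp only [Matrix.vecMul, dotProduct, Fintype.sum_option] at this
    exact this
  have hm := hP.pos
  have hnone : a none = 0 := by
    have h1 := h ⟨m - 1, by omega⟩
    have : (⟨m - 1, by omega⟩ : Fin m).succ = Fin.last m := by
      ext
      simp
      omega
    simpa [this, hP.last] using h1
  have hsome : (fun i => a (some i)) = 0 := by
    refine hP.immersive _ fun l => ?_
    refine Fin.cases ?_ (fun j => ?_) l
    · exact Finset.sum_eq_zero fun i _ => by rw [hP.map_derivation_zero, mul_zero]
    · simpa [hnone] using h j
  ext (_ | i)
  · exact hnone
  · exact congrFun hsome i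

variable [IsScalarTower A (MvPolynomial (Fin m) A) K]

theorem map_linearForm (hP : IsCriticalPoint φ D K) (g : Fin (m + 1) → A) :
    algebraMap (MvPolynomial (Fin m) A) K (linearForm g) = algebraMap A K (g 0) := by
  simp only [linearForm, map_add, map_sum, map_mul, hP.map_X, zero_mul, Finset.sum_const_zero,
    add_zero]
  rw [IsScalarTower.algebraMap_apply A (MvPolynomial (Fin m) A) K, MvPolynomial.algebraMap_eq]

theorem map_jacobianGenerator (hP : IsCriticalPoint φ D K) (r : Option ι) :
    algebraMap (MvPolynomial (Fin m) A) K (linearForm (jacobianGenerator φ D r)) = 0 := by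
  rw [hP.map_linearForm]
  rcases r with _ | i
  · exact hP.map_zero
  · exact hP.map_derivation_zero i

theorem map_eq_zero (hP : IsCriticalPoint φ D K) :
    ∀ s ∈ jacobianIdeal φ D, algebraMap (MvPolynomial (Fin m) A) K s = 0 := by
  intro s hs
  rw [jacobianIdeal_eq_span] at hs
  have : Ideal.span (Set.range fun r => linearForm (jacobianGenerator φ D r)) ≤
      RingHom.ker (algebraMap (MvPolynomial (Fin m) A) K) := by
    refine Ideal.span_le.2 ?_
    rintro _ ⟨r, rfl⟩
    exact hP.map_jacobianGenerator r
  exact this hs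

end IsCriticalPoint

/-- The critical scheme is reduced near a critical point. -/
theorem IsCriticalPoint.exists_reduced [IsDomain A] (hP : IsCriticalPoint φ D K) :
    ∃ δ : A, algebraMap A K δ ≠ 0 ∧ ∀ f : MvPolynomial (Fin m) A, f ^ 2 ∈ jacobianIdeal φ D →
      ∃ e : ℕ, MvPolynomial.C δ ^ e * f ∈ jacobianIdeal φ D := by
  classical
  obtain ⟨t, ht, hdet⟩ := exists_injective_det_ne_zero _ (hP.vecMul_eq_zero)
  refine ⟨Matrix.det (Matrix.of fun r r' => jacobianGenerator φ D r (t r').succ), ?_, fun f hf => ?_⟩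
  · rw [RingHom.map_det]
    exact hdet
  · rw [jacobianIdeal_eq_span] at hf ⊢
    exact exists_pow_mul_mem_of_sq_mem _ ht hf

end CriticalPoint

end DualVariety
end

noncomputable section
namespace DualVariety

/-! ## Square roots of determinants modulo an ideal -/

section Roots

variable {S : Type*} [CommRing S] {J : Ideal S} {ι : Type*} [Fintype ι] [DecidableEq ι]
  {M : Matrix ι ι S}

/-- The root is a lift of the Pfaffian of the matrix modulo `J`. The second clause will show that
its differential vanishes where the corank is at least three. -/
theorem exists_sq_sub_det_mem (h2 : (2 : S) = 0) (hM : ∀ i j, M i j - M j i ∈ J)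
    (h0 : ∀ i, M i i ∈ J) :
    ∃ f, f ^ 2 - M.det ∈ J ∧ ∀ (I : Ideal S) (s : Finset ι), J ≤ I → 3 ≤ s.card →
      (∀ i ∈ s, ∀ j, M i j ∈ I) → f ∈ I ^ 2 ⊔ J := by
  -- The Pfaffian needs an order only to select one index from each pair; any order will do.
  let _ : LinearOrder ι := LinearOrder.lift' (Fintype.equivFin ι) (Fintype.equivFin ι).injective
  set π := Ideal.Quotient.mk J with hπ
  have hsymm : (M.map π).IsSymm := by
    ext i j
    exact Ideal.Quotient.eq.2 (hM j i)
  have hdiag : ∀ i, M.map π i i = 0 := fun i => Ideal.Quotient.eq_zero_iff_mem.2 (h0 i)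
  have h2' : (2 : S ⧸ J) = 0 := by
    rw [show (2 : S ⧸ J) = π 2 from (map_ofNat π 2).symm, h2, map_zero]
  have hdet := det_eq_pfaffian_sq h2' hsymm hdiag
  obtain ⟨f, hf⟩ := Ideal.Quotient.mk_surjective (pfaffian (M.map π))
  refine ⟨f, ?_, fun I s hJI hs hI => ?_⟩
  · rw [← Ideal.Quotient.eq_zero_iff_mem, map_sub, map_pow, hf, RingHom.map_det,
      RingHom.mapMatrix_apply, hdet, sub_self]
  · have hl : ∀ i ∈ s, ∀ j, M.map π i j ∈ I.map π := fun i hi j =>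
      Ideal.mem_map_of_mem π (hI i hi j)
    have hr : ∀ i, ∀ j ∈ s, M.map π i j ∈ I.map π := fun i j hj => by
      rw [← hsymm.apply]
      exact hl j hj i
    have h := pfaffian_mem_sq s hs hl hr
    rw [← hf, ← Ideal.map_pow, Ideal.mem_map_iff_of_surjective _ Ideal.Quotient.mk_surjective] at h
    obtain ⟨g, hg, hgf⟩ := h
    rw [← sub_add_cancel f g, add_comm]
    exact Submodule.add_mem_sup hg (Ideal.Quotient.eq.1 hgf.symm)

variable {t : S} (hred : ∀ f, f ^ 2 ∈ J → ∃ e : ℕ, t ^ e * f ∈ J)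
include hred

/-- In characteristic two `(f - f')²` is the difference of the squares, hence lies in `J`; `hred`
expresses reducedness where `t` is invertible. -/
theorem exists_pow_mul_sub_mem (h2 : (2 : S) = 0) {f f' x : S} (hf : f ^ 2 - x ∈ J)
    (hf' : f' ^ 2 - x ∈ J) : ∃ e : ℕ, t ^ e * (f - f') ∈ J := by
  refine hred _ ?_
  have : (f - f') ^ 2 = (f ^ 2 - x) - (f' ^ 2 - x) := by
    linear_combination (f' ^ 2 - f * f') * h2
  rw [this]
  exact J.sub_mem hf hf'

/-- If `w² = det α`, then the elimination identity gives `det(α)² f` and `w` times the border form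
the same square modulo `J`; reducedness identifies them where `t` is invertible. -/
theorem exists_border_root {κ : Type*} [Fintype κ] [DecidableEq κ]
    {M : Matrix (κ ⊕ Fin 2) (κ ⊕ Fin 2) S} (h2 : (2 : S) = 0)
    (hM : ∀ i j, M i j - M j i ∈ J) (h0 : ∀ i, M i i ∈ J) {f : S} (hf : f ^ 2 - M.det ∈ J) :
    ∃ w, w ^ 2 - M.toBlocks₁₁.det ∈ J ∧
      ∃ e : ℕ, t ^ e * (M.toBlocks₁₁.det ^ 2 * f - w * borderForm M) ∈ J := by
  obtain ⟨w, hw, -⟩ := exists_sq_sub_det_mem (M := M.toBlocks₁₁) (J := J) h2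
    (fun i j => hM (Sum.inl i) (Sum.inl j)) fun i => h0 (Sum.inl i)
  refine ⟨w, hw, hred _ ?_⟩
  set π := Ideal.Quotient.mk J with hπ
  have hsymm : (M.map π).IsSymm := by
    ext i j
    exact Ideal.Quotient.eq.2 (hM j i)
  have hdiag : ∀ i, M.map π i i = 0 := fun i => Ideal.Quotient.eq_zero_iff_mem.2 (h0 i)
  have h2' : (2 : S ⧸ J) = 0 := by
    rw [show (2 : S ⧸ J) = π 2 from (map_ofNat π 2).symm, h2, map_zero]
  have h := det_mul_borderForm_sq h2' hsymm hdiag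
  rw [map_borderForm, show (M.map π).toBlocks₁₁ = M.toBlocks₁₁.map π from rfl,
    ← RingHom.mapMatrix_apply, ← RingHom.mapMatrix_apply, ← RingHom.map_det, ← RingHom.map_det] at h
  have hf' : π f ^ 2 = π M.det := by
    rw [← map_pow]
    exact Ideal.Quotient.eq.2 hf
  have hw' : π w ^ 2 = π M.toBlocks₁₁.det := by
    rw [← map_pow]
    exact Ideal.Quotient.eq.2 hw
  rw [← Ideal.Quotient.eq_zero_iff_mem]
  rw [map_pow, map_sub, map_mul, map_mul, map_pow]
  linear_combination π M.toBlocks₁₁.det ^ 4 * hf' + π (borderForm M) ^ 2 * hw' + h +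
    (-π M.toBlocks₁₁.det ^ 2 * π f * π w * π (borderForm M)
      + π M.toBlocks₁₁.det ^ 4 * π M.det) * h2'

end Roots

end DualVariety
end

noncomputable section
namespace DualVariety

/-! ## Adapted bases -/

section AdaptedBasis

variable {k : Type*} [Field k] {ι : Type*} [Fintype ι] [DecidableEq ι] {M : Matrix ι ι k}

omit [DecidableEq ι] in
/-- A symmetric bilinear form is nondegenerate on a complement of its kernel. -/
theorem exists_adapted_basis (hM : M.IsSymm) :
    ∃ b : Module.Basis (Fin M.rank ⊕ Fin (Fintype.card ι - M.rank)) k (ι → k),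
      (∀ a, M.mulVec (b (Sum.inr a)) = 0) ∧
      (Matrix.of fun i j => b (Sum.inl i) ⬝ᵥ M.mulVec (b (Sum.inl j))).det ≠ 0 := by
  set W : Submodule k (ι → k) := LinearMap.ker M.mulVecLin with hW
  obtain ⟨W', hc⟩ := Submodule.exists_isCompl W
  have hr := LinearMap.finrank_range_add_finrank_ker M.mulVecLin
  have hs := Submodule.finrank_add_eq_of_isCompl hc
  rw [Module.finrank_fintype_fun_eq_card] at hr hs
  change M.rank + Module.finrank k W = _ at hr
  have h1 : Module.finrank k W = Fintype.card ι - M.rank := by omega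
  have h2 : Module.finrank k W' = M.rank := by omega
  let bW := Module.finBasisOfFinrankEq k W h1
  let bW' := Module.finBasisOfFinrankEq k W' h2
  let b := (bW'.prod bW).map (Submodule.prodEquivOfIsCompl W' W hc.symm)
  have hl : ∀ i, b (Sum.inl i) = bW' i := fun i => by simp [b]
  have hrr : ∀ i, b (Sum.inr i) = bW i := fun i => by simp [b]
  have hker : ∀ a, M.mulVec (b (Sum.inr a)) = 0 := fun a => by
    rw [hrr]
    exact (bW a).2
  refine ⟨b, hker, fun h0 => ?_⟩
  -- A degenerate restriction yields a vector of the complement orthogonal to the complement. It is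
  -- also orthogonal to the kernel, so it lies in the kernel and must be zero.
  obtain ⟨c, hc0, hcz⟩ := Matrix.exists_mulVec_eq_zero_iff.2 h0
  set x : W' := ∑ j, c j • bW' j with hx
  have hxb : (x : ι → k) = ∑ j, c j • b (Sum.inl j) := by
    rw [hx]
    push_cast
    exact Finset.sum_congr rfl fun j _ => by rw [hl]
  have hi : ∀ i, b i ⬝ᵥ M.mulVec (x : ι → k) = 0 := by
    rintro (i | a)
    · have := congrFun hcz i
      rw [hxb, Matrix.mulVec_sum, dotProduct_sum]
      rw [Matrix.mulVec, dotProduct] at this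
      refine Eq.trans ?_ this
      refine Finset.sum_congr rfl fun j _ => ?_
      rw [Matrix.mulVec_smul, dotProduct_smul, smul_eq_mul, mul_comm]
      rfl
    · rw [dotProduct_mulVec_comm_of_isSymm hM, hker, dotProduct_zero]
  have hy : M.mulVec (x : ι → k) = 0 := by
    have hall : ∀ y : ι → k, y ⬝ᵥ M.mulVec (x : ι → k) = 0 := by
      intro y
      rw [← b.sum_repr y, sum_dotProduct]
      exact Finset.sum_eq_zero fun i _ => by rw [smul_dotProduct, hi, smul_zero]
    exact dotProduct_eq_zero _ fun y => by rw [dotProduct_comm]; exact hall y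
  have hx0 : (x : ι → k) = 0 :=
    (Submodule.mem_bot k).1 (hc.inf_eq_bot ▸ ⟨LinearMap.mem_ker.2 hy, x.2⟩)
  have hx0' : ∑ j, c j • bW' j = 0 := Subtype.ext hx0
  exact hc0 (funext fun j => Fintype.linearIndependent_iff.1 bW'.linearIndependent c hx0' j)

/-- On a complement of the kernel the form is alternating and nondegenerate, which is impossible in
odd dimension. -/
theorem even_rank (h2 : (2 : k) = 0) (hM : M.IsSymm) (h0 : ∀ i, M i i = 0) : Even M.rank := by
  obtain ⟨b, -, hdet⟩ := exists_adapted_basis hM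
  by_contra hodd
  refine hdet (det_eq_zero_of_odd_card h2 ?_ ?_ ?_)
  · ext i j
    exact dotProduct_mulVec_comm_of_isSymm hM _ _
  · exact fun i => dotProduct_mulVec_self_of_isSymm h2 hM h0 _
  · rw [Fintype.card_fin]
    exact Nat.not_even_iff_odd.1 hodd

theorem rank_add_two_le (h2 : (2 : k) = 0) (hM : M.IsSymm) (h0 : ∀ i, M i i = 0)
    (hι : Even (Fintype.card ι)) (hdet : M.det = 0) : M.rank + 2 ≤ Fintype.card ι := by
  have hle := M.rank_le_card_width
  have hne : M.rank ≠ Fintype.card ι := fun h => by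
    obtain ⟨z, hz, hMz⟩ := Matrix.exists_mulVec_eq_zero_iff.2 hdet
    have hr := LinearMap.finrank_range_add_finrank_ker M.mulVecLin
    rw [Module.finrank_fintype_fun_eq_card] at hr
    change M.rank + _ = _ at hr
    have h0 : Module.finrank k (LinearMap.ker M.mulVecLin) = 0 := by omega
    rw [Submodule.finrank_eq_zero] at h0
    exact hz ((Submodule.mem_bot k).1 (h0 ▸ LinearMap.mem_ker.2 hMz))
  obtain ⟨a, ha⟩ := even_rank h2 hM h0
  obtain ⟨b, hb⟩ := hι
  omega

end AdaptedBasis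

/-! ## Change of frame -/

section FrameChange

theorem exists_basis_change {k A M ι ι' : Type*} [CommRing k] [CommRing A] [Algebra k A]
    [AddCommGroup M] [Module A M] [Fintype ι] [DecidableEq ι]
    (b : Module.Basis ι' k (ι → k)) (D : Module.Basis ι A M) :
    ∃ D' : Module.Basis ι' A M, ∀ i, D' i = ∑ j, algebraMap k A (b i j) • D j := by
  refine ⟨((b.baseChange A).map (TensorProduct.piScalarRight k A A ι)).map D.equivFun.symm,
    fun i => ?_⟩
  simp [Module.Basis.equivFun_symm_apply, Algebra.smul_def]

variable {k : Type*} [Field k] {A : Type*} [CommRing A] [Algebra k A] {m : ℕ}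
  {ι ι' : Type*} [Fintype ι] [DecidableEq ι] [Fintype ι'] [DecidableEq ι']
  {φ : Fin (m + 1) → A} {D : Module.Basis ι A (Derivation k A A)}
  {D' : Module.Basis ι' A (Derivation k A A)} {b : Module.Basis ι' k (ι → k)}

omit [DecidableEq ι] [DecidableEq ι'] in
theorem jacobianIdeal_eq (D : Module.Basis ι A (Derivation k A A))
    (D' : Module.Basis ι' A (Derivation k A A)) : jacobianIdeal φ D = jacobianIdeal φ D' :=
  le_antisymm
    (jacobianIdeal_le _ (linearForm_mem_jacobianIdeal _) fun _ => linearForm_any_derivation_mem D' _)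
    (jacobianIdeal_le _ (linearForm_mem_jacobianIdeal _) fun _ => linearForm_any_derivation_mem D _)

variable (hb : ∀ i, D' i = ∑ j, algebraMap k A (b i j) • D j)
include hb

omit [DecidableEq ι] [Fintype ι'] [DecidableEq ι'] in
theorem basis_change_apply (i : ι') (a : A) : D' i a = ∑ j, algebraMap k A (b i j) * D j a := by
  rw [hb]
  change Derivation.coeFnAddMonoidHom (∑ j, algebraMap k A (b i j) • D j) a = _
  rw [map_sum, Finset.sum_apply]
  rfl

omit [DecidableEq ι] [Fintype ι'] [DecidableEq ι'] in
-- The coefficients of the change of frame are constants, killed by derivations. So no first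
-- derivatives of `Φ` appear, and the Hessian is transformed as a bilinear form even before passing
-- to the critical scheme.
theorem hessian_basis_change (i j : ι') :
    hessian φ D' i j = (fun a => algebraMap k (MvPolynomial (Fin m) A) (b i a)) ⬝ᵥ
      (hessian φ D).mulVec fun c => algebraMap k (MvPolynomial (Fin m) A) (b j c) := by
  have hA : ∀ r : k, algebraMap k (MvPolynomial (Fin m) A) r = MvPolynomial.C (algebraMap k A r) :=
    fun _ => rfl
  have h1 : ∀ l, D' i (D' j (φ l)) = ∑ a, algebraMap k A (b i a) *
      ∑ c, algebraMap k A (b j c) * D a (D c (φ l)) := by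
    intro l
    rw [basis_change_apply hb]
    refine Finset.sum_congr rfl fun a _ => ?_
    rw [basis_change_apply hb, map_sum]
    congr 1
    refine Finset.sum_congr rfl fun c _ => ?_
    rw [Derivation.leibniz, Derivation.map_algebraMap, smul_zero, add_zero, smul_eq_mul]
  rw [hessian, Matrix.of_apply]
  simp only [h1]
  rw [linearForm_sum, dotProduct]
  refine Finset.sum_congr rfl fun a _ => ?_
  rw [linearForm_mul, linearForm_sum, hA, Matrix.mulVec, dotProduct]
  congr 1
  refine Finset.sum_congr rfl fun c _ => ?_
  rw [linearForm_mul, hA, mul_comm]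
  rfl

theorem exists_det_hessian_basis_change : ∃ r : k, r ≠ 0 ∧
    (hessian φ D').det = algebraMap k (MvPolynomial (Fin m) A) r ^ 2 * (hessian φ D).det := by
  have e : ι' ≃ ι := b.indexEquiv (Pi.basisFun k ι)
  let G : Matrix ι ι k := Matrix.of fun i a => b (e.symm i) a
  have hG : IsUnit G.det := by
    have := (Pi.basisFun k ι).isUnit_det (b.reindex e)
    rw [Module.Basis.det_apply] at this
    rw [← Matrix.det_transpose]
    convert this using 2
    ext i j
    simp [G, Module.Basis.toMatrix_apply]
  refine ⟨G.det, hG.ne_zero, ?_⟩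
  set f := algebraMap k (MvPolynomial (Fin m) A) with hf
  have hmul : (hessian φ D').submatrix e.symm e.symm = G.map f * hessian φ D * (G.map f).transpose := by
    ext i j
    rw [Matrix.submatrix_apply, hessian_basis_change hb, Matrix.mul_assoc, Matrix.mul_apply']
    rfl
  rw [← Matrix.det_submatrix_equiv_self e.symm, hmul, Matrix.det_mul, Matrix.det_mul,
    Matrix.det_transpose, ← RingHom.mapMatrix_apply, ← RingHom.map_det]
  ring

variable {K : Type*} [Field K] [Algebra A K] [Algebra (MvPolynomial (Fin m) A) K]

omit [DecidableEq ι'] in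
theorem IsCriticalPoint.basis_change (hP : IsCriticalPoint φ D K) : IsCriticalPoint φ D' K where
  last := hP.last
  map_X := hP.map_X
  map_zero := hP.map_zero
  map_derivation_zero i := by
    rw [basis_change_apply hb, map_sum]
    exact Finset.sum_eq_zero fun j _ => by rw [map_mul, hP.map_derivation_zero, mul_zero]
  immersive a ha := by
    let f : k →+* K := (algebraMap A K).comp (algebraMap k A)
    let _ : Algebra k K := f.toAlgebra
    have hA : ∀ r : k, algebraMap A K (algebraMap k A r) = algebraMap k K r := fun _ => rfl
    obtain ⟨D₁, hD₁⟩ := exists_basis_change b (Pi.basisFun K ι)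
    have h1 : ∑ i, a i • D₁ i = 0 := by
      have : (∑ i, a i • D₁ i) = fun j => ∑ i, a i * algebraMap k K (b i j) := by
        ext j
        rw [Finset.sum_apply]
        refine Finset.sum_congr rfl fun i _ => ?_
        rw [hD₁, Pi.smul_apply, Finset.sum_apply, smul_eq_mul]
        congr 1
        rw [Finset.sum_eq_single j] <;> simp +contextual [eq_comm]
      rw [this]
      refine hP.immersive _ fun l => ?_
      rw [← ha l]
      simp only [Finset.sum_mul, basis_change_apply hb, map_sum, map_mul, Finset.mul_sum, hA]
      rw [Finset.sum_comm]
      exact Finset.sum_congr rfl fun i _ => Finset.sum_congr rfl fun j _ => by ring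
    exact funext fun i => Fintype.linearIndependent_iff.1 D₁.linearIndependent a h1 i

end FrameChange

end DualVariety
end

noncomputable section
namespace DualVariety

/-! ## Derivations of a quotient -/

section TangentSpace

variable {k S : Type*} [Field k] [CommRing S] [Algebra k S] (I : Ideal S) (N : Type*) [CommRing N]
  [Algebra k N] [Algebra S N] [IsScalarTower k S N]

variable (k) in
/-- The derivations of `S` into `N` that vanish on `I`. -/
def tangentSpace : Submodule k (Derivation k S N) where
  carrier := {v | ∀ s ∈ I, v s = 0}
  add_mem' := fun {v w} hv hw s hs => by rw [Derivation.add_apply, hv s hs, hw s hs, add_zero]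
  zero_mem' := fun _ _ => rfl
  smul_mem' := fun r v hv s hs => by rw [Derivation.smul_apply, hv s hs, smul_zero]

variable {N}

theorem mem_tangentSpace {v : Derivation k S N} : v ∈ tangentSpace k I N ↔ ∀ s ∈ I, v s = 0 :=
  Iff.rfl

variable (k N) [Algebra (S ⧸ I) N] [IsScalarTower S (S ⧸ I) N] [IsScalarTower k (S ⧸ I) N]

/-- Derivations of a quotient are the derivations that vanish on the ideal. -/
def derivationQuotientEquiv : Derivation k (S ⧸ I) N ≃ₗ[k] tangentSpace k I N :=
  LinearEquiv.ofBijective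
    ({ toFun := fun v => (⟨v.compAlgebraMap S, fun s hs => by
        have : Ideal.Quotient.mk I s = 0 := Ideal.Quotient.eq_zero_iff_mem.2 hs
        exact (congrArg v this).trans (map_zero v)⟩ : tangentSpace k I N)
       map_add' := fun _ _ => rfl
       map_smul' := fun _ _ => rfl } : Derivation k (S ⧸ I) N →ₗ[k] tangentSpace k I N)
    ⟨fun v w h => by
      ext x
      obtain ⟨s, rfl⟩ := Ideal.Quotient.mk_surjective x
      have h' : v.compAlgebraMap S = w.compAlgebraMap S := congrArg Subtype.val h
      exact congr($h' s),
    fun v => by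
      obtain ⟨v', hv'⟩ := exists_derivation_quotient I v.1 v.2
      exact ⟨v', Subtype.ext (Derivation.ext hv')⟩⟩

theorem derivationQuotientEquiv_apply (v : Derivation k (S ⧸ I) N) (s : S) :
    (derivationQuotientEquiv k I N v).1 s = v (Ideal.Quotient.mk I s) := rfl

end TangentSpace

/-! ## The tangent space of the critical scheme -/

section CriticalTangent

variable {k : Type*} [Field k] {A : Type*} [CommRing A] [Algebra k A] {m : ℕ} {ι : Type*}
  [Fintype ι] {φ : Fin (m + 1) → A} {D : Module.Basis ι A (Derivation k A A)}
  [Algebra.FormallySmooth k A] [Algebra.FiniteType k A] {K : Type*} [Field K] [Algebra k K]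
  [Algebra A K] [Algebra (MvPolynomial (Fin m) A) K] [IsScalarTower k A K]
  [IsScalarTower A (MvPolynomial (Fin m) A) K] [IsScalarTower k (MvPolynomial (Fin m) A) K]
  (hP : IsCriticalPoint φ D K)

variable (φ D K) in
/-- Evaluation of tangent vectors on the equations of the critical scheme. -/
def jacobianMap : Derivation k (MvPolynomial (Fin m) A) K →ₗ[k] (Option ι → K) where
  toFun v r := v (linearForm (jacobianGenerator φ D r))
  map_add' _ _ := rfl
  map_smul' _ _ := rfl

include hP

/-- Tangent vectors along the parameter space alone suffice: on them the map is given by a matrix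
with an invertible maximal minor. -/
theorem jacobianMap_surjective : Function.Surjective (jacobianMap φ D K) := by
  classical
  intro c
  set W : Matrix (Option ι) (Fin m) K := Matrix.of fun r (j : Fin m) =>
      algebraMap A K (jacobianGenerator φ D r j.succ) with hW
  obtain ⟨t, ht, hdet⟩ := exists_injective_det_ne_zero W hP.vecMul_eq_zero
  obtain ⟨b, hb⟩ := Matrix.mulVec_surjective_iff_isUnit.2
    ((Matrix.isUnit_iff_isUnit_det _).2 hdet.isUnit) c
  refine ⟨(polyFrameEquiv D K).symm (0, fun j => ∑ r, if t r = j then b r else 0), funext fun r => ?_⟩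
  change ((polyFrameEquiv D K).symm _) (linearForm (jacobianGenerator φ D r)) = _
  rw [apply_linearForm_eq D, LinearEquiv.apply_symm_apply, ← hb]
  simp only [Pi.zero_apply, mul_zero, Finset.sum_const_zero, zero_add, Finset.mul_sum, mul_ite]
  rw [Finset.sum_comm]
  simp [Matrix.mulVec, dotProduct, hW]

omit [Algebra.FormallySmooth k A] [Algebra.FiniteType k A] [IsScalarTower k A K] in
theorem tangentSpace_jacobianIdeal :
    tangentSpace k (jacobianIdeal φ D) K = LinearMap.ker (jacobianMap φ D K) := by
  ext v
  rw [LinearMap.mem_ker, mem_tangentSpace, jacobianIdeal_eq_span]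
  constructor
  · exact fun h => funext fun r => h _ (Ideal.subset_span ⟨r, rfl⟩)
  · intro h s hs
    refine derivation_eq_zero_of_mem_span v ?_ ?_ hs
    · rintro _ ⟨r, rfl⟩
      exact hP.map_jacobianGenerator r
    · rintro _ ⟨r, rfl⟩
      exact congrFun h r

/-- There are `n + m` coordinates and `n + 1` independent equations, where `n` is the length of the
frame; so the dimension is `m - 1`. -/
theorem finrank_tangentSpace_jacobianIdeal (hk : Function.Bijective (algebraMap k K)) :
    Module.finrank k (tangentSpace k (jacobianIdeal φ D) K) + 1 = m ∧
      Module.Finite k (Derivation k (MvPolynomial (Fin m) A) K) := by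
  have h1 : Module.finrank k K = 1 := by
    rw [← (LinearEquiv.ofBijective (Algebra.linearMap k K) hk).finrank_eq, Module.finrank_self]
  have hKfin : Module.Finite k K :=
    Module.Finite.equiv (LinearEquiv.ofBijective (Algebra.linearMap k K) hk)
  have hfin : Module.Finite k (Derivation k (MvPolynomial (Fin m) A) K) :=
    Module.Finite.equiv (polyFrameEquiv D K).symm
  refine ⟨?_, hfin⟩
  have h2 := LinearMap.finrank_range_add_finrank_ker (jacobianMap φ D K)
  rw [LinearMap.range_eq_top.2 (jacobianMap_surjective hP), finrank_top,
    ← tangentSpace_jacobianIdeal hP, (polyFrameEquiv D K).finrank_eq, Module.finrank_prod,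
    Module.finrank_pi_fintype, Module.finrank_pi_fintype, Module.finrank_pi_fintype] at h2
  simp only [h1, Finset.sum_const, Finset.card_univ, Fintype.card_option, Fintype.card_fin,
    smul_eq_mul, mul_one] at h2
  omega

end CriticalTangent

/-! ## Smooth points of the degeneracy scheme -/

section Degeneracy

variable {k : Type*} [Field k] {A : Type*} [CommRing A] [Algebra k A] {m : ℕ} {ι : Type*}
  [Fintype ι] {φ : Fin (m + 1) → A} {D : Module.Basis ι A (Derivation k A A)}
  [DecidableEq ι]

variable (φ D) in
/-- The ideal generated by the equations of the critical scheme and the square roots of the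
determinant of the Hessian. -/
def rootIdeal : Ideal (MvPolynomial (Fin m) A) :=
  jacobianIdeal φ D ⊔ Ideal.span {f | f ^ 2 - (hessian φ D).det ∈ jacobianIdeal φ D}

variable {f : MvPolynomial (Fin m) A} (hf : f ^ 2 - (hessian φ D).det ∈ jacobianIdeal φ D)

theorem jacobianIdeal_le_rootIdeal : jacobianIdeal φ D ≤ rootIdeal φ D := le_sup_left

include hf in
theorem mem_rootIdeal : f ∈ rootIdeal φ D := Ideal.mem_sup_right (Ideal.subset_span hf)

include hf in
-- Two square roots agree modulo the Jacobian ideal up to a power of `δ`, so near the point a single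
-- root `f` replaces all of them.
theorem exists_pow_mul_mem_of_mem_rootIdeal (h2 : (2 : A) = 0) {δ : A}
    (hred : ∀ f : MvPolynomial (Fin m) A, f ^ 2 ∈ jacobianIdeal φ D →
      ∃ e : ℕ, MvPolynomial.C δ ^ e * f ∈ jacobianIdeal φ D) {s : MvPolynomial (Fin m) A}
    (hs : s ∈ rootIdeal φ D) :
    ∃ e : ℕ, MvPolynomial.C δ ^ e * s ∈ jacobianIdeal φ D ⊔ Ideal.span {f} := by
  have h2' : (2 : MvPolynomial (Fin m) A) = 0 := by
    rw [show (2 : MvPolynomial (Fin m) A) = MvPolynomial.C 2 from (map_ofNat _ 2).symm, h2, map_zero]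
  obtain ⟨a, ha, b, hb, rfl⟩ := Submodule.mem_sup.1 hs
  suffices ∃ e : ℕ, MvPolynomial.C δ ^ e * b ∈ jacobianIdeal φ D ⊔ Ideal.span {f} by
    obtain ⟨e, he⟩ := this
    refine ⟨e, ?_⟩
    rw [mul_add]
    exact Ideal.add_mem _ (Ideal.mem_sup_left (Ideal.mul_mem_left _ _ ha)) he
  refine Submodule.span_induction
    (p := fun b _ => ∃ e : ℕ, MvPolynomial.C δ ^ e * b ∈ jacobianIdeal φ D ⊔ Ideal.span {f})
    (fun g hg => ?_) ⟨0, by simp⟩ (fun x y _ _ hx hy => ?_) (fun r x _ hx => ?_) hb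
  · obtain ⟨e, he⟩ := exists_pow_mul_sub_mem hred h2' hg hf
    refine ⟨e, ?_⟩
    rw [← sub_add_cancel g f, mul_add]
    exact Ideal.add_mem _ (Ideal.mem_sup_left he)
      (Ideal.mul_mem_left _ _ (Ideal.mem_sup_right (Ideal.subset_span rfl)))
  · obtain ⟨e, he⟩ := hx
    obtain ⟨e', he'⟩ := hy
    refine ⟨e + e', ?_⟩
    rw [mul_add, pow_add]
    refine Ideal.add_mem _ ?_ ?_
    · rw [mul_right_comm]
      exact Ideal.mul_mem_right _ _ he
    · rw [mul_assoc]
      exact Ideal.mul_mem_left _ _ he'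
  · obtain ⟨e, he⟩ := hx
    refine ⟨e, ?_⟩
    rw [smul_eq_mul, mul_left_comm]
    exact Ideal.mul_mem_left _ _ he

variable {N : Type*} [CommRing N] [Algebra k N] [Algebra (MvPolynomial (Fin m) A) N]
  [IsScalarTower k (MvPolynomial (Fin m) A) N]

include hf in
/-- A derivation vanishes on the ideal of the degeneracy scheme as soon as it does on the equations
of the critical scheme and on one square root of the determinant. -/
theorem mem_tangentSpace_rootIdeal (h2 : (2 : A) = 0) {δ : A}
    (hred : ∀ f : MvPolynomial (Fin m) A, f ^ 2 ∈ jacobianIdeal φ D →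
      ∃ e : ℕ, MvPolynomial.C δ ^ e * f ∈ jacobianIdeal φ D)
    (hδ : IsUnit (algebraMap (MvPolynomial (Fin m) A) N (MvPolynomial.C δ)))
    (hN : ∀ s ∈ rootIdeal φ D, algebraMap (MvPolynomial (Fin m) A) N s = 0)
    {v : Derivation k (MvPolynomial (Fin m) A) N} :
    v ∈ tangentSpace k (rootIdeal φ D) N ↔ v ∈ tangentSpace k (jacobianIdeal φ D) N ∧ v f = 0 := by
  refine ⟨fun h => ⟨fun s hs => h s (jacobianIdeal_le_rootIdeal hs), h f (mem_rootIdeal hf)⟩,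
    fun ⟨h, hvf⟩ s hs => ?_⟩
  obtain ⟨e, he⟩ := exists_pow_mul_mem_of_mem_rootIdeal hf h2 hred hs
  have hle : jacobianIdeal φ D ⊔ Ideal.span {f} ≤ rootIdeal φ D :=
    sup_le jacobianIdeal_le_rootIdeal
      ((Ideal.span_singleton_le_iff_mem _).2 (mem_rootIdeal hf))
  refine derivation_eq_zero_of_pow_mul_mem v (fun s hs => hN s (hle hs)) (fun x hx => ?_) hδ he
  obtain ⟨a, ha, b, hb, rfl⟩ := Submodule.mem_sup.1 hx
  rw [map_add, h a ha, zero_add]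
  refine derivation_eq_zero_of_mem_span v ?_ ?_ hb
  · rintro _ rfl
    exact hN _ (mem_rootIdeal hf)
  · rintro _ rfl
    exact hvf

end Degeneracy

end DualVariety
end

noncomputable section
namespace DualVariety

/-! ### Smoothness of the degeneracy scheme at a rational point -/

section SmoothPoint

theorem exists_isStandardSmoothOfRelativeDimension (R S : Type*) [CommRing R] [CommRing S]
    [Algebra R S] [Algebra.IsStandardSmooth R S] :
    ∃ d, Algebra.IsStandardSmoothOfRelativeDimension d R S := by
  obtain ⟨ι, σ, _, _, ⟨P⟩⟩ := ‹Algebra.IsStandardSmooth R S›.out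
  exact ⟨P.dimension, P.isStandardSmoothOfRelativeDimension rfl⟩

variable {k : Type*} [Field k] {A : Type*} [CommRing A] [Algebra k A] {m : ℕ} {ι : Type*}
  [Fintype ι] [DecidableEq ι] {φ : Fin (m + 1) → A} {D : Module.Basis ι A (Derivation k A A)}
  [Algebra.FormallySmooth k A] [Algebra.FiniteType k A] {K : Type*} [Field K] [Algebra k K]
  [Algebra A K] [Algebra (MvPolynomial (Fin m) A) K] [IsScalarTower k A K]
  [IsScalarTower A (MvPolynomial (Fin m) A) K] [IsScalarTower k (MvPolynomial (Fin m) A) K]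
  [IsDomain A] {I : Ideal (MvPolynomial (Fin m) A)}
  [Algebra (MvPolynomial (Fin m) A ⧸ I) K]
  [IsScalarTower (MvPolynomial (Fin m) A) (MvPolynomial (Fin m) A ⧸ I) K]
  [IsScalarTower k (MvPolynomial (Fin m) A ⧸ I) K]

/-- The degeneracy scheme is smooth of codimension one in the critical scheme precisely at the
points where the differential of the square root of the determinant does not vanish. -/
theorem isSmoothOfDimAt_iff (h2 : (2 : A) = 0) (hI : I = rootIdeal φ D)
    (hk : Function.Bijective (algebraMap k K))
    (hP : IsCriticalPoint φ D K) (hm : 2 ≤ m) {f : MvPolynomial (Fin m) A}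
    (hf : f ^ 2 - (hessian φ D).det ∈ jacobianIdeal φ D)
    {q : Ideal (MvPolynomial (Fin m) A ⧸ I)}
    (hq : RingHom.ker (algebraMap (MvPolynomial (Fin m) A ⧸ I) K) = q) :
    IsSmoothOfDimAt k q (m - 2) ↔ ∃ v ∈ tangentSpace k (jacobianIdeal φ D) K, v f ≠ 0 := by
  obtain ⟨δ, hδ, hred⟩ := hP.exists_reduced
  have hδ' : algebraMap (MvPolynomial (Fin m) A) K (MvPolynomial.C δ) ≠ 0 := by
    rwa [← MvPolynomial.algebraMap_eq, ← IsScalarTower.algebraMap_apply]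
  have hN : ∀ s ∈ I, algebraMap (MvPolynomial (Fin m) A) K s = 0 := fun s hs => by
    rw [IsScalarTower.algebraMap_apply (MvPolynomial (Fin m) A) (MvPolynomial (Fin m) A ⧸ I) K]
    have : algebraMap (MvPolynomial (Fin m) A) (MvPolynomial (Fin m) A ⧸ I) s = 0 := Ideal.Quotient.eq_zero_iff_mem.2 hs
    rw [this, map_zero]
  obtain ⟨hfinrank, hfin⟩ := finrank_tangentSpace_jacobianIdeal hP hk
  have hmem : ∀ v : Derivation k (MvPolynomial (Fin m) A) K, v ∈ tangentSpace k I K ↔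
      v ∈ tangentSpace k (jacobianIdeal φ D) K ∧ v f = 0 := fun v =>
    by
    rw [hI]
    exact mem_tangentSpace_rootIdeal hf h2 hred hδ'.isUnit (hI ▸ hN)
  have hder := (derivationQuotientEquiv k I K).finrank_eq
  have hdim : (∃ v ∈ tangentSpace k (jacobianIdeal φ D) K, v f ≠ 0) →
      Module.finrank k (Derivation k (MvPolynomial (Fin m) A ⧸ I) K) = m - 2 := by
    rintro ⟨v₀, hv₀, hv₀f⟩
    let ev : tangentSpace k (jacobianIdeal φ D) K →ₗ[k] K :=
      { toFun := fun v => v.1 f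
        map_add' := fun _ _ => rfl
        map_smul' := fun _ _ => rfl }
    let e : tangentSpace k I K ≃ₗ[k] LinearMap.ker ev :=
      { toFun := fun v => ⟨⟨v.1, ((hmem _).1 v.2).1⟩, ((hmem _).1 v.2).2⟩
        invFun := fun v => ⟨v.1.1, (hmem _).2 ⟨v.1.2, v.2⟩⟩
        map_add' := fun _ _ => rfl
        map_smul' := fun _ _ => rfl
        left_inv := fun _ => rfl
        right_inv := fun _ => rfl }
    have hev : LinearMap.range ev = ⊤ := by
      rw [LinearMap.range_eq_top]
      intro c
      obtain ⟨r, hr⟩ := hk.2 (c * (v₀ f)⁻¹)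
      refine ⟨r • ⟨v₀, hv₀⟩, ?_⟩
      change r • v₀ f = c
      rw [Algebra.smul_def, hr, mul_assoc, inv_mul_cancel₀ hv₀f, mul_one]
    have h := LinearMap.finrank_range_add_finrank_ker (K := k)
      (V := tangentSpace k (jacobianIdeal φ D) K) (V₂ := K) ev
    rw [hev, finrank_top, ← e.finrank_eq, ← hder,
      ← (LinearEquiv.ofBijective (Algebra.linearMap k K) hk).finrank_eq, Module.finrank_self] at h
    omega
  constructor
  · rintro ⟨g, hg, hsm⟩
    -- If `df` vanished on the tangent space of the critical scheme, the tangent space of the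
    -- degeneracy scheme would have dimension `m - 1` instead of `m - 2`.
    by_contra! hall
    have hg' : algebraMap (MvPolynomial (Fin m) A ⧸ I) K g ≠ 0 := fun h => hg (hq ▸ h)
    have h := finrank_derivation_of_isStandardSmooth hk hg' (d := m - 2)
    have hEq : tangentSpace k I K = tangentSpace k (jacobianIdeal φ D) K := by
      ext v
      rw [hmem]
      exact ⟨fun h => h.1, fun h => ⟨h, hall v h⟩⟩
    rw [hder, hEq] at h
    omega
  · intro hv
    have hdim' := hdim hv
    obtain ⟨v₀, hv₀, hv₀f⟩ := hv
    classical
    -- The tangent vectors `u` are dual to the equations of the critical scheme. Together with `v₀`,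
    -- which kills these equations but not `f`, they give a block triangular Jacobian matrix of
    -- determinant `v₀ f`.
    choose u hu using fun r : Option ι => jacobianMap_surjective hP (Pi.single r 1)
    have hu' : ∀ r r', u r (linearForm (jacobianGenerator φ D r')) =
        if r = r' then 1 else 0 := fun r r' => by
      have := congrFun (hu r) r'
      rw [Pi.single_apply] at this
      simp only [eq_comm (a := r)]
      exact this
    have : Algebra.FormallySmooth k (MvPolynomial (Fin m) A) := Algebra.FormallySmooth.comp k A (MvPolynomial (Fin m) A)
    have hqp : q.IsPrime := hq ▸ RingHom.ker_isPrime _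
    let h : Unit ⊕ Option ι → (MvPolynomial (Fin m) A) :=
      Sum.elim (fun _ => f) fun r => linearForm (jacobianGenerator φ D r)
    have hsm : Algebra.IsSmoothAt k q := by
      refine isSmoothAt_of_det_ne_zero (K := K) q hq h ?_ ?_ (Sum.elim (fun _ => v₀) u) ?_
      · rintro (_ | r)
        · exact hI ▸ mem_rootIdeal hf
        · refine hI ▸ jacobianIdeal_le_rootIdeal ?_
          rw [jacobianIdeal_eq_span]
          exact Ideal.subset_span ⟨r, rfl⟩
      · intro s hs
        obtain ⟨e, he⟩ := exists_pow_mul_mem_of_mem_rootIdeal hf h2 hred (hI ▸ hs)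
        refine ⟨MvPolynomial.C δ ^ e, by rw [map_pow]; exact pow_ne_zero _ hδ', ?_⟩
        refine (sup_le ?_ ?_ : jacobianIdeal φ D ⊔ Ideal.span {f} ≤ _) he
        · rw [jacobianIdeal_eq_span]
          refine Ideal.span_mono ?_
          rintro _ ⟨r, rfl⟩
          exact ⟨Sum.inr r, rfl⟩
        · rw [Ideal.span_singleton_le_iff_mem]
          exact Ideal.subset_span ⟨Sum.inl (), rfl⟩
      · have hblock : (Matrix.of fun i j => (Sum.elim (fun _ : Unit => v₀) u :
            Unit ⊕ Option ι → Derivation k (MvPolynomial (Fin m) A) K) i (h j)) =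
            Matrix.fromBlocks (Matrix.of fun _ _ => v₀ f) 0
              (Matrix.of fun r _ => u r f) 1 := by
          ext (_ | r) (_ | r')
          · rfl
          · exact hv₀ _ (by rw [jacobianIdeal_eq_span]; exact Ideal.subset_span ⟨r', rfl⟩)
          · rfl
          · exact (hu' r r').trans (Matrix.one_apply).symm
        rw [hblock, Matrix.det_fromBlocks_zero₁₂, Matrix.det_one, mul_one, Matrix.det_unique]
        exact hv₀f
    have : Algebra.FiniteType k (MvPolynomial (Fin m) A ⧸ I) := by
      have : Algebra.FiniteType k (MvPolynomial (Fin m) A) := Algebra.FiniteType.trans (S := A) inferInstance inferInstance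
      exact Algebra.FiniteType.trans (S := MvPolynomial (Fin m) A) this inferInstance
    have : Algebra.FinitePresentation k (MvPolynomial (Fin m) A ⧸ I) :=
      Algebra.FinitePresentation.of_finiteType.1 this
    obtain ⟨g, hg, hstd⟩ := Algebra.IsSmoothAt.exists_notMem_isStandardSmooth k q
    -- The relative dimension is not known in advance; it is read off from the tangent space at the
    -- point, of dimension `m - 2`.
    obtain ⟨d, hd⟩ := exists_isStandardSmoothOfRelativeDimension k (Localization.Away g)
    have hg' : algebraMap (MvPolynomial (Fin m) A ⧸ I) K g ≠ 0 := fun h => hg (hq ▸ h)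
    have h' := finrank_derivation_of_isStandardSmooth hk hg' (d := d)
    rw [hdim'] at h'
    exact ⟨g, hg, h' ▸ hd⟩

end SmoothPoint

end DualVariety
end

noncomputable section
namespace DualVariety

set_option linter.unusedSectionVars false

/-! ## The differential of the square root of the determinant of the Hessian -/

section HessianRoot

variable {k : Type*} [Field k] {A : Type*} [CommRing A] [Algebra k A] {m : ℕ} {ι : Type*}
  [Fintype ι] {φ : Fin (m + 1) → A} {D : Module.Basis ι A (Derivation k A A)}

omit [Fintype ι] in
theorem two_eq_zero_mvPolynomial (h2 : (2 : A) = 0) : (2 : MvPolynomial (Fin m) A) = 0 := by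
  rw [show (2 : MvPolynomial (Fin m) A) = MvPolynomial.C 2 from (map_ofNat _ 2).symm, h2, map_zero]

theorem exists_hessian_root [DecidableEq ι] (D : Module.Basis ι A (Derivation k A A))
    (h2 : (2 : A) = 0) :
    ∃ f, f ^ 2 - (hessian φ D).det ∈ jacobianIdeal φ D ∧
      ∀ (I : Ideal (MvPolynomial (Fin m) A)) (s : Finset ι), jacobianIdeal φ D ≤ I → 3 ≤ s.card →
        (∀ i ∈ s, ∀ j, hessian φ D i j ∈ I) → f ∈ I ^ 2 ⊔ jacobianIdeal φ D :=
  exists_sq_sub_det_mem (two_eq_zero_mvPolynomial h2) (hessian_sub_mem D) (hessian_self_mem D h2)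

variable {N : Type*} [CommRing N] [Algebra k N] [Algebra (MvPolynomial (Fin m) A) N]
  [IsScalarTower k (MvPolynomial (Fin m) A) N]
  {t : MvPolynomial (Fin m) A}
  (hred : ∀ f : MvPolynomial (Fin m) A, f ^ 2 ∈ jacobianIdeal φ D →
    ∃ e : ℕ, t ^ e * f ∈ jacobianIdeal φ D)
  (ht : IsUnit (algebraMap (MvPolynomial (Fin m) A) N t))
  (hN : ∀ s ∈ jacobianIdeal φ D, algebraMap (MvPolynomial (Fin m) A) N s = 0)

include hred ht hN

omit [Fintype ι] [Algebra k N] [IsScalarTower k (MvPolynomial (Fin m) A) N] in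
theorem map_root_eq (h2 : (2 : A) = 0) {f f' x : MvPolynomial (Fin m) A}
    (hf : f ^ 2 - x ∈ jacobianIdeal φ D) (hf' : f' ^ 2 - x ∈ jacobianIdeal φ D) :
    algebraMap (MvPolynomial (Fin m) A) N f = algebraMap (MvPolynomial (Fin m) A) N f' := by
  obtain ⟨e, he⟩ := exists_pow_mul_sub_mem hred (two_eq_zero_mvPolynomial h2) hf hf'
  have := eq_zero_of_pow_mul_mem hN ht he
  rwa [map_sub, sub_eq_zero] at this

omit [Fintype ι] in
theorem derivation_root_eq (h2 : (2 : A) = 0) {f f' x : MvPolynomial (Fin m) A}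
    (hf : f ^ 2 - x ∈ jacobianIdeal φ D) (hf' : f' ^ 2 - x ∈ jacobianIdeal φ D)
    {v : Derivation k (MvPolynomial (Fin m) A) N} (hv : v ∈ tangentSpace k (jacobianIdeal φ D) N) :
    v f = v f' := by
  obtain ⟨e, he⟩ := exists_pow_mul_sub_mem hred (two_eq_zero_mvPolynomial h2) hf hf'
  have := derivation_eq_zero_of_pow_mul_mem v hN hv ht he
  rwa [map_sub, sub_eq_zero] at this

end HessianRoot

/-! ### The degeneracy scheme near an invertible block of the Hessian -/

section Border

variable {k : Type*} [Field k] {A : Type*} [CommRing A] [Algebra k A] {m : ℕ} {κ : Type*}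
  [Fintype κ] [DecidableEq κ] {φ : Fin (m + 1) → A}
  {D : Module.Basis (κ ⊕ Fin 2) A (Derivation k A A)}
  {N : Type*} [CommRing N] [Algebra k N] [Algebra (MvPolynomial (Fin m) A) N]
  [IsScalarTower k (MvPolynomial (Fin m) A) N]
  {t : MvPolynomial (Fin m) A}
  (hred : ∀ f : MvPolynomial (Fin m) A, f ^ 2 ∈ jacobianIdeal φ D →
    ∃ e : ℕ, t ^ e * f ∈ jacobianIdeal φ D)
  (ht : IsUnit (algebraMap (MvPolynomial (Fin m) A) N t))
  (hN : ∀ s ∈ jacobianIdeal φ D, algebraMap (MvPolynomial (Fin m) A) N s = 0)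
  (hd : IsUnit ((hessian φ D).map (algebraMap (MvPolynomial (Fin m) A) N)).toBlocks₁₁.det)
  {f : MvPolynomial (Fin m) A} (hf : f ^ 2 - (hessian φ D).det ∈ jacobianIdeal φ D)
  (hfN : algebraMap (MvPolynomial (Fin m) A) N f = 0)

include hred ht hN hd hf hfN

/-- Near a point where the upper left block of the Hessian is invertible, the degeneracy scheme is
defined by the border form. -/
theorem border_relation (h2 : (2 : A) = 0) :
    borderForm ((hessian φ D).map (algebraMap (MvPolynomial (Fin m) A) N)) = 0 ∧
      ∀ v ∈ tangentSpace k (jacobianIdeal φ D) N,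
        v f = 0 ↔ v (borderForm (hessian φ D)) = 0 := by
  obtain ⟨w, hw, e, he⟩ := exists_border_root hred (two_eq_zero_mvPolynomial h2)
    (hessian_sub_mem D) (hessian_self_mem D h2) hf
  have hd' : IsUnit (algebraMap (MvPolynomial (Fin m) A) N (hessian φ D).toBlocks₁₁.det) := by
    rw [RingHom.map_det]
    exact hd
  have hwd : algebraMap (MvPolynomial (Fin m) A) N w ^ 2 =
      algebraMap (MvPolynomial (Fin m) A) N (hessian φ D).toBlocks₁₁.det := by
    have := hN _ hw
    rwa [map_sub, map_pow, sub_eq_zero] at this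
  have hwu : IsUnit (algebraMap (MvPolynomial (Fin m) A) N w) := by
    rw [← hwd] at hd'
    exact (isUnit_pow_iff two_ne_zero).1 hd'
  have hu : algebraMap (MvPolynomial (Fin m) A) N (borderForm (hessian φ D)) = 0 := by
    have := eq_zero_of_pow_mul_mem hN ht he
    rw [map_sub, map_mul, map_mul, hfN, mul_zero, zero_sub, neg_eq_zero] at this
    exact (hwu.mul_right_eq_zero).1 this
  refine ⟨by rw [map_borderForm, hu], fun v hv => ?_⟩
  -- Differentiating `det(α)² f = w u`, where `u` is the border form, at values where `f` and `u`
  -- vanish gives `det(α)² v(f) = w v(u)`, and both coefficients are units.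
  have h := derivation_eq_zero_of_pow_mul_mem v hN hv ht he
  rw [map_sub, Derivation.leibniz, Derivation.leibniz, Algebra.smul_def, Algebra.smul_def,
    Algebra.smul_def, Algebra.smul_def, hfN, hu, zero_mul, zero_mul, add_zero, add_zero,
    sub_eq_zero, map_pow] at h
  constructor
  · intro h0
    rw [h0, mul_zero, eq_comm] at h
    exact (hwu.mul_right_eq_zero).1 h
  · intro h0
    rw [h0, mul_zero] at h
    exact ((hd'.pow 2).mul_right_eq_zero).1 h

/-- At a point where the last two rows of the Hessian vanish, the differential of the local
equation of the degeneracy scheme is that of the last off-diagonal entry of the Hessian. -/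
theorem derivation_root_eq_zero_iff (h2 : (2 : A) = 0)
    (h0 : ∀ a i, algebraMap (MvPolynomial (Fin m) A) N (hessian φ D (Sum.inr a) i) = 0)
    {v : Derivation k (MvPolynomial (Fin m) A) N} (hv : v ∈ tangentSpace k (jacobianIdeal φ D) N) :
    v f = 0 ↔ v (hessian φ D (Sum.inr 0) (Sum.inr 1)) = 0 := by
  rw [(border_relation hred ht hN hd hf hfN h2).2 v hv]
  have hsymm := hessian_map_isSymm D hN
  set M := (hessian φ D).map (algebraMap (MvPolynomial (Fin m) A) N) with hM
  have h0' : ∀ i a, M i (Sum.inr a) = 0 := fun i a => by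
    rw [← hsymm.apply]
    exact h0 a i
  -- Here `β = 0`, so the border vectors are `det α` times unit vectors, and the derivative of the
  -- border form is `det(α)²` times that of a single entry.
  have hz : ∀ a, borderVec M a = M.toBlocks₁₁.det • Pi.single (Sum.inr a) 1 := by
    intro a
    have h12 : M.toBlocks₁₂ = 0 := by
      ext i b
      exact h0' _ _
    ext (i | b)
    · simp [borderVec, h12]
    · simp [borderVec, Pi.single_apply]
  have hMz : ∀ a, M.mulVec (borderVec M a) = 0 := by
    intro a
    ext i
    rw [hz, Matrix.mulVec_smul, Matrix.mulVec_single_one]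
    simp [h0']
  rw [derivation_borderForm v hsymm hMz, Finset.sum_eq_single (Sum.inr 0),
    Finset.sum_eq_single (Sum.inr 1), ← hM, hz, hz]
  · simp only [Pi.smul_apply, Pi.single_eq_same, smul_eq_mul, mul_one]
    rw [hd.mul_right_eq_zero, hd.mul_right_eq_zero]
  · intro j _ hj
    rw [← hM, hz 1]
    simp [Pi.single_eq_of_ne hj]
  · simp
  · intro i _ hi
    rw [← hM, hz 0]
    simp [Pi.single_eq_of_ne hi]
  · simp

end Border

/-! ### The rank of the Hessian at smooth points -/

section Rank

variable {k : Type*} [Field k] {A : Type*} [CommRing A] [Algebra k A] {m : ℕ} {ι ι' : Type*}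
  [Fintype ι] [DecidableEq ι] [Fintype ι'] [DecidableEq ι'] {φ : Fin (m + 1) → A}
  {D : Module.Basis ι A (Derivation k A A)} {D' : Module.Basis ι' A (Derivation k A A)}
  {b : Module.Basis ι' k (ι → k)}
  {K : Type*} [Field K] [Algebra k K]
  [Algebra A K] [Algebra (MvPolynomial (Fin m) A) K] [IsScalarTower k A K]
  [IsScalarTower A (MvPolynomial (Fin m) A) K] [IsScalarTower k (MvPolynomial (Fin m) A) K]
  [IsDomain A]

omit [Fintype ι] [DecidableEq ι] [IsScalarTower k A K]
  [IsScalarTower k (MvPolynomial (Fin m) A) K] [IsDomain A] [Algebra k K] in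
theorem algebraMap_C_ne_zero {δ : A} (hδ : algebraMap A K δ ≠ 0) :
    IsUnit (algebraMap (MvPolynomial (Fin m) A) K (MvPolynomial.C δ)) := by
  rw [← MvPolynomial.algebraMap_eq, ← IsScalarTower.algebraMap_apply]
  exact hδ.isUnit

/-- Change of frame multiplies the square root of the determinant of the Hessian by a constant. -/
theorem exists_root_basis_change (h2 : (2 : A) = 0) (hP : IsCriticalPoint φ D K)
    (hb : ∀ i, D' i = ∑ j, algebraMap k A (b i j) • D j) {f f' : MvPolynomial (Fin m) A}
    (hf : f ^ 2 - (hessian φ D).det ∈ jacobianIdeal φ D)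
    (hf' : f' ^ 2 - (hessian φ D').det ∈ jacobianIdeal φ D') :
    (algebraMap (MvPolynomial (Fin m) A) K f = 0 →
      algebraMap (MvPolynomial (Fin m) A) K f' = 0) ∧
    ∀ v ∈ tangentSpace k (jacobianIdeal φ D) K, v f = 0 ↔ v f' = 0 := by
  obtain ⟨δ, hδ, hred⟩ := hP.exists_reduced
  obtain ⟨r, hr, hdet⟩ := exists_det_hessian_basis_change (φ := φ) hb
  have hfr : (algebraMap k (MvPolynomial (Fin m) A) r * f) ^ 2 - (hessian φ D').det ∈
      jacobianIdeal φ D := by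
    rw [hdet, mul_pow, ← mul_sub]
    exact Ideal.mul_mem_left _ _ hf
  rw [← jacobianIdeal_eq D D'] at hf'
  refine ⟨fun h0 => ?_, fun v hv => ?_⟩
  · rw [← map_root_eq hred (algebraMap_C_ne_zero hδ) hP.map_eq_zero h2 hfr hf', map_mul, h0,
      mul_zero]
  · rw [← derivation_root_eq hred (algebraMap_C_ne_zero hδ) hP.map_eq_zero h2 hfr hf' hv,
      ← Algebra.smul_def, Derivation.map_smul, smul_eq_zero]
    simp [hr]

theorem exists_hessian_eq_map (hk : Function.Bijective (algebraMap k K)) :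
    ∃ H₀ : Matrix ι ι k,
      H₀.map (algebraMap k K) = (hessian φ D).map (algebraMap (MvPolynomial (Fin m) A) K) := by
  choose g hg using hk.2
  exact ⟨((hessian φ D).map (algebraMap (MvPolynomial (Fin m) A) K)).map g, by ext; simp [hg]⟩

theorem map_hessian_basis_change (hb : ∀ i, D' i = ∑ j, algebraMap k A (b i j) • D j)
    {H₀ : Matrix ι ι k}
    (hH₀ : H₀.map (algebraMap k K) = (hessian φ D).map (algebraMap (MvPolynomial (Fin m) A) K))
    (i j : ι') :
    algebraMap (MvPolynomial (Fin m) A) K (hessian φ D' i j) =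
      algebraMap k K (b i ⬝ᵥ H₀.mulVec (b j)) := by
  rw [hessian_basis_change hb]
  have h : ∀ a c, algebraMap (MvPolynomial (Fin m) A) K (hessian φ D a c) =
      algebraMap k K (H₀ a c) := fun a c => congrFun (congrFun hH₀.symm a) c
  simp only [dotProduct, Matrix.mulVec, map_sum, map_mul, ← IsScalarTower.algebraMap_apply, h]

variable {H₀ : Matrix ι ι k}
  (hH₀ : H₀.map (algebraMap k K) = (hessian φ D).map (algebraMap (MvPolynomial (Fin m) A) K))
  {f : MvPolynomial (Fin m) A} (hf : f ^ 2 - (hessian φ D).det ∈ jacobianIdeal φ D)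
  (hfK : algebraMap (MvPolynomial (Fin m) A) K f = 0) (h2 : (2 : A) = 0)
  (hP : IsCriticalPoint φ D K)

include hH₀ hP

theorem isSymm_of_map_hessian : H₀.IsSymm := by
  have h := hessian_map_isSymm D hP.map_eq_zero
  rw [← hH₀] at h
  ext i j
  exact (algebraMap k K).injective (congrFun (congrFun h i) j)

include h2 in
theorem diag_eq_zero_of_map_hessian (i : ι) : H₀ i i = 0 := by
  have h := hessian_map_self D hP.map_eq_zero h2 i
  rw [← hH₀] at h
  exact (map_eq_zero (algebraMap k K)).1 h

include hf hfK h2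

/-- At a smooth point of the degeneracy scheme the Hessian has corank two. -/
theorem rank_add_two_eq (hι : Even (Fintype.card ι))
    (hv : ∃ v ∈ tangentSpace k (jacobianIdeal φ D) K, v f ≠ 0) :
    H₀.rank + 2 = Fintype.card ι := by
  have hk2 : (2 : k) = 0 :=
    (algebraMap k A).injective (by rw [map_ofNat, h2, map_zero])
  have hsymm := isSymm_of_map_hessian hH₀ hP
  have hdet : H₀.det = 0 := by
    have := hP.map_eq_zero _ hf
    rw [map_sub, map_pow, hfK, RingHom.map_det, RingHom.mapMatrix_apply, ← hH₀,
      ← RingHom.mapMatrix_apply, ← RingHom.map_det] at this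
    simpa using this
  have hle := rank_add_two_le hk2 hsymm (diag_eq_zero_of_map_hessian hH₀ h2 hP) hι hdet
  by_contra hne
  obtain ⟨v, hv, hvf⟩ := hv
  obtain ⟨b, hb0, -⟩ := exists_adapted_basis hsymm
  obtain ⟨D', hb⟩ := exists_basis_change b D
  obtain ⟨f', hf', hI⟩ := exists_hessian_root (φ := φ) D' h2
  refine hvf (((exists_root_basis_change h2 hP hb hf hf').2 v hv).2 ?_)
  have hJ : jacobianIdeal φ D' ≤ RingHom.ker (algebraMap (MvPolynomial (Fin m) A) K) := by
    rw [← jacobianIdeal_eq D D']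
    exact hP.map_eq_zero
  -- In a frame adapted to the kernel the rows of the kernel vectors vanish at the point. If the
  -- corank is not two, there are at least three, and the root lies in the square of the maximal
  -- ideal plus the Jacobian ideal; tangent vectors of the critical scheme kill both.
  have hmem := hI (RingHom.ker (algebraMap (MvPolynomial (Fin m) A) K))
    (Finset.univ.map Function.Embedding.inr) hJ (by simp; omega) (fun i hi j => by
      obtain ⟨a, -, rfl⟩ := Finset.mem_map.1 hi
      rw [RingHom.mem_ker, map_hessian_basis_change hb hH₀, Function.Embedding.inr_apply,
        dotProduct_mulVec_comm_of_isSymm hsymm, hb0, dotProduct_zero, map_zero])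
  obtain ⟨x, hx, y, hy, rfl⟩ := Submodule.mem_sup.1 hmem
  rw [← jacobianIdeal_eq D D'] at hy
  rw [map_add, derivation_eq_zero_of_mem_sq v hx, hv y hy, add_zero]

end Rank

end DualVariety
end

noncomputable section
namespace DualVariety

set_option linter.unusedSectionVars false

/-! ## The kernel of the projection to the parameter space -/

section FrameCoord

variable {k : Type*} [CommRing k] {A : Type*} [CommRing A] [Algebra k A]
  [Algebra.FormallySmooth k A] [Algebra.FiniteType k A] {ι : Type*} [Fintype ι]
  (D : Module.Basis ι A (Derivation k A A)) {m : ℕ} {N : Type*} [CommRing N] [Algebra k N]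
  [Algebra A N] [Algebra (MvPolynomial (Fin m) A) N] [IsScalarTower k A N]
  [IsScalarTower A (MvPolynomial (Fin m) A) N] [IsScalarTower k (MvPolynomial (Fin m) A) N]

theorem polyFrameEquiv_fst_eq {v : Derivation k (MvPolynomial (Fin m) A) N} {c : ι → N}
    (hc : ∀ a, v (MvPolynomial.C a) =
      ∑ i, (MvPolynomial.C (D i a) : MvPolynomial (Fin m) A) • c i) :
    (polyFrameEquiv D N v).1 = c := by
  rw [← sub_eq_zero]
  refine eq_zero_of_sum_smul_eq_zero D fun a => ?_
  have h := apply_C_eq_sum_polyFrameEquiv D v a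
  rw [hc a, eq_comm, ← sub_eq_zero, ← Finset.sum_sub_distrib] at h
  refine Eq.trans (Finset.sum_congr rfl fun i _ => ?_) h
  rw [Pi.sub_apply, smul_sub]
  congr 1 <;> exact (algebraMap_smul (MvPolynomial (Fin m) A) (D i a) _).symm

variable (N) in
/-- The `A`-components of vector fields on `Spec A × 𝔸^m` with respect to a frame of `A`. -/
def frameCoord : Derivation k (MvPolynomial (Fin m) A) N →ₗ[N] (ι → N) where
  toFun v := (polyFrameEquiv D N v).1
  map_add' v w := by rw [map_add, Prod.fst_add]
  map_smul' r v := polyFrameEquiv_fst_eq D fun a => by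
    rw [Derivation.smul_apply, apply_C_eq_sum_polyFrameEquiv D v a, Finset.smul_sum]
    exact Finset.sum_congr rfl fun i _ => smul_comm _ _ _

theorem apply_C_eq_sum_frameCoord (v : Derivation k (MvPolynomial (Fin m) A) N) (a : A) :
    v (MvPolynomial.C a) =
      ∑ i, (MvPolynomial.C (D i a) : MvPolynomial (Fin m) A) • frameCoord D N v i :=
  apply_C_eq_sum_polyFrameEquiv D v a

theorem apply_linearForm_eq_of_apply_X (v : Derivation k (MvPolynomial (Fin m) A) N)
    (hv : ∀ j, v (MvPolynomial.X j) = 0) (g : Fin (m + 1) → A) :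
    v (linearForm g) = ∑ i, algebraMap (MvPolynomial (Fin m) A) N (linearForm fun l => D i (g l)) *
      frameCoord D N v i := by
  rw [apply_linearForm_eq D]
  refine add_eq_left.2 ?_
  refine Finset.sum_eq_zero fun j _ => ?_
  rw [← apply_X_eq_polyFrameEquiv, hv, mul_zero]

theorem exists_frameCoord_eq (c : ι → N) : ∃ v : Derivation k (MvPolynomial (Fin m) A) N,
    frameCoord D N v = c ∧ ∀ j, v (MvPolynomial.X j) = 0 := by
  refine ⟨(polyFrameEquiv D N).symm (c, 0), ?_, fun j => ?_⟩
  · change (polyFrameEquiv D N ((polyFrameEquiv D N).symm (c, 0))).1 = c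
    rw [LinearEquiv.apply_symm_apply]
  · rw [apply_X_eq_polyFrameEquiv D, LinearEquiv.apply_symm_apply]
    rfl

theorem eq_of_frameCoord_eq {v w : Derivation k (MvPolynomial (Fin m) A) N}
    (h : frameCoord D N v = frameCoord D N w) (hv : ∀ j, v (MvPolynomial.X j) = 0)
    (hw : ∀ j, w (MvPolynomial.X j) = 0) : v = w := by
  refine (polyFrameEquiv D N).injective (Prod.ext h (funext fun j => ?_))
  rw [← apply_X_eq_polyFrameEquiv, ← apply_X_eq_polyFrameEquiv, hv, hw]

end FrameCoord

section Kernel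

variable {k : Type*} [Field k] {A : Type*} [CommRing A] [Algebra k A]
  [Algebra.FormallySmooth k A] [Algebra.FiniteType k A] {m : ℕ} {φ : Fin (m + 1) → A}
  {N : Type*} [CommRing N] [Algebra k N]
  [Algebra A N] [Algebra (MvPolynomial (Fin m) A) N] [IsScalarTower k A N]
  [IsScalarTower A (MvPolynomial (Fin m) A) N] [IsScalarTower k (MvPolynomial (Fin m) A) N]

/-- For a field without `y`-components, the derivative of `Φ` is a combination of the `∂_iΦ` and
vanishes for free, while the derivatives of the `∂_rΦ` are, by symmetry, the Hessian applied to its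
coordinates. -/
theorem mem_tangentSpace_jacobianIdeal_iff {ι : Type*} [Fintype ι]
    (D : Module.Basis ι A (Derivation k A A))
    (hN : ∀ s ∈ jacobianIdeal φ D, algebraMap (MvPolynomial (Fin m) A) N s = 0)
    {v : Derivation k (MvPolynomial (Fin m) A) N} (hv : ∀ j, v (MvPolynomial.X j) = 0) :
    v ∈ tangentSpace k (jacobianIdeal φ D) N ↔
      ((hessian φ D).map (algebraMap (MvPolynomial (Fin m) A) N)).mulVec (frameCoord D N v) = 0 := by
  have hsymm := hessian_map_isSymm D hN
  have h : ∀ r, v (linearForm fun l => D r (φ l)) =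
      ((hessian φ D).map (algebraMap (MvPolynomial (Fin m) A) N)).mulVec (frameCoord D N v) r := by
    intro r
    rw [apply_linearForm_eq_of_apply_X D v hv]
    refine Finset.sum_congr rfl fun i _ => ?_
    exact congrArg (· * _) (hsymm.apply r i)
  constructor
  · intro hT
    ext r
    rw [← h]
    exact hT _ (linearForm_derivation_mem_jacobianIdeal _ _)
  · intro h0 s hs
    refine derivation_eq_zero_of_mem_span v ?_ ?_ hs
    · exact fun s hs => hN s (Ideal.subset_span hs)
    · rintro s (rfl | ⟨i, rfl⟩)
      · rw [apply_linearForm_eq_of_apply_X D v hv]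
        exact Finset.sum_eq_zero fun i _ => by
          rw [hN _ (linearForm_derivation_mem_jacobianIdeal _ i), zero_mul]
      · exact (h i).trans (congrFun h0 i)

variable {κ : Type*} [Fintype κ] [DecidableEq κ]
  {D : Module.Basis (κ ⊕ Fin 2) A (Derivation k A A)} {δ : A}

/-- On the open set where a block of size `n - 2` of the Hessian is invertible, the kernel of the
projection of the degeneracy scheme to the parameter space is free of rank two. -/
theorem existsUnique_kernel_derivation
    (hred : ∀ f : MvPolynomial (Fin m) A, f ^ 2 ∈ jacobianIdeal φ D →
      ∃ e : ℕ, MvPolynomial.C δ ^ e * f ∈ jacobianIdeal φ D)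
    (ht : IsUnit (algebraMap (MvPolynomial (Fin m) A) N (MvPolynomial.C δ)))
    (hN : ∀ s ∈ rootIdeal φ D, algebraMap (MvPolynomial (Fin m) A) N s = 0)
    (hd : IsUnit ((hessian φ D).map (algebraMap (MvPolynomial (Fin m) A) N)).toBlocks₁₁.det)
    (h2 : (2 : A) = 0) (x : Fin 2 → N) :
    ∃! v : Derivation k (MvPolynomial (Fin m) A) N, v ∈ tangentSpace k (rootIdeal φ D) N ∧
      (∀ j, v (MvPolynomial.X j) = 0) ∧ ∀ a, frameCoord D N v (Sum.inr a) = x a := by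
  obtain ⟨f, hf, -⟩ := exists_hessian_root (φ := φ) D h2
  have hJ : ∀ s ∈ jacobianIdeal φ D, algebraMap (MvPolynomial (Fin m) A) N s = 0 := fun s hs =>
    hN s (jacobianIdeal_le_rootIdeal hs)
  obtain ⟨hu, hvf⟩ := border_relation (k := k) hred ht hJ hd hf (hN _ (mem_rootIdeal hf)) h2
  have hsymm := hessian_map_isSymm D hJ
  have hdiag := hessian_map_self D hJ h2
  have h2N : (2 : N) = 0 := by
    rw [← map_ofNat (algebraMap A N), h2, map_zero]
  -- Tangency to the degeneracy scheme adds no condition to the tangency to the critical scheme,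
  -- because the border form has zero derivative along the kernel of the Hessian.
  have hT : ∀ v : Derivation k (MvPolynomial (Fin m) A) N, (∀ j, v (MvPolynomial.X j) = 0) →
      (v ∈ tangentSpace k (rootIdeal φ D) N ↔
        ((hessian φ D).map (algebraMap (MvPolynomial (Fin m) A) N)).mulVec
          (frameCoord D N v) = 0) := by
    intro v hv
    rw [mem_tangentSpace_rootIdeal hf h2 hred ht hN, mem_tangentSpace_jacobianIdeal_iff D hJ hv]
    refine and_iff_left_of_imp fun hH => ?_
    exact (hvf v ((mem_tangentSpace_jacobianIdeal_iff D hJ hv).2 hH)).2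
      (derivation_borderForm_eq_zero D h2 hJ hd hu v (apply_C_eq_sum_frameCoord D v) hv hH)
  set H := (hessian φ D).map (algebraMap (MvPolynomial (Fin m) A) N) with hH
  obtain ⟨d', hd'⟩ := hd
  have hb : ∀ a b, borderVec H a (Sum.inr b) = if b = a then H.toBlocks₁₁.det else 0 :=
    fun _ _ => rfl
  have hdd : (↑d'⁻¹ : N) * H.toBlocks₁₁.det = 1 := by rw [← hd', Units.inv_mul]
  -- The last two coordinates of the border vectors are `det α` or `0`; division by `det α` makes
  -- those of this combination equal to `x`.
  obtain ⟨v, hvc, hvX⟩ := exists_frameCoord_eq (m := m) D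
    ((↑d'⁻¹ : N) • (x 0 • borderVec H 0 + x 1 • borderVec H 1))
  have hdu : IsUnit H.toBlocks₁₁.det := ⟨d', hd'⟩
  refine ⟨v, ⟨(hT v hvX).2 ?_, hvX, fun a => ?_⟩, fun w ⟨hwT, hwX, hwx⟩ => ?_⟩
  · rw [hvc, Matrix.mulVec_smul, Matrix.mulVec_add, Matrix.mulVec_smul, Matrix.mulVec_smul,
      mulVec_borderVec_eq_zero h2N hsymm hdiag hdu hu,
      mulVec_borderVec_eq_zero h2N hsymm hdiag hdu hu]
    simp
  · rw [hvc]
    fin_cases a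
    · simp [hb, mul_left_comm _ (x 0), hdd]
    · simp [hb, mul_left_comm _ (x 1), hdd]
  · refine eq_of_frameCoord_eq D ?_ hwX hvX
    have := det_smul_eq_of_mulVec_eq_zero h2N hdu ((hT w hwX).1 hwT)
    rw [hvc, ← hwx, ← hwx, ← this, smul_smul, hdd, one_smul]

/-- A constant change of frame multiplies the determinant by the square of a nonzero constant `r`;
multiplication by `r` carries roots to roots. -/
theorem rootIdeal_eq {ι ι' : Type*} [Fintype ι] [DecidableEq ι] [Fintype ι'] [DecidableEq ι']
    {D : Module.Basis ι A (Derivation k A A)} {D' : Module.Basis ι' A (Derivation k A A)}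
    {b : Module.Basis ι' k (ι → k)} (hb : ∀ i, D' i = ∑ j, algebraMap k A (b i j) • D j) :
    rootIdeal φ D = rootIdeal φ D' := by
  obtain ⟨r, hr, hdet⟩ := exists_det_hessian_basis_change (φ := φ) hb
  have hrr : algebraMap k (MvPolynomial (Fin m) A) r⁻¹ * algebraMap k (MvPolynomial (Fin m) A) r =
      1 := by rw [← map_mul, inv_mul_cancel₀ hr, map_one]
  rw [rootIdeal, rootIdeal, ← jacobianIdeal_eq D D', hdet]
  refine le_antisymm (sup_le le_sup_left ?_) (sup_le le_sup_left ?_) <;> refine Ideal.span_le.2 ?_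
  · intro f hf
    have h : algebraMap k (MvPolynomial (Fin m) A) r * f ∈
        {f | f ^ 2 - algebraMap k (MvPolynomial (Fin m) A) r ^ 2 * (hessian φ D).det ∈
          jacobianIdeal φ D} := by
      rw [Set.mem_ofPred_eq, mul_pow, ← mul_sub]
      exact Ideal.mul_mem_left _ _ hf
    have := Ideal.mul_mem_left _ (algebraMap k (MvPolynomial (Fin m) A) r⁻¹)
      (Ideal.mem_sup_right (S := jacobianIdeal φ D) (Ideal.subset_span h))
    rwa [← mul_assoc, hrr, one_mul] at this
  · intro f hf
    refine Ideal.mem_sup_right ?_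
    have h : algebraMap k (MvPolynomial (Fin m) A) r⁻¹ * f ∈
        {f | f ^ 2 - (hessian φ D).det ∈ jacobianIdeal φ D} := by
      have := (jacobianIdeal φ D).mul_mem_left
        (algebraMap k (MvPolynomial (Fin m) A) r⁻¹ ^ 2) hf
      rwa [mul_sub, ← mul_assoc, ← mul_pow, ← mul_pow, hrr, one_pow, one_mul] at this
    have := Ideal.mul_mem_left _ (algebraMap k (MvPolynomial (Fin m) A) r) (Ideal.subset_span h)
    rwa [← mul_assoc, mul_comm (algebraMap k _ r), hrr, one_mul] at this

end Kernel

/-! ### The kernel of the projection on the tangent space at a point -/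

section KernelBundle

variable {k : Type*} [Field k] {A : Type*} [CommRing A] [Algebra k A]
  [Algebra.FormallySmooth k A] [Algebra.FiniteType k A] {m : ℕ} {φ : Fin (m + 1) → A}
  {κ : Type*} [Fintype κ] [DecidableEq κ]
  {D : Module.Basis (κ ⊕ Fin 2) A (Derivation k A A)} {δ : A}
  {I : Ideal (MvPolynomial (Fin m) A)} (hI : I = rootIdeal φ D)
  (hred : ∀ f : MvPolynomial (Fin m) A, f ^ 2 ∈ jacobianIdeal φ D →
      ∃ e : ℕ, MvPolynomial.C δ ^ e * f ∈ jacobianIdeal φ D) (h2 : (2 : A) = 0)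

include hI hred h2

theorem finrank_ker_differential (N : Type*) [CommRing N] [Nontrivial N] [Algebra k N] [Algebra A N]
    [Algebra (MvPolynomial (Fin m) A) N] [Algebra (MvPolynomial (Fin m) A ⧸ I) N]
    [IsScalarTower k A N] [IsScalarTower A (MvPolynomial (Fin m) A) N]
    [IsScalarTower k (MvPolynomial (Fin m) A) N]
    [IsScalarTower (MvPolynomial (Fin m) A) (MvPolynomial (Fin m) A ⧸ I) N]
    [IsScalarTower k (MvPolynomial (Fin m) A ⧸ I) N]
    (hk : Function.Bijective (algebraMap k N))
    (ht : IsUnit (algebraMap (MvPolynomial (Fin m) A) N (MvPolynomial.C δ)))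
    (hd : IsUnit ((hessian φ D).map (algebraMap (MvPolynomial (Fin m) A) N)).toBlocks₁₁.det) :
    Module.finrank k (LinearMap.ker (differential (k := k)
      (fun j => Ideal.Quotient.mk I (MvPolynomial.X j : MvPolynomial (Fin m) A)) N)) = 2 := by
  have hN : ∀ s ∈ I, algebraMap (MvPolynomial (Fin m) A) N s = 0 := fun s hs => by
    rw [IsScalarTower.algebraMap_apply _ (MvPolynomial (Fin m) A ⧸ I) N]
    exact (congrArg _ (Ideal.Quotient.eq_zero_iff_mem.2 hs)).trans (map_zero _)
  have hex := existsUnique_kernel_derivation (N := N) hred ht (hI ▸ hN) hd h2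
  rw [← hI] at hex
  let L : LinearMap.ker (differential (k := k)
      (fun j => Ideal.Quotient.mk I (MvPolynomial.X j : MvPolynomial (Fin m) A)) N) →ₗ[k]
        (Fin 2 → N) :=
    { toFun := fun v a => frameCoord D N (derivationQuotientEquiv k I N v.1).1 (Sum.inr a)
      map_add' := fun v w => by
        ext a
        simp
      map_smul' := fun r v => by
        ext a
        simp only [SetLike.val_smul_of_tower, map_smul]
        rw [← algebraMap_smul N r (derivationQuotientEquiv k I N v.1).1, map_smul, Pi.smul_apply,
          algebraMap_smul]
        rfl }
  have hL : Function.Bijective L := by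
    constructor
    · intro v w h
      obtain ⟨u, -, huniq⟩ := hex (L v)
      have hv := huniq (derivationQuotientEquiv k I N v.1).1
        ⟨(derivationQuotientEquiv k I N v.1).2, fun j => congrFun v.2 j, fun a => rfl⟩
      have hw := huniq (derivationQuotientEquiv k I N w.1).1
        ⟨(derivationQuotientEquiv k I N w.1).2, fun j => congrFun w.2 j, fun a =>
          (congrFun h a).symm⟩
      exact Subtype.ext ((derivationQuotientEquiv k I N).injective
        (Subtype.ext (hv.trans hw.symm)))
    · intro x
      obtain ⟨u, ⟨huT, huX, hux⟩, -⟩ := hex x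
      obtain ⟨v, hv⟩ := (derivationQuotientEquiv k I N).surjective ⟨u, huT⟩
      have hv' : ∀ s, v (Ideal.Quotient.mk I s) = u s := fun s => by
        rw [← derivationQuotientEquiv_apply, hv]
      refine ⟨⟨v, ?_⟩, ?_⟩
      · rw [LinearMap.mem_ker]
        ext j
        exact (hv' _).trans (huX j)
      · ext a
        change frameCoord D N (derivationQuotientEquiv k I N v).1 (Sum.inr a) = _
        rw [hv]
        exact hux a
  rw [(LinearEquiv.ofBijective L hL).finrank_eq,
    ← (LinearEquiv.piCongrRight fun _ : Fin 2 =>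
      LinearEquiv.ofBijective (Algebra.linearMap k N) hk).finrank_eq]
  simp

end KernelBundle

end DualVariety
end

noncomputable section
namespace DualVariety

set_option linter.unusedSectionVars false

/-! ### The kernel of the projection as a subbundle of the tangent bundle -/

section KernelBundle

theorem isCompl_ker_of_bijective {R M P : Type*} [Ring R] [AddCommGroup M] [AddCommGroup P]
    [Module R M] [Module R P] {Z : Submodule R M} {L : M →ₗ[R] P}
    (hL : Function.Bijective (L.comp Z.subtype)) : IsCompl Z (LinearMap.ker L) := by
  constructor
  · rw [disjoint_iff, eq_bot_iff]
    rintro v ⟨hvZ, hvL⟩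
    have : (⟨v, hvZ⟩ : Z) = 0 := hL.1 ((LinearMap.mem_ker.1 hvL).trans (map_zero _).symm)
    exact congrArg Subtype.val this
  · rw [codisjoint_iff, eq_top_iff]
    intro v _
    obtain ⟨z, hz⟩ := hL.2 (L v)
    rw [← add_sub_cancel z.1 v]
    refine Submodule.add_mem_sup z.2 ?_
    rw [LinearMap.mem_ker, map_sub, sub_eq_zero]
    exact hz.symm

theorem isStandardSmoothOfRelativeDimension_away_mul {k B : Type*} [CommRing k] [CommRing B]
    [Algebra k B] {d : ℕ} {g : B} (h : B)
    [Algebra.IsStandardSmoothOfRelativeDimension d k (Localization.Away g)] :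
    Algebra.IsStandardSmoothOfRelativeDimension d k (Localization.Away (g * h)) := by
  let T := Localization.Away (algebraMap B (Localization.Away g) h)
  have : IsLocalization.Away (g * h) T := IsLocalization.Away.mul' (Localization.Away g) T g h
  have : Algebra.IsStandardSmoothOfRelativeDimension 0 (Localization.Away g) T :=
    Algebra.IsStandardSmoothOfRelativeDimension.localization_away
      (algebraMap B (Localization.Away g) h)
  have hT : Algebra.IsStandardSmoothOfRelativeDimension (0 + d) k T :=
    Algebra.IsStandardSmoothOfRelativeDimension.trans d 0 k (Localization.Away g) T
  rw [zero_add] at hT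
  exact Algebra.IsStandardSmoothOfRelativeDimension.of_algEquiv d
    ((IsLocalization.algEquiv (Submonoid.powers (g * h)) T
      (Localization.Away (g * h))).restrictScalars k)

variable {k : Type*} [Field k] {A : Type*} [CommRing A] [Algebra k A]
  [Algebra.FormallySmooth k A] [Algebra.FiniteType k A] {m : ℕ} {φ : Fin (m + 1) → A}
  {κ : Type*} [Fintype κ] [DecidableEq κ]
  {D : Module.Basis (κ ⊕ Fin 2) A (Derivation k A A)} {δ : A}
  {I : Ideal (MvPolynomial (Fin m) A)} (hI : I = rootIdeal φ D)
  (hred : ∀ f : MvPolynomial (Fin m) A, f ^ 2 ∈ jacobianIdeal φ D →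
      ∃ e : ℕ, MvPolynomial.C δ ^ e * f ∈ jacobianIdeal φ D) (h2 : (2 : A) = 0)

include hI hred h2

theorem kernelIsSubbundleNear {q : Ideal (MvPolynomial (Fin m) A ⧸ I)} [q.IsPrime] {d : ℕ}
    (hsm : IsSmoothOfDimAt k q d) (hδ : Ideal.Quotient.mk I (MvPolynomial.C δ) ∉ q)
    (hd : Ideal.Quotient.mk I (hessian φ D).toBlocks₁₁.det ∉ q) :
    KernelIsSubbundleNear k
      (fun j => Ideal.Quotient.mk I (MvPolynomial.X j : MvPolynomial (Fin m) A)) q d 2 := by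
  obtain ⟨g₀, hg₀, hstd⟩ := hsm
  -- The neighbourhood is where `ℛ` is smooth (`g₀`), where reducedness of `𝒞` is available (`δ`),
  -- and where the block of the Hessian is invertible.
  set h := Ideal.Quotient.mk I (MvPolynomial.C δ) *
    Ideal.Quotient.mk I (hessian φ D).toBlocks₁₁.det with hh
  have hg : g₀ * h ∉ q := fun hmem => by
    rcases Ideal.IsPrime.mem_or_mem ‹_› hmem with h' | h'
    · exact hg₀ h'
    · rcases Ideal.IsPrime.mem_or_mem ‹_› h' with h' | h'
      · exact hδ h'
      · exact hd h'
  have hstd' := isStandardSmoothOfRelativeDimension_away_mul (k := k) (d := d) (g := g₀) h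
  obtain ⟨g, hgdef⟩ : ∃ g, g = g₀ * h := ⟨_, rfl⟩
  rw [← hgdef] at hg hstd'
  let N := Localization.Away g
  have hunit : IsUnit (algebraMap (MvPolynomial (Fin m) A ⧸ I) N g) :=
    IsLocalization.Away.algebraMap_isUnit g
  replace hunit : IsUnit (algebraMap (MvPolynomial (Fin m) A ⧸ I) N (g₀ * h)) := by
    rw [← hgdef]
    exact hunit
  rw [hh, map_mul, map_mul, IsUnit.mul_iff, IsUnit.mul_iff] at hunit
  have hN : ∀ s ∈ I, algebraMap (MvPolynomial (Fin m) A) N s = 0 := fun s hs => by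
    rw [IsScalarTower.algebraMap_apply _ (MvPolynomial (Fin m) A ⧸ I) N]
    exact (congrArg _ (Ideal.Quotient.eq_zero_iff_mem.2 hs)).trans (map_zero _)
  have hd' : IsUnit ((hessian φ D).map (algebraMap (MvPolynomial (Fin m) A) N)).toBlocks₁₁.det := by
    have := hunit.2.2
    change IsUnit (algebraMap (MvPolynomial (Fin m) A) N (hessian φ D).toBlocks₁₁.det) at this
    rw [RingHom.map_det] at this
    exact this
  have hex := existsUnique_kernel_derivation (N := N) hred hunit.2.1 (hI ▸ hN) hd' h2
  rw [← hI] at hex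
  set Z := LinearMap.ker (differential (k := k) (fun j => algebraMap _ N
      (Ideal.Quotient.mk I (MvPolynomial.X j : MvPolynomial (Fin m) A))) N) with hZ
  -- The last two frame coordinates make sense for all vector fields and restrict to an isomorphism
  -- on the kernel of the projection. So `L` provides both a basis of that kernel and, by its own
  -- kernel, a complement.
  let L : Derivation k N N →ₗ[N] (Fin 2 → N) :=
    { toFun := fun v a => frameCoord D N (v.compAlgebraMap (MvPolynomial (Fin m) A)) (Sum.inr a)
      map_add' := fun v w => by
        ext a
        have : (v + w).compAlgebraMap (MvPolynomial (Fin m) A) =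
          v.compAlgebraMap (MvPolynomial (Fin m) A) +
            w.compAlgebraMap (MvPolynomial (Fin m) A) := rfl
        rw [this, map_add]
        rfl
      map_smul' := fun r v => by
        ext a
        have : (r • v).compAlgebraMap (MvPolynomial (Fin m) A) =
          r • v.compAlgebraMap (MvPolynomial (Fin m) A) := rfl
        rw [this, map_smul]
        rfl }
  have hT : ∀ v : Derivation k N N,
      v.compAlgebraMap (MvPolynomial (Fin m) A) ∈ tangentSpace k I N := fun v s hs => by
    change v (algebraMap (MvPolynomial (Fin m) A) N s) = 0
    rw [hN s hs, map_zero]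
  have hL : Function.Bijective (L.comp Z.subtype) := by
    constructor
    · intro v w hvw
      obtain ⟨u, -, huniq⟩ := hex (L v)
      have hv := huniq (v.1.compAlgebraMap (MvPolynomial (Fin m) A))
        ⟨hT v.1, fun j => congrFun v.2 j, fun a => rfl⟩
      have hw := huniq (w.1.compAlgebraMap (MvPolynomial (Fin m) A))
        ⟨hT w.1, fun j => congrFun w.2 j, fun a => (congrFun hvw a).symm⟩
      refine Subtype.ext (derivation_ext_of_isLocalization (Submonoid.powers g) N fun b => ?_)
      obtain ⟨s, rfl⟩ := Ideal.Quotient.mk_surjective b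
      exact congr($(hv.trans hw.symm) s)
    · intro x
      obtain ⟨u, ⟨huT, huX, hux⟩, -⟩ := hex x
      obtain ⟨v, hv⟩ := (derivationQuotientEquiv k I N).surjective ⟨u, huT⟩
      obtain ⟨w, hw⟩ := exists_derivation_of_isLocalization (Submonoid.powers g) N v
      have hwu : w.compAlgebraMap (MvPolynomial (Fin m) A) = u := Derivation.ext fun s => by
        have : v (Ideal.Quotient.mk I s) = u s := by rw [← derivationQuotientEquiv_apply, hv]
        rw [← this, ← hw]
        rfl
      refine ⟨⟨w, ?_⟩, ?_⟩
      · rw [hZ, LinearMap.mem_ker]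
        ext j
        exact (congr($hwu (MvPolynomial.X j))).trans (huX j)
      · ext a
        change frameCoord D N (w.compAlgebraMap (MvPolynomial (Fin m) A)) (Sum.inr a) = _
        rw [hwu]
        exact hux a
  refine ⟨g, hg, hstd',
    ⟨Module.Basis.ofEquivFun (LinearEquiv.ofBijective _ hL)⟩, LinearMap.ker L, isCompl_ker_of_bijective hL⟩

end KernelBundle

end DualVariety
end

noncomputable section
namespace DualVariety

set_option linter.unusedSectionVars false

/-! ## Derivatives of functions with a given power series expansion -/

section Expansion

variable {k : Type*} [Field k] {O : Type*} [CommRing O] [IsLocalRing O] [Algebra k O] {n : ℕ}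

/-- A derivation lowers the order of vanishing by at most one. Hence derivatives of order `e` at the
point can be computed on the truncation of the expansion modulo the power `e + 1` of the maximal
ideal. -/
theorem derivation_mem_pow (d : Derivation k O O) {e : ℕ} {x : O}
    (hx : x ∈ IsLocalRing.maximalIdeal O ^ (e + 1)) : d x ∈ IsLocalRing.maximalIdeal O ^ e := by
  induction e generalizing x with
  | zero => simp
  | succ e ih =>
    rw [pow_succ] at hx
    refine Submodule.mul_induction_on hx (fun a ha b hb => ?_) fun a b ha hb => by
      rw [map_add]
      exact Ideal.add_mem _ ha hb
    rw [Derivation.leibniz, smul_eq_mul, smul_eq_mul]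
    refine Ideal.add_mem _ (Ideal.mul_mem_right _ _ ha) ?_
    rw [pow_succ']
    exact Ideal.mul_mem_mul hb (ih ha)

omit [IsLocalRing O] in
theorem derivation_aeval (d : Derivation k O O) (x : Fin n → O) (q : MvPolynomial (Fin n) k) :
    d (MvPolynomial.aeval x q) =
      ∑ a, MvPolynomial.aeval x (MvPolynomial.pderiv a q) * d (x a) := by
  induction q using MvPolynomial.induction_on with
  | C r => simp [MvPolynomial.algHom_C]
  | add p q hp hq => simp only [map_add, hp, hq, add_mul, Finset.sum_add_distrib]
  | mul_X p j hp =>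
    rw [map_mul, Derivation.leibniz, hp]
    simp only [Derivation.leibniz, MvPolynomial.aeval_X, MvPolynomial.pderiv_X, smul_eq_mul,
      map_add, map_mul, add_mul, Finset.sum_add_distrib, Finset.mul_sum]
    congr 1
    · rw [Finset.sum_eq_single j]
      · simp
      · intro a _ ha
        simp [Pi.single_eq_of_ne' ha]
      · simp
    · exact Finset.sum_congr rfl fun a _ => by ring

/-- The third partial derivatives of a power series at the origin. -/
def thirdAtOrigin (ψ : MvPowerSeries (Fin n) k) (c b a : Fin n) : k :=
  MvPowerSeries.coeff (Finsupp.single c 1 + Finsupp.single b 1 + Finsupp.single a 1) ψ *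
    (((Finsupp.single c 1 + Finsupp.single b 1 : Fin n →₀ ℕ) a : ℕ) + 1) *
      ((Finsupp.single c 1 b : ℕ) + 1)

section Coeff

variable (ψ : MvPowerSeries (Fin n) k) {e : ℕ}

theorem coeff_pderiv_truncTotal (he : 2 ≤ e) (a : Fin n) :
    MvPolynomial.coeff 0 (MvPolynomial.pderiv a (MvPowerSeries.truncTotal e ψ)) =
      MvPowerSeries.coeff (Finsupp.single a 1) ψ := by
  rw [MvPolynomial.coeff_pderiv, zero_add, MvPowerSeries.coeff_truncTotal]
  · simp
  · rw [Finsupp.degree_single]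
    omega

theorem coeff_pderiv_pderiv_truncTotal (he : 3 ≤ e) (a b : Fin n) :
    MvPolynomial.coeff 0 (MvPolynomial.pderiv b (MvPolynomial.pderiv a
      (MvPowerSeries.truncTotal e ψ))) = hessianAtOrigin ψ b a := by
  rw [MvPolynomial.coeff_pderiv, zero_add, MvPolynomial.coeff_pderiv,
    MvPowerSeries.coeff_truncTotal, hessianAtOrigin, Matrix.of_apply, Finsupp.single_apply]
  · split_ifs
    · simp
      ring
    · simp
  · rw [map_add, Finsupp.degree_single, Finsupp.degree_single]
    omega

theorem coeff_pderiv_pderiv_pderiv_truncTotal (he : 4 ≤ e) (a b c : Fin n) :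
    MvPolynomial.coeff 0 (MvPolynomial.pderiv c (MvPolynomial.pderiv b (MvPolynomial.pderiv a
      (MvPowerSeries.truncTotal e ψ)))) = thirdAtOrigin ψ c b a := by
  rw [MvPolynomial.coeff_pderiv, zero_add, MvPolynomial.coeff_pderiv, MvPolynomial.coeff_pderiv,
    MvPowerSeries.coeff_truncTotal, thirdAtOrigin]
  · simp
  · rw [map_add, map_add, Finsupp.degree_single, Finsupp.degree_single, Finsupp.degree_single]
    omega

end Coeff

variable {K : Type*} [Field K] [Algebra k K] [Algebra O K] [IsScalarTower k O K]
  (hε : ∀ x ∈ IsLocalRing.maximalIdeal O, algebraMap O K x = 0)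
  {x : Fin n → O} (hx : ∀ a, x a ∈ IsLocalRing.maximalIdeal O)
include hε

theorem map_aeval_of_mem_maximalIdeal (hx : ∀ a, x a ∈ IsLocalRing.maximalIdeal O)
    (q : MvPolynomial (Fin n) k) :
    algebraMap O K (MvPolynomial.aeval x q) = algebraMap k K (MvPolynomial.coeff 0 q) := by
  induction q using MvPolynomial.induction_on with
  | C r => simp [MvPolynomial.algHom_C, ← IsScalarTower.algebraMap_apply]
  | add p q hp hq => simp only [map_add, hp, hq, MvPolynomial.coeff_add]
  | mul_X p j hp =>
    rw [map_mul, map_mul, MvPolynomial.aeval_X, hε _ (hx j), mul_zero, MvPolynomial.coeff_mul_X',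
      if_neg (by simp), map_zero]

variable {ψ : MvPowerSeries (Fin n) k} {h : O}

theorem map_eq_zero_of_mem_pow {e : ℕ} {y : O} (he : e ≠ 0)
    (hy : y ∈ IsLocalRing.maximalIdeal O ^ e) : algebraMap O K y = 0 :=
  hε _ (Ideal.pow_le_self he hy)

include hx

theorem map_derivation_expansion (hψ : IsExpansion x h ψ) (d : Derivation k O O) :
    algebraMap O K (d h) =
      ∑ a, algebraMap k K (MvPowerSeries.coeff (Finsupp.single a 1) ψ) *
        algebraMap O K (d (x a)) := by
  have h0 := derivation_mem_pow d (hψ 2)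
  have h1 := map_eq_zero_of_mem_pow hε one_ne_zero h0
  rw [map_sub, map_sub, sub_eq_zero, derivation_aeval, map_sum] at h1
  rw [h1]
  refine Finset.sum_congr rfl fun a _ => ?_
  rw [map_mul, map_aeval_of_mem_maximalIdeal hε hx, coeff_pderiv_truncTotal _ le_rfl]

theorem map_derivation_derivation_expansion (hψ : IsExpansion x h ψ)
    (hψ1 : ∀ a, MvPowerSeries.coeff (Finsupp.single a 1) ψ = 0) (d d' : Derivation k O O) :
    algebraMap O K (d (d' h)) =
      ∑ a, ∑ b, algebraMap k K (hessianAtOrigin ψ b a) *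
        (algebraMap O K (d (x b)) * algebraMap O K (d' (x a))) := by
  have h0 := derivation_mem_pow d (derivation_mem_pow d' (hψ 3))
  have h1 := map_eq_zero_of_mem_pow hε one_ne_zero h0
  rw [map_sub, map_sub, map_sub, sub_eq_zero] at h1
  rw [h1, derivation_aeval, map_sum, map_sum]
  refine Finset.sum_congr rfl fun a _ => ?_
  rw [Derivation.leibniz, map_add, smul_eq_mul, smul_eq_mul, map_mul, map_mul,
    map_aeval_of_mem_maximalIdeal hε hx, coeff_pderiv_truncTotal _ (by norm_num), hψ1, map_zero,
    zero_mul, zero_add, derivation_aeval, map_sum, Finset.mul_sum]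
  refine Finset.sum_congr rfl fun b _ => ?_
  rw [map_mul, map_aeval_of_mem_maximalIdeal hε hx, coeff_pderiv_pderiv_truncTotal _ le_rfl]
  ring

/-- The chain rule of third order; terms with a first partial derivative of `ψ` drop out since `ψ`
has no linear part. The terms with the Hessian remain because the derivations need not be coordinate
fields: second derivatives of the parameters can be nonzero. -/
theorem map_derivation_derivation_derivation_expansion (hψ : IsExpansion x h ψ)
    (hψ1 : ∀ a, MvPowerSeries.coeff (Finsupp.single a 1) ψ = 0) (d d' d'' : Derivation k O O) :
    algebraMap O K (d (d' (d'' h))) =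
      ∑ a, ∑ b, ((∑ c, algebraMap k K (thirdAtOrigin ψ c b a) * algebraMap O K (d (x c))) *
          (algebraMap O K (d' (x b)) * algebraMap O K (d'' (x a))) +
        algebraMap k K (hessianAtOrigin ψ b a) *
          (algebraMap O K (d (d' (x b))) * algebraMap O K (d'' (x a)) +
          algebraMap O K (d' (x b)) * algebraMap O K (d (d'' (x a))) +
          algebraMap O K (d (x b)) * algebraMap O K (d' (d'' (x a))))) := by
  have h0 := derivation_mem_pow d (derivation_mem_pow d' (derivation_mem_pow d'' (hψ 4)))
  have h1 := map_eq_zero_of_mem_pow hε one_ne_zero h0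
  rw [map_sub, map_sub, map_sub, map_sub, sub_eq_zero] at h1
  have hlin : ∀ a, algebraMap O K (MvPolynomial.aeval x (MvPolynomial.pderiv a
      (MvPowerSeries.truncTotal 4 ψ))) = 0 := fun a => by
    rw [map_aeval_of_mem_maximalIdeal hε hx, coeff_pderiv_truncTotal _ (by norm_num), hψ1, map_zero]
  have hquad : ∀ a b, algebraMap O K (MvPolynomial.aeval x (MvPolynomial.pderiv b
      (MvPolynomial.pderiv a (MvPowerSeries.truncTotal 4 ψ)))) =
        algebraMap k K (hessianAtOrigin ψ b a) := fun a b => by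
    rw [map_aeval_of_mem_maximalIdeal hε hx, coeff_pderiv_pderiv_truncTotal _ (by norm_num)]
  have hcub : ∀ a b c, algebraMap O K (MvPolynomial.aeval x (MvPolynomial.pderiv c
      (MvPolynomial.pderiv b (MvPolynomial.pderiv a (MvPowerSeries.truncTotal 4 ψ))))) =
        algebraMap k K (thirdAtOrigin ψ c b a) := fun a b c => by
    rw [map_aeval_of_mem_maximalIdeal hε hx, coeff_pderiv_pderiv_pderiv_truncTotal _ le_rfl]
  have hd1 : ∀ (d : Derivation k O O) a, algebraMap O K (d (MvPolynomial.aeval x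
      (MvPolynomial.pderiv a (MvPowerSeries.truncTotal 4 ψ)))) =
        ∑ b, algebraMap k K (hessianAtOrigin ψ b a) * algebraMap O K (d (x b)) := fun d a => by
    rw [derivation_aeval, map_sum]
    exact Finset.sum_congr rfl fun b _ => by rw [map_mul, hquad]
  have hd2 : ∀ a, algebraMap O K (d (d' (MvPolynomial.aeval x
      (MvPolynomial.pderiv a (MvPowerSeries.truncTotal 4 ψ))))) =
        ∑ b, ((∑ c, algebraMap k K (thirdAtOrigin ψ c b a) * algebraMap O K (d (x c))) *
          algebraMap O K (d' (x b)) + algebraMap k K (hessianAtOrigin ψ b a) *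
            algebraMap O K (d (d' (x b)))) := fun a => by
    rw [derivation_aeval, map_sum, map_sum]
    refine Finset.sum_congr rfl fun b _ => ?_
    rw [Derivation.leibniz, map_add, smul_eq_mul, smul_eq_mul, map_mul, map_mul, hquad,
      derivation_aeval, map_sum, add_comm, mul_comm (algebraMap O K (d' (x b)))]
    refine congrArg (· * _ + _) (Finset.sum_congr rfl fun c _ => ?_)
    rw [map_mul, hcub]
  rw [h1, derivation_aeval, map_sum, map_sum, map_sum]
  refine Finset.sum_congr rfl fun a _ => ?_
  rw [Derivation.leibniz, map_add, map_add, smul_eq_mul, smul_eq_mul, Derivation.leibniz,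
    Derivation.leibniz]
  simp only [smul_eq_mul, map_add, map_mul, hlin, hd1, hd2, zero_mul, zero_add]
  rw [Finset.mul_sum, Finset.mul_sum, Finset.sum_mul, ← Finset.sum_add_distrib,
    ← Finset.sum_add_distrib]
  refine Finset.sum_congr rfl fun b _ => ?_
  ring

end Expansion

end DualVariety
end

noncomputable section
namespace DualVariety

set_option linter.unusedSectionVars false

/-! ## Frames in a local ring -/

section LocalFrame

variable {k : Type*} [Field k] {A : Type*} [CommRing A] [Algebra k A]
  {O : Type*} [CommRing O] [Algebra k O] [Algebra A O] [IsScalarTower k A O]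

/-- Derivations of `A` extend to a localization of `A`. -/
theorem exists_derivation_extension (M : Submonoid A) [IsLocalization M O]
    (d : Derivation k A A) :
    ∃ d' : Derivation k O O, ∀ a, d' (algebraMap A O a) = algebraMap A O (d a) :=
  exists_derivation_of_isLocalization M O ((Algebra.linearMap A O).compDer d)

variable [IsLocalRing O] [Algebra.FormallySmooth k A] [Algebra.FiniteType k A] {n : ℕ}
  {D : Module.Basis (Fin n) A (Derivation k A A)} {dO : Fin n → Derivation k O O}
  (hdO : ∀ i a, dO i (algebraMap A O a) = algebraMap A O (D i a))
  {K : Type*} [Field K] [Algebra k K] [Algebra A K] [Algebra O K] [IsScalarTower k O K]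
  [IsScalarTower A O K] (hk : Function.Bijective (algebraMap k K))
  (hε : ∀ x ∈ IsLocalRing.maximalIdeal O, algebraMap O K x = 0)
  {x : Fin n → O} (hx : IsParameterSystem x)

include hx in
theorem IsParameterSystem.mem (a : Fin n) : x a ∈ IsLocalRing.maximalIdeal O := by
  rw [← hx]
  exact Ideal.subset_span ⟨a, rfl⟩

include hdO in
theorem map_derivation_derivation_eq (i j : Fin n) (a : A) :
    algebraMap A K (D i (D j a)) = algebraMap O K (dO i (dO j (algebraMap A O a))) := by
  rw [hdO, hdO, ← IsScalarTower.algebraMap_apply]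

include hdO hk hε hx

/-- A combination of the frame that kills all parameters at the point kills the maximal ideal by the
product rule, hence every function, since functions are constants modulo that ideal. The
coefficients in a frame are unique, so the combination is trivial. -/
theorem det_derivation_ne_zero :
    (Matrix.of fun i a => algebraMap O K (dO i (x a))).det ≠ 0 := by
  intro h0
  obtain ⟨l, hl0, hl⟩ := Matrix.exists_vecMul_eq_zero_iff.2 h0
  refine hl0 ?_
  let v : Derivation k O K := ∑ i, l i • (Algebra.linearMap O K).compDer (dO i)
  have hv : ∀ y, v y = ∑ i, l i * algebraMap O K (dO i y) := fun y => by
    change Derivation.coeFnAddMonoidHom v y = _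
    rw [map_sum, Finset.sum_apply]
    rfl
  have hvx : ∀ a, v (x a) = 0 := fun a => by
    rw [hv]
    exact congrFun hl a
  have hv0 : ∀ y, v y = 0 := by
    intro y
    obtain ⟨r, hr⟩ := hk.2 (algebraMap O K y)
    have hmem : y - algebraMap k O r ∈ IsLocalRing.maximalIdeal O := by
      rw [IsLocalRing.mem_maximalIdeal, mem_nonunits_iff]
      intro hu
      refine (hu.map (algebraMap O K)).ne_zero ?_
      rw [map_sub, ← IsScalarTower.algebraMap_apply, hr, sub_self]
    rw [← hx] at hmem
    have := derivation_eq_zero_of_mem_span v (by rintro _ ⟨a, rfl⟩; exact hε _ (hx.mem a))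
      (by rintro _ ⟨a, rfl⟩; exact hvx a) hmem
    rwa [map_sub, Derivation.map_algebraMap, sub_zero] at this
  refine eq_zero_of_sum_smul_eq_zero D fun a => ?_
  rw [← hv0 (algebraMap A O a), hv]
  refine Finset.sum_congr rfl fun i _ => ?_
  rw [hdO, Algebra.smul_def, IsScalarTower.algebraMap_apply A O K, mul_comm]

theorem exists_jacobian_matrix : ∃ G : Matrix (Fin n) (Fin n) k, IsUnit G.det ∧
    ∀ i a, algebraMap O K (dO i (x a)) = algebraMap k K (G i a) := by
  choose g hg using hk.2
  refine ⟨Matrix.of fun i a => g (algebraMap O K (dO i (x a))), ?_, fun i a => (hg _).symm⟩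
  refine isUnit_iff_ne_zero.2 fun h0 => det_derivation_ne_zero hdO hk hε hx ?_
  have := congrArg (algebraMap k K) h0
  rw [RingHom.map_det, map_zero] at this
  rw [← this]
  congr 1
  ext i a
  exact (hg _).symm

/-- A frame that at the given point is dual to a given parameter system. -/
theorem exists_dual_frame : ∃ (b : Module.Basis (Fin n) k (Fin n → k))
    (D' : Module.Basis (Fin n) A (Derivation k A A)) (dO' : Fin n → Derivation k O O),
    (∀ i, D' i = ∑ j, algebraMap k A (b i j) • D j) ∧
    (∀ i a, dO' i (algebraMap A O a) = algebraMap A O (D' i a)) ∧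
    ∀ i a, algebraMap O K (dO' i (x a)) = if i = a then 1 else 0 := by
  obtain ⟨G, hG, hGx⟩ := exists_jacobian_matrix hdO hk hε hx
  have hGu : IsUnit G := (Matrix.isUnit_iff_isUnit_det G).2 hG
  have hli : LinearIndependent k (G⁻¹).row :=
    Matrix.linearIndependent_rows_of_isUnit (Matrix.isUnit_nonsing_inv_iff.2 hGu)
  -- Constant coefficients, the inverse of the Jacobian matrix at the point, suffice; the new frame
  -- is dual to the parameters at this point only.
  let b := basisOfLinearIndependentOfCardEqFinrank' (G⁻¹).row hli (by simp)
  have hbG : ∀ i j, b i j = G⁻¹ i j := fun i j => by simp [b]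
  obtain ⟨D', hb⟩ := exists_basis_change b D
  let dO' : Fin n → Derivation k O O := fun i => ∑ j, algebraMap k O (b i j) • dO j
  have hdO' : ∀ i y, dO' i y = ∑ j, algebraMap k O (b i j) * dO j y := fun i y => by
    change Derivation.coeFnAddMonoidHom (dO' i) y = _
    rw [map_sum, Finset.sum_apply]
    rfl
  refine ⟨b, D', dO', hb, fun i a => ?_, fun i a => ?_⟩
  · rw [hdO', basis_change_apply hb, map_sum]
    refine Finset.sum_congr rfl fun j _ => ?_
    rw [hdO, map_mul, ← IsScalarTower.algebraMap_apply]
  · have h1 : (G⁻¹ * G) i a = if i = a then 1 else 0 := by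
      rw [Matrix.nonsing_inv_mul _ hG, Matrix.one_apply]
    rw [hdO', map_sum]
    have h2 := congrArg (algebraMap k K) h1
    rw [Matrix.mul_apply, map_sum] at h2
    rw [← map_one (algebraMap k K), ← map_zero (algebraMap k K), ← apply_ite, ← h2]
    refine Finset.sum_congr rfl fun j _ => ?_
    rw [map_mul, map_mul, hGx, hbG, ← IsScalarTower.algebraMap_apply]

variable {m : ℕ} {φ : Fin (m + 1) → A} [Algebra (MvPolynomial (Fin m) A) K]
  [IsScalarTower A (MvPolynomial (Fin m) A) K] {ψ : MvPowerSeries (Fin n) k}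

theorem coeff_single_eq_zero {h : O} (hψ : IsExpansion x h ψ)
    (hd : ∀ i, algebraMap O K (dO i h) = 0) (a : Fin n) :
    MvPowerSeries.coeff (Finsupp.single a 1) ψ = 0 := by
  obtain ⟨G, hG, hGx⟩ := exists_jacobian_matrix hdO hk hε hx
  have h0 : G.mulVec (fun a => MvPowerSeries.coeff (Finsupp.single a 1) ψ) = 0 := by
    ext i
    refine hk.1 ?_
    have := hd i
    rw [map_derivation_expansion hε hx.mem hψ] at this
    rw [Pi.zero_apply, map_zero, ← this, Matrix.mulVec, dotProduct, map_sum]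
    refine Finset.sum_congr rfl fun a _ => ?_
    rw [hGx, map_mul, mul_comm]
  have := Matrix.eq_zero_of_mulVec_eq_zero hG.ne_zero h0
  exact congrFun this a

/-- The expansion has no linear part at a critical point, so the Hessians in the frame and in the
parameters differ by congruence with the Jacobian matrix. The rank therefore does not depend on the
parameter system. -/
theorem exists_map_hessian_eq (hP : IsCriticalPoint φ D K)
    (hψ : IsExpansion x (algebraMap A O (φ 0)) ψ) :
    ∃ H₀ : Matrix (Fin n) (Fin n) k,
      H₀.map (algebraMap k K) = (hessian φ D).map (algebraMap (MvPolynomial (Fin m) A) K) ∧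
        H₀.rank = (hessianAtOrigin ψ).rank := by
  obtain ⟨G, hG, hGx⟩ := exists_jacobian_matrix hdO hk hε hx
  have hlin := coeff_single_eq_zero hdO hk hε hx hψ fun i => by
    rw [hdO, ← IsScalarTower.algebraMap_apply]
    exact hP.map_derivation_zero i
  refine ⟨G * hessianAtOrigin ψ * G.transpose, ?_, ?_⟩
  · ext i j
    rw [Matrix.map_apply, Matrix.map_apply, hessian, Matrix.of_apply, hP.map_linearForm,
      map_derivation_derivation_eq hdO,
      map_derivation_derivation_expansion hε hx.mem hψ hlin, Matrix.mul_apply, map_sum]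
    refine Finset.sum_congr rfl fun a _ => ?_
    rw [Matrix.mul_apply, map_mul, map_sum, Finset.sum_mul]
    refine Finset.sum_congr rfl fun c _ => ?_
    rw [map_mul, hGx, hGx, Matrix.transpose_apply]
    ring
  · rw [Matrix.rank_mul_eq_left_of_isUnit_det _ _ (by rwa [Matrix.det_transpose]),
      Matrix.rank_mul_eq_right_of_isUnit_det _ _ hG]

end LocalFrame

end DualVariety
end

noncomputable section
namespace DualVariety

set_option linter.unusedSectionVars false

/-! ## Smoothness in terms of power series expansions -/

section Coefficients

variable {k : Type*} [Field k] {n : ℕ}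

theorem coeff_pair_eq_squarefreeCoeff (ψ : MvPowerSeries (Fin n) k) {s t : Fin n} (hst : s ≠ t) :
    hessianAtOrigin ψ s t = squarefreeCoeff {(s : ℕ) + 1, (t : ℕ) + 1} ψ := by
  rw [hessianAtOrigin, Matrix.of_apply, if_neg hst, one_mul, squarefreeCoeff]
  congr 2
  ext i
  simp only [Finsupp.add_apply, Finsupp.single_apply, Finsupp.equivFunOnFinite_symm_apply_apply,
    Finset.mem_insert, Finset.mem_singleton, Nat.add_right_cancel_iff, Fin.ext_iff]
  have := Fin.val_ne_of_ne hst
  split_ifs <;> omega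

theorem thirdAtOrigin_eq_squarefreeCoeff (ψ : MvPowerSeries (Fin n) k) {l s t : Fin n}
    (hst : s ≠ t) (hls : l ≠ s) (hlt : l ≠ t) :
    thirdAtOrigin ψ l s t = squarefreeCoeff {(l : ℕ) + 1, (s : ℕ) + 1, (t : ℕ) + 1} ψ := by
  have h1 : (Finsupp.single l 1 + Finsupp.single s 1 : Fin n →₀ ℕ) t = 0 := by
    simp [hst, hlt]
  have h2 : (Finsupp.single l 1 : Fin n →₀ ℕ) s = 0 := by simp [hls]
  rw [thirdAtOrigin, h1, h2, squarefreeCoeff]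
  simp only [Nat.cast_zero, zero_add, mul_one]
  congr 2
  ext i
  simp only [Finsupp.add_apply, Finsupp.single_apply, Finsupp.equivFunOnFinite_symm_apply_apply,
    Finset.mem_insert, Finset.mem_singleton, Nat.add_right_cancel_iff, Fin.ext_iff]
  have h3 := Fin.val_ne_of_ne hst
  have h4 := Fin.val_ne_of_ne hls
  have h5 := Fin.val_ne_of_ne hlt
  split_ifs <;> omega

/-- Differentiating twice in the same variable yields a factor two when the third variable is
different. This is why the directions `ξ_1` and `ξ_2` give no coefficient in the criterion. -/
theorem thirdAtOrigin_eq_zero (h2 : (2 : k) = 0) (ψ : MvPowerSeries (Fin n) k) {l s t : Fin n}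
    (hst : s ≠ t) (h : l = s ∨ l = t) : thirdAtOrigin ψ l s t = 0 := by
  rw [thirdAtOrigin]
  rcases h with rfl | rfl
  · simp [one_add_one_eq_two, h2]
  · have : (Finsupp.single l 1 + Finsupp.single s 1 : Fin n →₀ ℕ) l = 1 := by
      simp [hst]
    rw [this]
    simp [one_add_one_eq_two, h2]

theorem standardAlt_mulVec_injective {r : ℕ} (hr : 2 * r = n) {z : Fin n → k}
    (hz : (standardAlt k n r).mulVec z = 0) : z = 0 := by
  ext j
  rcases Nat.even_or_odd (j : ℕ) with hj | hj
  · have hj1 : (j : ℕ) + 1 < n := by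
      rcases hj with ⟨a, ha⟩
      have := j.2
      omega
    have h := congrFun hz ⟨j + 1, hj1⟩
    rw [Matrix.mulVec, dotProduct, Finset.sum_eq_single j] at h
    · have hodd : ¬ Even ((j : ℕ) + 1) := Nat.not_even_iff_odd.2 hj.add_one
      simpa [standardAlt, hr, hj1, j.2, hodd, hj] using h
    · intro i _ hi
      have hne : (i : ℕ) ≠ j := fun h => hi (Fin.ext h)
      have hodd : ¬ Even ((j : ℕ) + 1) := Nat.not_even_iff_odd.2 hj.add_one
      have h' : ¬ ((j : ℕ) + 1 = (i : ℕ) + 1) := by omega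
      simp [standardAlt, hodd, Ne.symm hne]
    · simp
  · obtain ⟨a, ha⟩ := hj
    have hjn := j.2
    have h := congrFun hz ⟨j - 1, by omega⟩
    have hev : Even ((j : ℕ) - 1) := ⟨a, by omega⟩
    have hodd : ¬ Even (j : ℕ) := Nat.not_even_iff_odd.2 ⟨a, ha⟩
    rw [Matrix.mulVec, dotProduct, Finset.sum_eq_single j] at h
    · have h1 : (j : ℕ) = j - 1 + 1 := by omega
      have h2 : (j : ℕ) - 1 < 2 * r := by omega
      have h3 : (j : ℕ) < 2 * r := by omega
      simpa [standardAlt, h2, h3, hev, ← h1] using h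
    · intro i _ hi
      have hne : (i : ℕ) ≠ j := fun h => hi (Fin.ext h)
      have h1 : ¬ ((i : ℕ) = j - 1 + 1) := by omega
      have h2 : ¬ (Even (i : ℕ) ∧ (j : ℕ) - 1 = i + 1) := by
        rintro ⟨⟨b, hb⟩, h⟩
        omega
      rw [standardAlt, Matrix.of_apply]
      simp only [h1, h2, and_false, if_false, ite_self, zero_mul]
    · simp

/-- If the blocks filled the whole matrix, it would be invertible and the rank would be `n`. As `n`
is even, at least the last two rows and columns are zero. -/
theorem standardAlt_apply_eq_zero {r : ℕ} (hn : Even n) (hr : 2 * r ≤ n)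
    (hrank : (standardAlt k n r).rank + 2 = n) {i j : Fin n}
    (h : n ≤ (i : ℕ) + 2 ∨ n ≤ (j : ℕ) + 2) : standardAlt k n r i j = 0 := by
  have hne : 2 * r ≠ n := fun h => by
    have hu : IsUnit (standardAlt k n r) := by
      rw [Matrix.isUnit_iff_isUnit_det, isUnit_iff_ne_zero]
      intro h0
      obtain ⟨z, hz0, hz⟩ := Matrix.exists_mulVec_eq_zero_iff.2 h0
      exact hz0 (standardAlt_mulVec_injective h hz)
    have := Matrix.rank_of_isUnit _ hu
    rw [Fintype.card_fin] at this
    omega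
  obtain ⟨a, ha⟩ := hn
  rw [standardAlt, Matrix.of_apply, if_neg]
  omega

end Coefficients

/-- The variables `y_1, …, y_m` fall into three groups: `y_1, …, y_n` belong to the parameters,
`y_{n+1}, …, y_{m-1}` to the singular divisors, and `y_m` to the divisor not passing through `p`. -/
theorem sum_fin_eq_sum_add_sum_add {M : Type*} [AddCommMonoid M] {n m : ℕ} (hnm : n < m)
    (F : Fin m → M) :
    ∑ j, F j = ∑ a : Fin n, F ⟨a, by omega⟩ + ∑ b : Fin (m - 1 - n), F ⟨n + b, by omega⟩ +
      F ⟨m - 1, by omega⟩ := by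
  obtain ⟨m', rfl⟩ : ∃ m', m = n + m' + 1 := ⟨m - n - 1, by omega⟩
  rw [Fin.sum_univ_castSucc, Fin.sum_univ_add]
  congr 1
  congr 1
  exact Fintype.sum_equiv (finCongr (by omega)) _ _ fun b => rfl

end DualVariety
end

noncomputable section
namespace DualVariety

set_option linter.unusedSectionVars false

/-! ### Tangent vectors of the critical scheme in an adapted basis -/

section AdaptedPoint

variable {k : Type*} [Field k] {A : Type*} [CommRing A] [Algebra k A]
  {O : Type*} [CommRing O] [Algebra k O] [Algebra A O] [IsScalarTower k A O]
  [IsLocalRing O] [Algebra.FormallySmooth k A] [Algebra.FiniteType k A] {n : ℕ}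
  {D : Module.Basis (Fin n) A (Derivation k A A)} {dO : Fin n → Derivation k O O}
  (hdO : ∀ i a, dO i (algebraMap A O a) = algebraMap A O (D i a))
  {K : Type*} [Field K] [Algebra k K] [Algebra A K] [Algebra O K] [IsScalarTower k O K]
  [IsScalarTower A O K] [IsScalarTower k A K] (hk : Function.Bijective (algebraMap k K))
  (hε : ∀ x ∈ IsLocalRing.maximalIdeal O, algebraMap O K x = 0)
  {m : ℕ} (hnm : n < m) {φ : Fin (m + 1) → A} [Algebra (MvPolynomial (Fin m) A) K]
  [IsScalarTower A (MvPolynomial (Fin m) A) K] [IsScalarTower k (MvPolynomial (Fin m) A) K]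
  (hx : IsParameterSystem fun a : Fin n => algebraMap A O (φ ⟨a + 1, by omega⟩))
  (hdual : ∀ i a : Fin n, algebraMap O K (dO i (algebraMap A O (φ ⟨a + 1, by omega⟩))) =
    if i = a then 1 else 0)
  (hP : IsCriticalPoint φ D K)
  (hvan : ∀ i : Fin (m + 1), (i : ℕ) < m → algebraMap A K (φ i) = 0)
  (hsing : ∀ i : Fin (m + 1), n < (i : ℕ) → (i : ℕ) < m →
    algebraMap A O (φ i) ∈ IsLocalRing.maximalIdeal O ^ 2)
  {ψ : Fin (m + 1) → MvPowerSeries (Fin n) k}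
  (hψ : ∀ i, IsExpansion (fun a : Fin n => algebraMap A O (φ ⟨a + 1, by omega⟩))
    (algebraMap A O (φ i)) (ψ i))

include hP in
theorem phi_eq_one {i : Fin (m + 1)} (hi : (i : ℕ) = m) : φ i = 1 := by
  rw [← hP.last]
  congr 1
  exact Fin.ext hi

include hdO hk hε hx

include hP hψ in
theorem coeff_single_zero_eq_zero (a : Fin n) :
    MvPowerSeries.coeff (Finsupp.single a 1) (ψ 0) = 0 :=
  coeff_single_eq_zero hdO hk hε hx (hψ 0) (fun i => by
    rw [hdO, ← IsScalarTower.algebraMap_apply]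
    exact hP.map_derivation_zero i) a

include hsing hψ in
theorem coeff_single_eq_zero_of_singular (i : Fin (m + 1)) (hi : n < (i : ℕ)) (hi' : (i : ℕ) < m)
    (a : Fin n) : MvPowerSeries.coeff (Finsupp.single a 1) (ψ i) = 0 :=
  coeff_single_eq_zero hdO hk hε hx (hψ i) (fun r =>
    map_eq_zero_of_mem_pow hε one_ne_zero (derivation_mem_pow (dO r) (hsing i hi hi'))) a

include hdual

include hP hψ in
theorem map_derivation_derivation_zero (i j : Fin n) :
    algebraMap A K (D i (D j (φ 0))) = algebraMap k K (hessianAtOrigin (ψ 0) i j) := by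
  rw [map_derivation_derivation_eq hdO, map_derivation_derivation_expansion hε hx.mem (hψ 0)
    (coeff_single_zero_eq_zero hdO hk hε hnm hx hP hψ)]
  simp [hdual]

include hsing hψ in
theorem map_derivation_derivation_singular (l : Fin (m + 1)) (hl : n < (l : ℕ)) (hl' : (l : ℕ) < m)
    (i j : Fin n) :
    algebraMap A K (D i (D j (φ l))) = algebraMap k K (hessianAtOrigin (ψ l) i j) := by
  rw [map_derivation_derivation_eq hdO, map_derivation_derivation_expansion hε hx.mem (hψ l)
    (coeff_single_eq_zero_of_singular hdO hk hε hnm hx hsing hψ l hl hl')]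
  simp [hdual]

include hP hψ in
-- The frame is dual to the parameters only at the point, so `D_s D_t x_a` need not vanish there and
-- gives the correction term. The other two corrections contain entries of the Hessian in row `s` or
-- column `t`, which are zero.
theorem map_derivation_derivation_derivation_zero {s t : Fin n}
    (hs : ∀ a, hessianAtOrigin (ψ 0) s a = 0) (ht : ∀ a, hessianAtOrigin (ψ 0) a t = 0)
    (l : Fin n) :
    algebraMap A K (D l (D s (D t (φ 0)))) = algebraMap k K (thirdAtOrigin (ψ 0) l s t) +
      ∑ a : Fin n, algebraMap k K (hessianAtOrigin (ψ 0) l a) *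
        algebraMap A K (D s (D t (φ ⟨a + 1, by omega⟩))) := by
  have h3 : algebraMap A K (D l (D s (D t (φ 0)))) =
      algebraMap O K (dO l (dO s (dO t (algebraMap A O (φ 0))))) := by
    rw [hdO, hdO, hdO, ← IsScalarTower.algebraMap_apply]
  rw [h3, map_derivation_derivation_derivation_expansion hε hx.mem (hψ 0)
    (coeff_single_zero_eq_zero hdO hk hε hnm hx hP hψ)]
  simp only [hdual, map_derivation_derivation_eq hdO]
  simp only [mul_add, Finset.sum_add_distrib, mul_ite, ite_mul, mul_one, one_mul, zero_mul,
    mul_zero, Finset.sum_ite_eq, Finset.mem_univ, if_true, hs, map_zero, add_zero]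
  simp only [Finset.sum_comm (γ := Fin n), Finset.sum_ite_eq, Finset.mem_univ, if_true, ht,
    map_zero, zero_mul, Finset.sum_const_zero, zero_add]

include hP hvan hsing in
theorem apply_jacobianGenerator_none (v : Derivation k (MvPolynomial (Fin m) A) K) :
    v (linearForm φ) = (polyFrameEquiv D K v).2 ⟨m - 1, by omega⟩ := by
  rw [apply_linearForm_eq D, sum_fin_eq_sum_add_sum_add hnm, Finset.sum_eq_zero, zero_add,
    Finset.sum_eq_zero, zero_add, Finset.sum_eq_zero, zero_add,
    phi_eq_one hP (by simp; omega), map_one, one_mul]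
  · intro b _
    rw [hvan _ (by simp; omega), zero_mul]
  · intro a _
    rw [hvan _ (by simp; omega), zero_mul]
  · intro i _
    rw [hP.map_linearForm, hP.map_derivation_zero, zero_mul]

include hP hsing hψ in
theorem apply_jacobianGenerator_some (v : Derivation k (MvPolynomial (Fin m) A) K) (r : Fin n) :
    v (linearForm fun l => D r (φ l)) =
      ∑ l, algebraMap k K (hessianAtOrigin (ψ 0) l r) * (polyFrameEquiv D K v).1 l +
        (polyFrameEquiv D K v).2 ⟨r, by omega⟩ := by
  have hφ : ∀ i : Fin (m + 1), algebraMap A K (D r (φ i)) =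
      algebraMap O K (dO r (algebraMap A O (φ i))) := fun i => by
    rw [hdO, ← IsScalarTower.algebraMap_apply]
  rw [apply_linearForm_eq D, sum_fin_eq_sum_add_sum_add hnm]
  congr 1
  · refine Finset.sum_congr rfl fun l _ => ?_
    rw [hP.map_linearForm, map_derivation_derivation_zero hdO hk hε hnm hx hdual hP hψ]
  · rw [phi_eq_one hP (by simp; omega), Derivation.map_one_eq_zero, map_zero, zero_mul, add_zero,
      Finset.sum_eq_single r, Finset.sum_eq_zero, add_zero]
    · simp only [Fin.succ_mk]
      rw [hφ, hdual, if_pos rfl, one_mul]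
    · intro b _
      simp only [Fin.succ_mk]
      rw [hφ, map_eq_zero_of_mem_pow hε one_ne_zero
        (derivation_mem_pow (dO r) (hsing _ (by simp) (by simp; omega))), zero_mul]
    · intro a _ ha
      simp only [Fin.succ_mk]
      rw [hφ, hdual, if_neg ha.symm, zero_mul]
    · simp

include hP hvan hsing hψ in
-- The tangent space is a graph: the `y_m`-component is zero and those along `y_1, …, y_n` are
-- determined by the displacement of `p`. The displacement and the components along `y_{n+1}, …,
-- y_{m-1}` are free.
theorem mem_tangentSpace_jacobianIdeal_iff_coords (v : Derivation k (MvPolynomial (Fin m) A) K) :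
    v ∈ tangentSpace k (jacobianIdeal φ D) K ↔
      (polyFrameEquiv D K v).2 ⟨m - 1, by omega⟩ = 0 ∧
      ∀ r : Fin n, ∑ l, algebraMap k K (hessianAtOrigin (ψ 0) l r) * (polyFrameEquiv D K v).1 l +
        (polyFrameEquiv D K v).2 ⟨r, by omega⟩ = 0 := by
  rw [tangentSpace_jacobianIdeal hP, LinearMap.mem_ker, funext_iff, Option.forall]
  refine and_congr ?_ (forall_congr' fun r => ?_)
  · rw [← apply_jacobianGenerator_none hdO hk hε hnm hx hdual hP hvan hsing]
    rfl
  · rw [← apply_jacobianGenerator_some hdO hk hε hnm hx hdual hP hsing hψ]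
    rfl

include hP hvan hsing hψ in
-- The components along `y_1, …, y_n` forced by tangency contribute exactly the negative of the
-- corrections in the third derivatives of `φ_0`. What remains are the coefficients of the
-- expansions, as if the frame consisted of coordinate fields.
theorem apply_hessian_eq {s t : Fin n}
    (hs : ∀ a, hessianAtOrigin (ψ 0) s a = 0) (ht : ∀ a, hessianAtOrigin (ψ 0) a t = 0)
    {v : Derivation k (MvPolynomial (Fin m) A) K} (hv : v ∈ tangentSpace k (jacobianIdeal φ D) K) :
    v (hessian φ D s t) =
      ∑ l, algebraMap k K (thirdAtOrigin (ψ 0) l s t) * (polyFrameEquiv D K v).1 l +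
        ∑ b : Fin (m - 1 - n), algebraMap k K (hessianAtOrigin (ψ ⟨n + b + 1, by omega⟩) s t) *
          (polyFrameEquiv D K v).2 ⟨n + b, by omega⟩ := by
  obtain ⟨h1, h2⟩ := (mem_tangentSpace_jacobianIdeal_iff_coords hdO hk hε hnm hx hdual hP hvan
    hsing hψ v).1 hv
  rw [hessian, Matrix.of_apply, apply_linearForm_eq D, sum_fin_eq_sum_add_sum_add hnm, h1,
    mul_zero, add_zero, ← add_assoc]
  congr 1
  · have h3 : ∀ r : Fin n, (polyFrameEquiv D K v).2 ⟨r, by omega⟩ =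
        -∑ l, algebraMap k K (hessianAtOrigin (ψ 0) l r) * (polyFrameEquiv D K v).1 l := fun r =>
      eq_neg_of_add_eq_zero_right (h2 r)
    simp only [hP.map_linearForm, h3, Fin.succ_mk,
      map_derivation_derivation_derivation_zero hdO hk hε hnm hx hdual hP hψ hs ht]
    simp only [add_mul, Finset.sum_add_distrib, mul_neg, Finset.sum_neg_distrib, Finset.sum_mul,
      Finset.mul_sum]
    rw [add_assoc, add_eq_left, add_neg_eq_zero, Finset.sum_comm]
    exact Finset.sum_congr rfl fun a _ => Finset.sum_congr rfl fun l _ => by ring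
  · refine Finset.sum_congr rfl fun b _ => ?_
    simp only [Fin.succ_mk]
    rw [map_derivation_derivation_singular hdO hk hε hnm hx hdual hsing hψ _ (by simp)
      (by simp; omega)]

include hP hvan hsing hψ in
theorem exists_apply_hessian_ne_zero_iff {s t : Fin n}
    (hs : ∀ a, hessianAtOrigin (ψ 0) s a = 0) (ht : ∀ a, hessianAtOrigin (ψ 0) a t = 0) :
    (∃ v ∈ tangentSpace k (jacobianIdeal φ D) K, v (hessian φ D s t) ≠ 0) ↔
      (∃ l, thirdAtOrigin (ψ 0) l s t ≠ 0) ∨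
        ∃ b : Fin (m - 1 - n), hessianAtOrigin (ψ ⟨n + b + 1, by omega⟩) s t ≠ 0 := by
  have happ := fun v hv => apply_hessian_eq hdO hk hε hnm hx hdual hP hvan hsing hψ hs ht (v := v) hv
  have hmem := mem_tangentSpace_jacobianIdeal_iff_coords hdO hk hε hnm hx hdual hP hvan hsing hψ
  constructor
  · rintro ⟨v, hv, hne⟩
    by_contra! h
    rw [happ v hv] at hne
    simp [h.1, h.2] at hne
  · rintro (⟨l, hl⟩ | ⟨b, hb⟩)
    -- This vector moves `p` along `x_l`, with the components along `y_1, …, y_n` that tangency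
    -- forces.
    · obtain ⟨v, hc⟩ := (polyFrameEquiv (m := m) D K).surjective (Pi.single l 1, fun j =>
        if h : (j : ℕ) < n then -algebraMap k K (hessianAtOrigin (ψ 0) l ⟨j, h⟩) else 0)
      have hv : v ∈ tangentSpace k (jacobianIdeal φ D) K := by
        rw [hmem, hc]
        refine ⟨dif_neg (by simp; omega), fun r => ?_⟩
        simp [Pi.single_apply]
      refine ⟨v, hv, ?_⟩
      rw [happ v hv, hc]
      simpa [Pi.single_apply] using hl
    -- This vector fixes `p` and moves only along `y_{n+b+1}`, the variable with index `n + b`.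
    · obtain ⟨v, hc⟩ := (polyFrameEquiv (m := m) D K).surjective (0, Pi.single ⟨n + b, by omega⟩ 1)
      have hv : v ∈ tangentSpace k (jacobianIdeal φ D) K := by
        rw [hmem, hc]
        refine ⟨Pi.single_eq_of_ne (by simp [Fin.ext_iff]; omega) _, fun r => ?_⟩
        simp only [Pi.zero_apply, mul_zero, Finset.sum_const_zero, zero_add]
        exact Pi.single_eq_of_ne (by simp [Fin.ext_iff]; omega) _
      refine ⟨v, hv, ?_⟩
      rw [happ v hv, hc, Finset.sum_eq_zero (by simp), zero_add, Finset.sum_eq_single b]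
      · simpa using hb
      · intro b' _ hb'
        have : (⟨n + b', by omega⟩ : Fin m) ≠ ⟨n + b, by omega⟩ := fun h =>
          hb' (Fin.ext (by simpa using h))
        exact mul_eq_zero_of_right _ (Pi.single_eq_of_ne this _)
      · simp

end AdaptedPoint

end DualVariety
end

noncomputable section
namespace DualVariety

set_option linter.unusedSectionVars false

/-! ### The criterion in terms of expansion coefficients -/

section Criterion

theorem hessianAtOrigin_isSymm {k : Type*} [Field k] {n : ℕ} (ψ : MvPowerSeries (Fin n) k) :
    (hessianAtOrigin ψ).IsSymm := by
  ext i j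
  simp only [hessianAtOrigin, Matrix.transpose_apply, Matrix.of_apply, eq_comm (a := j),
    add_comm (Finsupp.single j 1)]

theorem hessianAtOrigin_self {k : Type*} [Field k] (h2 : (2 : k) = 0) {n : ℕ}
    (ψ : MvPowerSeries (Fin n) k) (i : Fin n) : hessianAtOrigin ψ i i = 0 := by
  simp [hessianAtOrigin, h2]

theorem rank_le_rank_toBlocks₁₁ {k κ l : Type*} [Field k] [Fintype κ] [Fintype l] [DecidableEq κ]
    (M : Matrix (κ ⊕ l) (κ ⊕ l) k) (hl : ∀ a i, M (Sum.inr a) i = 0)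
    (hr : ∀ i a, M i (Sum.inr a) = 0) : M.rank ≤ M.toBlocks₁₁.rank := by
  have h : M = (Matrix.fromRows 1 0 : Matrix (κ ⊕ l) κ k) *
      (M.toBlocks₁₁ * (Matrix.fromCols 1 0 : Matrix κ (κ ⊕ l) k)) := by
    rw [Matrix.fromRows_mul, Matrix.one_mul, Matrix.zero_mul, Matrix.mul_fromCols, Matrix.mul_one,
      Matrix.mul_zero]
    ext (i | a) (j | b) <;> simp [Matrix.toBlocks₁₁, hl, hr]
  conv_lhs => rw [h]
  exact (Matrix.rank_mul_le_right _ _).trans (Matrix.rank_mul_le_left _ _)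

variable {k : Type*} [Field k] {A : Type*} [CommRing A] [Algebra k A] [IsDomain A]
  {O : Type*} [CommRing O] [Algebra k O] [Algebra A O] [IsScalarTower k A O]
  [IsLocalRing O] [Algebra.FormallySmooth k A] [Algebra.FiniteType k A] {n : ℕ}
  {D : Module.Basis (Fin n) A (Derivation k A A)} {dO : Fin n → Derivation k O O}
  (hdO : ∀ i a, dO i (algebraMap A O a) = algebraMap A O (D i a))
  {K : Type*} [Field K] [Algebra k K] [Algebra A K] [Algebra O K] [IsScalarTower k O K]
  [IsScalarTower A O K] [IsScalarTower k A K] (hk : Function.Bijective (algebraMap k K))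
  (hε : ∀ x ∈ IsLocalRing.maximalIdeal O, algebraMap O K x = 0)
  {m : ℕ} {φ : Fin (m + 1) → A} [Algebra (MvPolynomial (Fin m) A) K]
  [IsScalarTower A (MvPolynomial (Fin m) A) K] [IsScalarTower k (MvPolynomial (Fin m) A) K]
  (hP : IsCriticalPoint φ D K) (h2 : (2 : A) = 0)
  {f : MvPolynomial (Fin m) A} (hf : f ^ 2 - (hessian φ D).det ∈ jacobianIdeal φ D)
  (hfK : algebraMap (MvPolynomial (Fin m) A) K f = 0) (hn : Even n)

include hdO hk hε hP h2 hf hfK hn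

theorem rank_hessianAtOrigin_add_two_eq {x : Fin n → O} (hx : IsParameterSystem x)
    {ψ : MvPowerSeries (Fin n) k} (hψ : IsExpansion x (algebraMap A O (φ 0)) ψ)
    (hv : ∃ v ∈ tangentSpace k (jacobianIdeal φ D) K, v f ≠ 0) :
    (hessianAtOrigin ψ).rank + 2 = n := by
  obtain ⟨H₀, hH₀, hr⟩ := exists_map_hessian_eq hdO hk hε hx hP hψ
  have := rank_add_two_eq hH₀ hf hfK h2 hP (by rwa [Fintype.card_fin]) hv
  rwa [hr, Fintype.card_fin] at this

theorem exists_apply_root_ne_zero_iff (hnm : n < m)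
    (hx : IsParameterSystem fun a : Fin n => algebraMap A O (φ ⟨a + 1, by omega⟩))
    (hvan : ∀ i : Fin (m + 1), (i : ℕ) < m → algebraMap A K (φ i) = 0)
    (hsing : ∀ i : Fin (m + 1), n < (i : ℕ) → (i : ℕ) < m →
      algebraMap A O (φ i) ∈ IsLocalRing.maximalIdeal O ^ 2)
    {ψ : Fin (m + 1) → MvPowerSeries (Fin n) k}
    (hψ : ∀ i, IsExpansion (fun a : Fin n => algebraMap A O (φ ⟨a + 1, by omega⟩))
      (algebraMap A O (φ i)) (ψ i))
    (hrank : (hessianAtOrigin (ψ 0)).rank + 2 = n)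
    (hrow : ∀ i j : Fin n, n ≤ (i : ℕ) + 2 → hessianAtOrigin (ψ 0) i j = 0)
    {s t : Fin n} (hs : (s : ℕ) + 2 = n) (ht : (t : ℕ) + 1 = n) :
    (∃ v ∈ tangentSpace k (jacobianIdeal φ D) K, v f ≠ 0) ↔
      (∃ l, thirdAtOrigin (ψ 0) l s t ≠ 0) ∨
        ∃ b : Fin (m - 1 - n), hessianAtOrigin (ψ ⟨n + b + 1, by omega⟩) s t ≠ 0 := by
  have hk2 : (2 : k) = 0 := (algebraMap k A).injective (by rw [map_ofNat, h2, map_zero])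
  obtain ⟨b, D', dO', hb, hdO', hdual⟩ := exists_dual_frame hdO hk hε hx
  have hP' := hP.basis_change hb
  have hsymm := hessianAtOrigin_isSymm (ψ 0)
  have hcol : ∀ i j : Fin n, n ≤ (j : ℕ) + 2 → hessianAtOrigin (ψ 0) i j = 0 := fun i j hj => by
    rw [← hsymm.apply]
    exact hrow j i hj
  rw [← exists_apply_hessian_ne_zero_iff hdO' hk hε hnm hx hdual hP' hvan hsing hψ
    (fun a => hrow s a (by omega)) (fun a => hcol a t (by omega))]
  have hH' : ∀ i j, algebraMap (MvPolynomial (Fin m) A) K (hessian φ D' i j) =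
      algebraMap k K (hessianAtOrigin (ψ 0) i j) := fun i j => by
    rw [hessian, Matrix.of_apply, hP'.map_linearForm]
    exact map_derivation_derivation_zero hdO' hk hε hnm hx hdual hP' hψ i j
  -- The dual frame is reindexed so that the last two vectors, which span the kernel of the Hessian
  -- at the point, are split off as the border.
  let e : Fin (n - 2) ⊕ Fin 2 ≃ Fin n := finSumFinEquiv.trans (finCongr (by omega))
  have hel : ∀ i, (e (Sum.inl i) : ℕ) = i := fun i => by simp [e]
  have her : ∀ a, (e (Sum.inr a) : ℕ) = n - 2 + a := fun a => by simp [e]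
  have hes : e (Sum.inr 0) = s := Fin.ext (by rw [her]; simp; omega)
  have het : e (Sum.inr 1) = t := Fin.ext (by rw [her]; simp; omega)
  let D'' := D'.reindex e.symm
  have hb' : ∀ i, D'' i = ∑ j, algebraMap k A (b.reindex e.symm i j) • D j := fun i => by
    simp only [D'', Module.Basis.reindex_apply]
    exact hb _
  have hH'' : ∀ i j, hessian φ D'' i j = hessian φ D' (e i) (e j) := fun i j => by
    simp only [hessian, Matrix.of_apply, D'', Module.Basis.reindex_apply, Equiv.symm_symm]
  obtain ⟨f', hf', -⟩ := exists_hessian_root (φ := φ) D'' h2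
  obtain ⟨h0, hvf⟩ := exists_root_basis_change h2 hP hb' hf hf'
  have hP'' := hP.basis_change hb'
  obtain ⟨δ, hδ, hred⟩ := hP''.exists_reduced
  set M := (hessianAtOrigin (ψ 0)).submatrix e e with hM
  have hMK : (hessian φ D'').map (algebraMap (MvPolynomial (Fin m) A) K) =
      M.map (algebraMap k K) := by
    ext i j
    rw [Matrix.map_apply, hH'', hH']
    rfl
  have hMr : ∀ a i, M (Sum.inr a) i = 0 := fun a i => hrow _ _ (by rw [her]; omega)
  have hMc : ∀ i a, M i (Sum.inr a) = 0 := fun i a => hcol _ _ (by rw [her]; omega)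
  -- A degenerate alternating block of even size `n - 2` would have rank at most `n - 4`, but all
  -- other entries of `M` vanish and its rank is `n - 2`.
  have hdet : M.toBlocks₁₁.det ≠ 0 := by
    intro h0
    have h1 := rank_add_two_le hk2 (M := M.toBlocks₁₁) (by ext i j; exact hsymm.apply _ _)
      (fun i => hessianAtOrigin_self hk2 _ _)
      (by
        rw [Fintype.card_fin]
        obtain ⟨a, ha⟩ := hn
        exact ⟨a - 1, by omega⟩) h0
    have h2 := rank_le_rank_toBlocks₁₁ M hMr hMc
    rw [hM, Matrix.rank_submatrix, ← hM] at h2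
    rw [Fintype.card_fin] at h1
    omega
  have hd : IsUnit ((hessian φ D'').map
      (algebraMap (MvPolynomial (Fin m) A) K)).toBlocks₁₁.det := by
    rw [hMK, show (M.map (algebraMap k K)).toBlocks₁₁ = M.toBlocks₁₁.map (algebraMap k K) from rfl,
      ← RingHom.mapMatrix_apply, ← RingHom.map_det]
    exact (map_ne_zero (algebraMap k K)).2 hdet |>.isUnit
  have hkey := fun v hv => derivation_root_eq_zero_iff hred (algebraMap_C_ne_zero hδ)
    hP''.map_eq_zero hd hf' (h0 hfK) h2 (fun a i => by
      have := congrFun (congrFun hMK (Sum.inr a)) i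
      rw [Matrix.map_apply, Matrix.map_apply, hMr, map_zero] at this
      exact this) (v := v) hv
  rw [← jacobianIdeal_eq D D''] at hkey
  rw [← jacobianIdeal_eq D D']
  refine exists_congr fun v => and_congr_right fun hv => not_congr ?_
  rw [hvf v hv, hkey v hv, hH'', hes, het]

end Criterion

end DualVariety
end

noncomputable section
namespace DualVariety

set_option linter.unusedSectionVars false

/-! ## Rational points of the degeneracy scheme -/

section RationalPoint

open IsLocalRing

variable {k : Type*} [Field k] {A : Type*} [CommRing A] [Algebra k A]
  {O : Type*} [CommRing O] [IsLocalRing O] [Algebra k O] [Algebra A O] [IsScalarTower k A O]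
  (hκ : Function.Bijective (algebraMap k (ResidueField O))) {m : ℕ}

variable (A O m) in
/-- The ideal of the point `(p, 0)` of `Spec A × 𝔸^m`, where `O` is the local ring of `p`. -/
def originIdeal : Ideal (MvPolynomial (Fin m) A) :=
  Ideal.comap ((algebraMap A O).comp
    (MvPolynomial.aeval (R := A) (fun _ : Fin m => (0 : A))).toRingHom) (maximalIdeal O)

theorem mem_originIdeal {s : MvPolynomial (Fin m) A} : s ∈ originIdeal A O m ↔
    algebraMap A O (MvPolynomial.aeval (fun _ => 0) s) ∈ maximalIdeal O := Iff.rfl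

theorem linearForm_mem_originIdeal {g : Fin (m + 1) → A} :
    linearForm g ∈ originIdeal A O m ↔ algebraMap A O (g 0) ∈ maximalIdeal O := by
  rw [mem_originIdeal]
  simp [linearForm]

theorem X_mem_originIdeal (j : Fin m) :
    (MvPolynomial.X j : MvPolynomial (Fin m) A) ∈ originIdeal A O m := by
  rw [mem_originIdeal]
  simp

theorem C_mem_originIdeal {a : A} :
    (MvPolynomial.C a : MvPolynomial (Fin m) A) ∈ originIdeal A O m ↔
      algebraMap A O a ∈ maximalIdeal O := by
  rw [mem_originIdeal]
  simp [MvPolynomial.algHom_C]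

include hκ

theorem exists_sub_algebraMap_mem (y : O) : ∃ r : k, y - algebraMap k O r ∈ maximalIdeal O := by
  obtain ⟨r, hr⟩ := hκ.2 (residue O y)
  refine ⟨r, ?_⟩
  rw [← residue_eq_zero_iff, map_sub, ← hr, sub_eq_zero]
  exact IsScalarTower.algebraMap_apply k O (ResidueField O) r

theorem exists_sub_algebraMap_mem_originIdeal (s : MvPolynomial (Fin m) A) :
    ∃ r : k, s - algebraMap k _ r ∈ originIdeal A O m := by
  obtain ⟨r, hr⟩ := exists_sub_algebraMap_mem hκ
    (algebraMap A O (MvPolynomial.aeval (fun _ : Fin m => (0 : A)) s))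
  refine ⟨r, ?_⟩
  have : MvPolynomial.aeval (fun _ : Fin m => (0 : A))
      (algebraMap k (MvPolynomial (Fin m) A) r) = algebraMap k A r := by
    rw [IsScalarTower.algebraMap_apply k A (MvPolynomial (Fin m) A), AlgHom.commutes]
    rfl
  rw [mem_originIdeal, map_sub, map_sub, this, ← IsScalarTower.algebraMap_apply]
  exact hr

theorem originIdeal_isMaximal : (originIdeal A O m).IsMaximal := by
  have : (originIdeal A O m).IsPrime := Ideal.comap_isPrime _ _
  refine Ideal.Quotient.maximal_of_isField _ ⟨⟨0, 1, zero_ne_one⟩, mul_comm, fun {x} hx => ?_⟩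
  obtain ⟨s, rfl⟩ := Ideal.Quotient.mk_surjective x
  obtain ⟨r, hr⟩ := exists_sub_algebraMap_mem_originIdeal (A := A) (m := m) hκ s
  have hr' := Ideal.Quotient.eq.2 hr
  have hr0 : r ≠ 0 := by
    rintro rfl
    rw [map_zero, map_zero] at hr'
    exact hx hr'
  refine ⟨Ideal.Quotient.mk _ (algebraMap k _ r⁻¹), ?_⟩
  rw [hr', ← map_mul, ← map_mul, mul_inv_cancel₀ hr0, map_one, map_one]

variable {I : Ideal (MvPolynomial (Fin m) A)} (hI : I ≤ originIdeal A O m)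
include hI

theorem map_originIdeal_isMaximal :
    ((originIdeal A O m).map (Ideal.Quotient.mk I)).IsMaximal := by
  have := originIdeal_isMaximal (A := A) (m := m) hκ
  exact Ideal.IsMaximal.map_of_surjective_of_ker_le Ideal.Quotient.mk_surjective
    (by rwa [Ideal.mk_ker])

omit hκ in
theorem mk_mem_map_originIdeal {s : MvPolynomial (Fin m) A} :
    Ideal.Quotient.mk I s ∈ (originIdeal A O m).map (Ideal.Quotient.mk I) ↔
      s ∈ originIdeal A O m := by
  rw [← Ideal.mem_comap, Ideal.comap_map_of_surjective _ Ideal.Quotient.mk_surjective,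
    ← RingHom.ker_eq_comap_bot, Ideal.mk_ker, sup_of_le_left hI]

theorem algebraMap_quotient_bijective : Function.Bijective
    (algebraMap k ((MvPolynomial (Fin m) A ⧸ I) ⧸
      (originIdeal A O m).map (Ideal.Quotient.mk I))) := by
  have hmax := map_originIdeal_isMaximal hκ hI
  refine ⟨(algebraMap k _).injective, fun x => ?_⟩
  obtain ⟨b, rfl⟩ := Ideal.Quotient.mk_surjective x
  obtain ⟨s, rfl⟩ := Ideal.Quotient.mk_surjective b
  obtain ⟨r, hr⟩ := exists_sub_algebraMap_mem_originIdeal (A := A) (m := m) hκ s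
  refine ⟨r, (Ideal.Quotient.eq.2 ?_).symm⟩
  exact (mk_mem_map_originIdeal hI).2 hr

end RationalPoint

end DualVariety
end

noncomputable section
namespace DualVariety

set_option linter.unusedSectionVars false

/-! ### Immersive points in terms of cotangent spaces -/

section CriticalPoint

open IsLocalRing

variable {k : Type*} [Field k] {A : Type*} [CommRing A] [Algebra k A]
  {O : Type*} [CommRing O] [IsLocalRing O] [Algebra k O] [Algebra A O] [IsScalarTower k A O]
  (hκ : Function.Bijective (algebraMap k (ResidueField O))) {m n : ℕ}

/-- The functional on the cotangent space given by a derivation of a local ring. -/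
theorem exists_dual_of_derivation (d : Derivation k O O) :
    ∃ v : Module.Dual (ResidueField O) (CotangentSpace O), ∀ z : maximalIdeal O,
      v ((maximalIdeal O).toCotangent z) = residue O (d z) := by
  let f : maximalIdeal O →ₗ[O] ResidueField O :=
    { toFun := fun z => residue O (d z)
      map_add' := fun y z => by simp
      map_smul' := fun y z => by
        have hz : residue O (z : O) = 0 := residue_eq_zero_iff _ |>.2 z.2
        rw [Submodule.coe_smul, smul_eq_mul, Derivation.leibniz, smul_eq_mul, smul_eq_mul, map_add,
          map_mul, map_mul, hz, zero_mul, add_zero, RingHom.id_apply, Algebra.smul_def]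
        rfl }
  have hf : (maximalIdeal O • ⊤ : Submodule O (maximalIdeal O)) ≤ LinearMap.ker f := by
    refine Submodule.smul_le.2 fun y hy z _ => ?_
    rw [LinearMap.mem_ker, map_smul, Algebra.smul_def, ResidueField.algebraMap_eq,
      residue_eq_zero_iff _ |>.2 hy, zero_mul]
  let g : CotangentSpace O →ₗ[O] ResidueField O := Submodule.liftQ _ f hf
  exact ⟨g.extendScalarsOfSurjective residue_surjective, fun z => rfl⟩

variable [Algebra.FormallySmooth k A] [Algebra.FiniteType k A] (M : Submonoid A)
  [IsLocalization M O] {D : Module.Basis (Fin n) A (Derivation k A A)} {φ : Fin (m + 1) → A}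
  {K : Type*} [Field K] [Algebra k K] [Algebra A K] [Algebra O K] [IsScalarTower k O K]
  [IsScalarTower A O K] [IsScalarTower k A K] (hk : Function.Bijective (algebraMap k K))
  (hε : ∀ x ∈ maximalIdeal O, algebraMap O K x = 0)
  [Algebra (MvPolynomial (Fin m) A) K] [IsScalarTower A (MvPolynomial (Fin m) A) K]
  (hker : ∀ s ∈ originIdeal A O m, algebraMap (MvPolynomial (Fin m) A) K s = 0)

include M hκ hk hε hker

/-- A relation `a` between the derivatives of the `φ_l` at the point defines a derivation of the
local ring, hence a functional on the cotangent space that kills the linear system. It is zero by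
`himm`; then the derivation vanishes at the point on all functions, and `a = 0` by uniqueness of
coefficients in a frame. -/
theorem isCriticalPoint (hlast : φ (Fin.last m) = 1) (hJ : jacobianIdeal φ D ≤ originIdeal A O m)
    (himm : ∀ v : Module.Dual (ResidueField O) (CotangentSpace O),
      (∀ (r : Fin (m + 1) → k)
        (h0 : algebraMap A O (∑ i, algebraMap k A (r i) * φ i) ∈ maximalIdeal O),
        v ((maximalIdeal O).toCotangent ⟨_, h0⟩) = 0) → v = 0) :
    IsCriticalPoint φ D K := by
  have hK : ∀ g : Fin (m + 1) → A, linearForm g ∈ jacobianIdeal φ D → algebraMap A K (g 0) = 0 :=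
    fun g hg => by
      rw [IsScalarTower.algebraMap_apply A O K]
      exact hε _ (linearForm_mem_originIdeal.1 (hJ hg))
  refine ⟨hlast, fun j => hker _ (X_mem_originIdeal j), hK _ (linearForm_mem_jacobianIdeal _),
    fun i => hK _ (linearForm_derivation_mem_jacobianIdeal _ i), fun a ha => ?_⟩
  choose dO hdO using fun i => exists_derivation_extension (O := O) M (D i)
  choose g hg using hk.2
  let d : Derivation k O O := ∑ i, g (a i) • dO i
  have hd : ∀ y, d y = ∑ i, algebraMap k O (g (a i)) * dO i y := fun y => by
    change Derivation.coeFnAddMonoidHom d y = _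
    rw [map_sum, Finset.sum_apply]
    exact Finset.sum_congr rfl fun i _ => Algebra.smul_def _ _
  have hdA : ∀ b : A, algebraMap O K (d (algebraMap A O b)) =
      ∑ i, a i * algebraMap A K (D i b) := fun b => by
    rw [hd, map_sum]
    refine Finset.sum_congr rfl fun i _ => ?_
    rw [hdO, map_mul, ← IsScalarTower.algebraMap_apply, ← IsScalarTower.algebraMap_apply, hg]
  have hmem : ∀ y : O, algebraMap O K y = 0 ↔ y ∈ maximalIdeal O := fun y => by
    refine ⟨fun h => ?_, hε y⟩
    rw [mem_maximalIdeal, mem_nonunits_iff]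
    exact fun hu => (hu.map (algebraMap O K)).ne_zero h
  obtain ⟨v, hv⟩ := exists_dual_of_derivation d
  have hv0 : v = 0 := by
    refine himm v fun r h0 => ?_
    rw [hv, residue_eq_zero_iff, ← hmem, hdA]
    have : ∀ i, D i (∑ l, algebraMap k A (r l) * φ l) = ∑ l, algebraMap k A (r l) * D i (φ l) :=
      fun i => by simp [Derivation.leibniz]
    simp only [this, map_sum, map_mul, Finset.mul_sum]
    rw [Finset.sum_comm]
    refine Finset.sum_eq_zero fun l _ => ?_
    rw [← mul_zero (algebraMap A K (algebraMap k A (r l))), ← ha l, Finset.mul_sum]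
    exact Finset.sum_congr rfl fun i _ => mul_left_comm _ _ _
  refine eq_zero_of_sum_smul_eq_zero D fun b => ?_
  obtain ⟨r, hr⟩ := exists_sub_algebraMap_mem hκ (algebraMap A O b)
  have h1 := hv ⟨_, hr⟩
  rw [hv0, LinearMap.zero_apply, eq_comm, residue_eq_zero_iff, ← hmem, map_sub,
    Derivation.map_algebraMap, sub_zero, hdA] at h1
  rw [← h1]
  exact Finset.sum_congr rfl fun i _ => by rw [Algebra.smul_def, mul_comm]

end CriticalPoint

end DualVariety
end

noncomputable section
namespace DualVariety

set_option linter.unusedSectionVars false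

/-! ### The kernel of the projection at smooth points -/

section Bundle

variable {k : Type*} [Field k] {A : Type*} [CommRing A] [Algebra k A] [IsDomain A]
  [Algebra.FormallySmooth k A] [Algebra.FiniteType k A] {ι : Type*} [Fintype ι] [DecidableEq ι]
  {D : Module.Basis ι A (Derivation k A A)} {m : ℕ} {φ : Fin (m + 1) → A}
  {K : Type*} [Field K] [Algebra k K] [Algebra A K] [IsScalarTower k A K]
  (hk : Function.Bijective (algebraMap k K)) [Algebra (MvPolynomial (Fin m) A) K]
  [IsScalarTower A (MvPolynomial (Fin m) A) K] [IsScalarTower k (MvPolynomial (Fin m) A) K]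
  (hP : IsCriticalPoint φ D K) (h2 : (2 : A) = 0)

include hk hP h2

/-- At a smooth point of the degeneracy scheme there is a frame whose last two vectors span the
kernel of the Hessian. -/
theorem exists_block_frame (hι : Even (Fintype.card ι)) {f : MvPolynomial (Fin m) A}
    (hf : f ^ 2 - (hessian φ D).det ∈ jacobianIdeal φ D)
    (hfK : algebraMap (MvPolynomial (Fin m) A) K f = 0)
    (hv : ∃ v ∈ tangentSpace k (jacobianIdeal φ D) K, v f ≠ 0) :
    ∃ (r : ℕ) (b : Module.Basis (Fin r ⊕ Fin 2) k (ι → k))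
      (D' : Module.Basis (Fin r ⊕ Fin 2) A (Derivation k A A)),
      (∀ i, D' i = ∑ j, algebraMap k A (b i j) • D j) ∧
      IsUnit ((hessian φ D').map (algebraMap (MvPolynomial (Fin m) A) K)).toBlocks₁₁.det := by
  obtain ⟨H₀, hH₀⟩ := exists_hessian_eq_map (φ := φ) (D := D) hk
  have hr := rank_add_two_eq hH₀ hf hfK h2 hP hι hv
  obtain ⟨b, -, hdet⟩ := exists_adapted_basis (isSymm_of_map_hessian hH₀ hP)
  let b' := b.reindex ((Equiv.refl (Fin H₀.rank)).sumCongr (finCongr (by omega : _ = 2)))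
  have hb' : ∀ i, b' (Sum.inl i) = b (Sum.inl i) := fun i => by simp [b']
  obtain ⟨D', hb⟩ := exists_basis_change b' D
  refine ⟨_, b', D', hb, ?_⟩
  have : ((hessian φ D').map (algebraMap (MvPolynomial (Fin m) A) K)).toBlocks₁₁ =
      (Matrix.of fun i j => b (Sum.inl i) ⬝ᵥ H₀.mulVec (b (Sum.inl j))).map (algebraMap k K) := by
    ext i j
    rw [Matrix.map_apply, Matrix.of_apply, ← hb', ← hb']
    exact map_hessian_basis_change hb hH₀ _ _
  rw [this, ← RingHom.mapMatrix_apply, ← RingHom.map_det]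
  exact ((map_ne_zero (algebraMap k K)).2 hdet).isUnit

variable {I : Ideal (MvPolynomial (Fin m) A)} (hI : I = rootIdeal φ D)
  [Algebra (MvPolynomial (Fin m) A ⧸ I) K]
  [IsScalarTower (MvPolynomial (Fin m) A) (MvPolynomial (Fin m) A ⧸ I) K]
  [IsScalarTower k (MvPolynomial (Fin m) A ⧸ I) K]
  {q : Ideal (MvPolynomial (Fin m) A ⧸ I)}
  (hq : RingHom.ker (algebraMap (MvPolynomial (Fin m) A ⧸ I) K) = q)

include hI hq

/-- The kernel of the projection of the degeneracy scheme to the parameter space. -/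
theorem kernelIsSubbundleNear_and_finrank (hι : Even (Fintype.card ι)) (hm : 2 ≤ m)
    (hsm : IsSmoothOfDimAt k q (m - 2)) :
    KernelIsSubbundleNear k
      (fun j => Ideal.Quotient.mk I (MvPolynomial.X j : MvPolynomial (Fin m) A)) q (m - 2) 2 ∧
    Module.finrank k (LinearMap.ker (differential (k := k)
      (fun j => Ideal.Quotient.mk I (MvPolynomial.X j : MvPolynomial (Fin m) A)) K)) = 2 := by
  obtain ⟨f, hf, -⟩ := exists_hessian_root (φ := φ) D h2
  have hmap : ∀ s, algebraMap (MvPolynomial (Fin m) A) K s =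
      algebraMap (MvPolynomial (Fin m) A ⧸ I) K (Ideal.Quotient.mk I s) := fun s =>
    IsScalarTower.algebraMap_apply _ (MvPolynomial (Fin m) A ⧸ I) K s
  have hfK : algebraMap (MvPolynomial (Fin m) A) K f = 0 := by
    rw [hmap, Ideal.Quotient.eq_zero_iff_mem.2 (hI ▸ mem_rootIdeal hf), map_zero]
  obtain ⟨r, b, D', hb, hd⟩ := exists_block_frame hk hP h2 hι hf hfK
    ((isSmoothOfDimAt_iff h2 hI hk hP hm hf hq).1 hsm)
  have hP' := hP.basis_change hb
  obtain ⟨δ, hδ, hred⟩ := hP'.exists_reduced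
  have hδ' := algebraMap_C_ne_zero (m := m) hδ
  have hI' : I = rootIdeal φ D' := hI.trans (rootIdeal_eq hb)
  have hqp : q.IsPrime := hq ▸ RingHom.ker_isPrime _
  refine ⟨kernelIsSubbundleNear hI' hred h2 hsm (fun h => ?_) (fun h => ?_),
    finrank_ker_differential hI' hred h2 K hk hδ' hd⟩
  · rw [← hq, RingHom.mem_ker, ← hmap] at h
    exact hδ'.ne_zero h
  · rw [← hq, RingHom.mem_ker, ← hmap, RingHom.map_det] at h
    exact hd.ne_zero h

end Bundle

/-! ### The theorem at a rational point of an affine chart -/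

section Main

open IsLocalRing

variable {k : Type*} [Field k] {A : Type*} [CommRing A] [Algebra k A] [IsDomain A]
  {O : Type*} [CommRing O] [IsLocalRing O] [Algebra k O] [Algebra A O] [IsScalarTower k A O]
  (hκ : Function.Bijective (algebraMap k (ResidueField O))) {m n : ℕ}
  [Algebra.FormallySmooth k A] [Algebra.FiniteType k A] (M : Submonoid A)
  [IsLocalization M O] {D : Module.Basis (Fin n) A (Derivation k A A)} {φ : Fin (m + 1) → A}
  (h2 : (2 : A) = 0) (hn : Even n) (hn0 : 0 < n) (hnm : n < m)
  {I : Ideal (MvPolynomial (Fin m) A)} (hI : I = rootIdeal φ D) (hIorig : I ≤ originIdeal A O m)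
  (hlast : φ (Fin.last m) = 1)
  (himm : ∀ v : Module.Dual (ResidueField O) (CotangentSpace O),
    (∀ (r : Fin (m + 1) → k)
      (h0 : algebraMap A O (∑ i, algebraMap k A (r i) * φ i) ∈ maximalIdeal O),
      v ((maximalIdeal O).toCotangent ⟨_, h0⟩) = 0) → v = 0)

include hκ M h2 hn hn0 hnm hI hIorig hlast himm

theorem degeneracy_point :
    (IsSmoothOfDimAt k ((originIdeal A O m).map (Ideal.Quotient.mk I)) (m - 2) →
      ∀ (x : Fin n → O) (ψ : MvPowerSeries (Fin n) k), IsParameterSystem x →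
        IsExpansion x (algebraMap A O (φ 0)) ψ → (hessianAtOrigin ψ).rank = n - 2) ∧
    (∀ ψ : Fin (m + 1) → MvPowerSeries (Fin n) k,
      (∀ i, IsExpansion (fun a : Fin n => algebraMap A O (φ ⟨a + 1, by omega⟩))
        (algebraMap A O (φ i)) (ψ i)) →
      (∀ i : Fin (m + 1), (i : ℕ) < m → algebraMap A O (φ i) ∈ maximalIdeal O) →
      IsParameterSystem (fun a : Fin n => algebraMap A O (φ ⟨a + 1, by omega⟩)) →
      (∀ i : Fin (m + 1), n < (i : ℕ) → (i : ℕ) < m →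
        algebraMap A O (φ i) ∈ maximalIdeal O ^ 2) →
      (∃ r : ℕ, 2 * r ≤ n ∧ hessianAtOrigin (ψ 0) = standardAlt k n r) →
      (hessianAtOrigin (ψ 0)).rank = n - 2 →
        (IsSmoothOfDimAt k ((originIdeal A O m).map (Ideal.Quotient.mk I)) (m - 2) ↔
          (∃ i ∈ Finset.Icc 1 (n - 2), squarefreeCoeff {i, n - 1, n} (ψ 0) ≠ 0) ∨
          (∃ j : Fin (m + 1), n + 1 ≤ (j : ℕ) ∧ (j : ℕ) ≤ m - 1 ∧
            squarefreeCoeff {n - 1, n} (ψ j) ≠ 0))) ∧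
    (IsSmoothOfDimAt k ((originIdeal A O m).map (Ideal.Quotient.mk I)) (m - 2) →
      KernelIsSubbundleNear k
        (fun j => Ideal.Quotient.mk I (MvPolynomial.X j : MvPolynomial (Fin m) A))
        ((originIdeal A O m).map (Ideal.Quotient.mk I)) (m - 2) 2 ∧
      Module.finrank k (LinearMap.ker (differential (k := k)
        (fun j => Ideal.Quotient.mk I (MvPolynomial.X j : MvPolynomial (Fin m) A))
        ((MvPolynomial (Fin m) A ⧸ I) ⧸ (originIdeal A O m).map (Ideal.Quotient.mk I)))) = 2) := by
  set q := (originIdeal A O m).map (Ideal.Quotient.mk I) with hqdef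
  have hmax : q.IsMaximal := map_originIdeal_isMaximal hκ hIorig
  let _ : Field ((MvPolynomial (Fin m) A ⧸ I) ⧸ q) := Ideal.Quotient.field q
  have hk : Function.Bijective (algebraMap k ((MvPolynomial (Fin m) A ⧸ I) ⧸ q)) :=
    algebraMap_quotient_bijective hκ hIorig
  have hn2 : 2 ≤ n := by
    obtain ⟨a, rfl⟩ := hn
    omega
  have hq : RingHom.ker (algebraMap (MvPolynomial (Fin m) A ⧸ I)
      ((MvPolynomial (Fin m) A ⧸ I) ⧸ q)) = q := Ideal.mk_ker
  -- Both the residue field of `O` and that of the point on `ℛ` equal `k`, so `O` acts on the latter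
  -- through values in `k`. This agrees with the action of `A`, since both send a function to its
  -- value at `p`.
  let εκ : O →+* ((MvPolynomial (Fin m) A ⧸ I) ⧸ q) :=
    (algebraMap k ((MvPolynomial (Fin m) A ⧸ I) ⧸ q)).comp
      ((RingEquiv.ofBijective _ hκ).symm.toRingHom.comp (residue O))
  have hεκ : ∀ (y : O) (r : k), y - algebraMap k O r ∈ maximalIdeal O →
      εκ y = algebraMap k ((MvPolynomial (Fin m) A ⧸ I) ⧸ q) r := by
    intro y r hy
    have h1 : residue O y = algebraMap k (ResidueField O) r := by
      rw [← residue_eq_zero_iff, map_sub, sub_eq_zero] at hy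
      exact hy
    change algebraMap k ((MvPolynomial (Fin m) A ⧸ I) ⧸ q)
      ((RingEquiv.ofBijective _ hκ).symm (residue O y)) = _
    rw [h1]
    congr 1
    exact (RingEquiv.ofBijective (algebraMap k (ResidueField O)) hκ).symm_apply_apply r
  let _ : Algebra O ((MvPolynomial (Fin m) A ⧸ I) ⧸ q) := εκ.toAlgebra
  have hker : ∀ s ∈ originIdeal A O m,
      algebraMap (MvPolynomial (Fin m) A) ((MvPolynomial (Fin m) A ⧸ I) ⧸ q) s = 0 := fun s hs =>
    Ideal.Quotient.eq_zero_iff_mem.2 ((mk_mem_map_originIdeal hIorig).2 hs)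
  have hAO : IsScalarTower A O ((MvPolynomial (Fin m) A ⧸ I) ⧸ q) :=
    IsScalarTower.of_algebraMap_eq fun a => by
      obtain ⟨r, hr⟩ := exists_sub_algebraMap_mem hκ (algebraMap A O a)
      refine Eq.trans ?_ (hεκ _ r hr).symm
      have h1 : MvPolynomial.C (a - algebraMap k A r) ∈ originIdeal A O m := by
        rw [C_mem_originIdeal, map_sub, ← IsScalarTower.algebraMap_apply]
        exact hr
      have h2 := hker _ h1
      rw [← MvPolynomial.algebraMap_eq, ← IsScalarTower.algebraMap_apply, map_sub,
        ← IsScalarTower.algebraMap_apply, sub_eq_zero] at h2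
      exact h2
  have hkO : IsScalarTower k O ((MvPolynomial (Fin m) A ⧸ I) ⧸ q) :=
    IsScalarTower.of_algebraMap_eq fun r => (hεκ _ r (by rw [sub_self]; exact zero_mem _)).symm
  have hε : ∀ x ∈ maximalIdeal O, algebraMap O ((MvPolynomial (Fin m) A ⧸ I) ⧸ q) x = 0 :=
    fun x hx => by
      refine (hεκ x 0 ?_).trans (map_zero _)
      rwa [map_zero, sub_zero]
  have hJ : jacobianIdeal φ D ≤ originIdeal A O m :=
    (hI ▸ jacobianIdeal_le_rootIdeal : jacobianIdeal φ D ≤ I).trans hIorig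
  have hP : IsCriticalPoint φ D ((MvPolynomial (Fin m) A ⧸ I) ⧸ q) :=
    isCriticalPoint hκ M hk hε hker hlast hJ himm
  obtain ⟨f, hf, -⟩ := exists_hessian_root (φ := φ) D h2
  have hfK : algebraMap (MvPolynomial (Fin m) A) ((MvPolynomial (Fin m) A ⧸ I) ⧸ q) f = 0 :=
    hker _ (hIorig (hI ▸ mem_rootIdeal hf))
  choose dO hdO using fun i => exists_derivation_extension (O := O) M (D i)
  have hsm := isSmoothOfDimAt_iff h2 hI hk hP (by omega) hf hq
  refine ⟨fun h x ψ hx hψ => ?_, fun ψ hψ hvan hx hsing hadm hrank => ?_, fun h => ?_⟩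
  · have := rank_hessianAtOrigin_add_two_eq hdO hk hε hP h2 hf hfK hn hx hψ (hsm.1 h)
    omega
  · obtain ⟨r, hr, hstd⟩ := hadm
    have hst : (⟨n - 2, by omega⟩ : Fin n) ≠ ⟨n - 1, by omega⟩ := by
      rw [Ne, Fin.mk.injEq]
      omega
    have hk2 : (2 : k) = 0 := (algebraMap k A).injective (by rw [map_ofNat, h2, map_zero])
    rw [hsm, exists_apply_root_ne_zero_iff hdO hk hε hP h2 hf hfK hn hnm hx
      (fun i hi => by rw [IsScalarTower.algebraMap_apply A O, hε _ (hvan i hi)]) hsing hψ (by omega)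
      (fun i j hi => by
        rw [hstd]
        exact standardAlt_apply_eq_zero hn hr (by rw [← hstd]; omega) (Or.inl hi))
      (s := ⟨n - 2, by omega⟩) (t := ⟨n - 1, by omega⟩) (by simp; omega) (by simp; omega)]
    have e1 : n - 2 + 1 = n - 1 := by omega
    have e2 : n - 1 + 1 = n := by omega
    refine or_congr ⟨?_, ?_⟩ ⟨?_, ?_⟩
    · rintro ⟨l, hl⟩
      have h3 : l ≠ ⟨n - 2, by omega⟩ ∧ l ≠ ⟨n - 1, by omega⟩ := by
        refine ⟨fun h => hl (thirdAtOrigin_eq_zero hk2 _ hst (Or.inl h)),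
          fun h => hl (thirdAtOrigin_eq_zero hk2 _ hst (Or.inr h))⟩
      rw [thirdAtOrigin_eq_squarefreeCoeff _ hst h3.1 h3.2] at hl
      simp only [e1, e2] at hl
      refine ⟨l + 1, ?_, hl⟩
      have h4 := Fin.val_ne_of_ne h3.1
      have h5 := Fin.val_ne_of_ne h3.2
      have h6 := l.2
      simp only at h4 h5
      rw [Finset.mem_Icc]
      omega
    · rintro ⟨i, hi, hne⟩
      rw [Finset.mem_Icc] at hi
      refine ⟨⟨i - 1, by omega⟩, ?_⟩
      rw [thirdAtOrigin_eq_squarefreeCoeff _ hst (by rw [Ne, Fin.mk.injEq]; omega)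
        (by rw [Ne, Fin.mk.injEq]; omega)]
      simp only [e1, e2, Nat.sub_add_cancel hi.1]
      exact hne
    · rintro ⟨b, hb⟩
      rw [coeff_pair_eq_squarefreeCoeff _ hst] at hb
      simp only [e1, e2] at hb
      exact ⟨_, by simp, by simp; omega, hb⟩
    · rintro ⟨j, hj1, hj2, hj⟩
      refine ⟨⟨j - n - 1, by omega⟩, ?_⟩
      rw [coeff_pair_eq_squarefreeCoeff _ hst]
      simp only [e1, e2]
      convert hj using 3
      ext
      simp
      omega
  · exact kernelIsSubbundleNear_and_finrank hk hP h2 hI hq (by rwa [Fintype.card_fin]) (by omega) h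

end Main

end DualVariety
end

noncomputable section
namespace DualVariety

set_option linter.unusedSectionVars false

/-! ## The local rings of a projective variety -/

section Variety

variable {k : Type u} [Field k] {X : Scheme.{u}} [X.Over (Spec (CommRingCat.of k))]

attribute [local instance] MvPolynomial.gradedAlgebra in
-- Homogeneous polynomials of degree zero are constants, so `Proj` over its ring of degree zero is
-- of finite type over `k`, and closed immersions preserve this.
theorem IsProjectiveVariety.locallyOfFiniteType (hX : IsProjectiveVariety k X) :
    LocallyOfFiniteType (X ↘ Spec (CommRingCat.of k)) := by
  obtain ⟨N, i, hi, h⟩ := hX.projective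
  rw [← h]
  have h0 : Function.Surjective
      (algebraMap k (MvPolynomial.homogeneousSubmodule (Fin (N + 1)) k 0)) := fun x => by
    obtain ⟨x, hx⟩ := x
    have hx' := (MvPolynomial.mem_homogeneousSubmodule _ _).1 hx
    refine ⟨MvPolynomial.coeff 0 x, Subtype.ext ?_⟩
    exact ((MvPolynomial.totalDegree_eq_zero_iff_eq_C).1
      (Nat.le_zero.1 hx'.totalDegree_le)).symm
  have : Algebra.FiniteType (MvPolynomial.homogeneousSubmodule (Fin (N + 1)) k 0)
      (MvPolynomial (Fin (N + 1)) k) := by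
    rw [← RingHom.finiteType_algebraMap]
    refine RingHom.FiniteType.of_comp_finiteType (f := algebraMap k _) ?_
    exact (RingHom.finiteType_algebraMap (A := k)).2 inferInstance
  have : LocallyOfFiniteType (Spec.map (CommRingCat.ofHom
      (algebraMap k (MvPolynomial.homogeneousSubmodule (Fin (N + 1)) k 0)))) := by
    rw [HasRingHomProperty.Spec_iff (P := @LocallyOfFiniteType)]
    exact RingHom.FiniteType.of_surjective _ h0
  infer_instance

theorem algebraMap_sections_eq (U : X.Opens) : algebraMap k Γ(X, U) =
    ((Scheme.ΓSpecIso (CommRingCat.of k)).inv ≫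
      (X ↘ Spec (CommRingCat.of k)).appLE ⊤ U (fun _ _ => trivial)).hom := rfl

theorem finiteType_sections [LocallyOfFiniteType (X ↘ Spec (CommRingCat.of k))] {U : X.Opens}
    (hU : IsAffineOpen U) : Algebra.FiniteType k Γ(X, U) := by
  rw [← RingHom.finiteType_algebraMap, algebraMap_sections_eq, CommRingCat.hom_comp]
  exact ((X ↘ Spec (CommRingCat.of k)).finiteType_appLE (isAffineOpen_top _) hU _).comp
    (.of_surjective _ (ConcreteCategory.bijective_of_isIso
      (Scheme.ΓSpecIso (CommRingCat.of k)).inv).2)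

/-- The points of `U` outside the smooth locus form a locally closed set. In a Jacobson space it
contains a closed point if it is not empty, so smoothness at closed points suffices. -/
theorem formallySmooth_sections [LocallyOfFiniteType (X ↘ Spec (CommRingCat.of k))] {U : X.Opens}
    (hU : IsAffineOpen U)
    (h : ∀ p ∈ U, IsClosed ({p} : Set X) → ∃ W : X.Opens, p ∈ W ∧
      Smooth (W.ι ≫ (X ↘ Spec (CommRingCat.of k)))) :
    Algebra.FormallySmooth k Γ(X, U) := by
  have : LocallyOfFinitePresentation (X ↘ Spec (CommRingCat.of k)) :=
    LocallyOfFinitePresentation.iff_locallyOfFiniteType.2 ‹_›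
  have : JacobsonSpace X := LocallyOfFiniteType.jacobsonSpace (X ↘ Spec (CommRingCat.of k))
  have hle : U ≤ (X ↘ Spec (CommRingCat.of k)).smoothLocus := by
    by_contra hlt
    obtain ⟨p, ⟨hp, hps⟩, hpc⟩ := nonempty_inter_closedPoints
      (Z := (U : Set X) \ (X ↘ Spec (CommRingCat.of k)).smoothLocus) (Set.sdiff_nonempty.2 hlt)
      (U.2.isLocallyClosed.inter (X ↘ Spec (CommRingCat.of k)).smoothLocus.2.isClosed_compl.isLocallyClosed)
    obtain ⟨W, hpW, hW⟩ := h p hp hpc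
    have h1 := (Scheme.Hom.preimage_smoothLocus_eq W.ι (X ↘ Spec (CommRingCat.of k))).trans
      (W.ι ≫ (X ↘ Spec (CommRingCat.of k))).smoothLocus_eq_top
    exact hps (h1.ge (Set.mem_univ (⟨p, hpW⟩ : W)))
  have hsm : Smooth (U.ι ≫ (X ↘ Spec (CommRingCat.of k))) := by
    rw [← Scheme.Hom.smoothLocus_eq_top_iff, ← Scheme.Hom.preimage_smoothLocus_eq, eq_top_iff]
    exact fun x _ => hle x.2
  have : IsAffine U := hU
  have h2 := (U.ι ≫ (X ↘ Spec (CommRingCat.of k))).smooth_appLE (isAffineOpen_top _)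
    (isAffineOpen_top U.toScheme) (fun _ _ => trivial)
  have h3 : (U.ι ≫ (X ↘ Spec (CommRingCat.of k))).appLE ⊤ ⊤ (fun _ _ => trivial) =
      (X ↘ Spec (CommRingCat.of k)).appLE ⊤ U (fun _ _ => trivial) ≫ U.topIso.inv := by
    have e : (⊤ : U.toScheme.Opens) ≤ U.ι ⁻¹ᵁ U := fun x _ => x.2
    rw [← Scheme.Hom.appLE_comp_appLE _ _ ⊤ U ⊤ (fun _ _ => trivial) e]
    congr 1
    simp only [Scheme.Hom.appLE, Scheme.Opens.ι_app, Scheme.Opens.toScheme_presheaf_map,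
      Scheme.Opens.topIso_inv]
    exact (X.presheaf.map_comp _ _).symm
  rw [h3, CommRingCat.hom_comp,
    RingHom.Smooth.propertyIsLocal.respectsIso.cancel_right_isIso] at h2
  have h4 : (algebraMap k Γ(X, U)).Smooth := by
    rw [algebraMap_sections_eq, CommRingCat.hom_comp,
      RingHom.Smooth.propertyIsLocal.respectsIso.cancel_left_isIso]
    exact h2
  exact ((RingHom.smooth_algebraMap (R := k)).1 h4).formallySmooth

/-- The Nullstellensatz: the residue field is a finitely generated algebra over `k`, hence finite
over `k`, which is algebraically closed. -/
theorem bijective_algebraMap_residueField [IsAlgClosed k] {A O : Type*} [CommRing A] [Algebra k A]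
    [Algebra.FiniteType k A] [CommRing O] [IsLocalRing O] [Algebra k O] [Algebra A O]
    [IsScalarTower k A O] (P : Ideal A) [hP : P.IsMaximal] [IsLocalization.AtPrime O P] :
    Function.Bijective (algebraMap k (IsLocalRing.ResidueField O)) := by
  have h : Function.Surjective (algebraMap A (IsLocalRing.ResidueField O)) := by
    have h1 := (IsLocalization.AtPrime.equivQuotMaximalIdeal P O).surjective
    intro x
    obtain ⟨y, rfl⟩ := h1 x
    obtain ⟨a, rfl⟩ := Ideal.Quotient.mk_surjective y
    exact ⟨a, rfl⟩
  have : Algebra.FiniteType k (IsLocalRing.ResidueField O) :=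
    Algebra.FiniteType.of_surjective
      (IsScalarTower.toAlgHom k A (IsLocalRing.ResidueField O)) h
  have := finite_of_finite_type_of_isJacobsonRing k (IsLocalRing.ResidueField O)
  exact IsAlgClosed.algebraMap_bijective_of_isIntegral

theorem map_algebraMap (U : X.Opens) (r : k) :
    X.presheaf.map (homOfLE (le_top : U ≤ ⊤)).op (algebraMap k Γ(X, ⊤) r) =
      algebraMap k Γ(X, U) r := by
  have e : (⊤ : X.Opens) ≤ (X ↘ Spec (CommRingCat.of k)) ⁻¹ᵁ ⊤ := fun _ _ => trivial
  have h := Scheme.Hom.appLE_map (X ↘ Spec (CommRingCat.of k)) e (homOfLE (le_top : U ≤ ⊤)).op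
  simp only [algebraMap_sections_eq]
  rw [← h]
  rfl

theorem germ_algebraMap {p : X} {U : X.Opens} (hp : p ∈ U) (r : k) :
    X.presheaf.germ U p hp (algebraMap k Γ(X, U) r) = algebraMap k (X.presheaf.stalk p) r := by
  rw [← map_algebraMap, X.presheaf.germ_res_apply]
  rfl

theorem res_add (L : X.Modules) (U : X.Opens) (s t : Γ(L, ⊤)) :
    res L U (s + t) = res L U s + res L U t :=
  map_add (L.presheaf.map (homOfLE (le_top : U ≤ ⊤)).op).hom s t

theorem res_smul (L : X.Modules) (U : X.Opens) (r : k) (s : Γ(L, ⊤)) :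
    res L U (r • s) = algebraMap k Γ(X, U) r • res L U s := by
  rw [← map_algebraMap]
  exact L.map_smul (homOfLE (le_top : U ≤ ⊤)) (algebraMap k Γ(X, ⊤) r) s

theorem IsFrame.smul_injective {L : X.Modules} {U : X.Opens} {b : Γ(L, U)} (hb : IsFrame L U b) :
    Function.Injective fun a : Γ(X, U) => a • b := by
  have := (hb U le_rfl).1
  simpa using this

end Variety

/-! ### The linear system in an affine chart -/

section Chart

open IsLocalRing

variable {k : Type u} [Field k] {X : Scheme.{u}} [X.Over (Spec (CommRingCat.of k))]

namespace Chart

variable {n m : ℕ} {L : X.Modules} {M : Submodule k Γ(L, ⊤)} (c : Chart n m L M)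

theorem phi_smul (i : Fin (m + 1)) :
    c.phi i • res L c.U (c.s (Fin.last m)) = res L c.U (c.s i) := (c.exists_phi i).choose_spec

theorem phi_last : c.phi (Fin.last m) = 1 :=
  c.isFrame.smul_injective ((c.phi_smul _).trans (one_smul _ _).symm)

theorem sum_smul (r : Fin (m + 1) → k) :
    (∑ i, algebraMap k Γ(X, c.U) (r i) * c.phi i) • res L c.U (c.s (Fin.last m)) =
      res L c.U (∑ i, r i • (c.s i : Γ(L, ⊤))) := by
  let ρ : Γ(L, ⊤) →+ Γ(L, c.U) := ⟨⟨res L c.U, by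
    exact map_zero (L.presheaf.map (homOfLE (le_top : c.U ≤ ⊤)).op).hom⟩, res_add L c.U⟩
  rw [Finset.sum_smul]
  refine Eq.trans ?_ (map_sum ρ _ _).symm
  refine Finset.sum_congr rfl fun i _ => ?_
  rw [mul_smul, phi_smul]
  exact (res_smul L c.U (r i) _).symm

variable {p : X} (hp : p ∈ c.U)

/-- In the frame `s_m`, every section in `M` is a constant combination of the `φ_i`, so immersivity
for all of `M` can be tested on such combinations. -/
theorem eq_zero_of_forall_apply_eq_zero (hpc : IsClosed ({p} : Set X))
    (v : Module.Dual (ResidueField (X.presheaf.stalk p)) (CotangentSpace (X.presheaf.stalk p)))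
    (hv : ∀ (r : Fin (m + 1) → k)
      (h0 : X.presheaf.germ c.U p hp (∑ i, algebraMap k Γ(X, c.U) (r i) * c.phi i) ∈
        maximalIdeal (X.presheaf.stalk p)),
      v ((maximalIdeal (X.presheaf.stalk p)).toCotangent ⟨_, h0⟩) = 0) : v = 0 := by
  refine (c.good p hp hpc).immersive c.U hp _ c.isFrame v fun s hs h h0 hres => ?_
  have h1 : h = ∑ i, algebraMap k Γ(X, c.U) (c.s.repr ⟨s, hs⟩ i) * c.phi i := by
    refine c.isFrame.smul_injective (hres.symm.trans (Eq.trans ?_ (c.sum_smul _).symm))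
    congr 1
    have := congrArg (Subtype.val) (c.s.sum_repr ⟨s, hs⟩)
    rw [Submodule.coe_sum] at this
    exact this.symm
  subst h1
  exact hv _ h0

end Chart

end Chart

end DualVariety
end

set_option maxHeartbeats 1000000 in
open DualVariety in
/-- `X` is the projective variety, `P = ℙ_*(M)`, and `c` is any affine chart of `X° × P`
at the point `(p, [f])`, `f = s_0`, which is assumed to lie on `ℛ`. -/
theorem theorem5p1 {k : Type u} [Field k] [IsAlgClosed k] [CharP k 2]
    {X : Scheme.{u}} [X.Over (Spec (CommRingCat.of k))] (hX : IsProjectiveVariety k X)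
    {n m : ℕ} (hn0 : 0 < n) (hdim : topologicalKrullDim X = n)
    (L : X.Modules) (hL : IsLineBundle L)
    (M : Submodule k Γ(L, ⊤)) (hM : Module.finrank k M = m + 1) (hnm : n < m)
    (hdense : Dense {p : X | IsGoodPoint L M p})
    (hn : Even n)
    (c : Chart n m L M) (p : X) (hp : p ∈ c.U) (hpc : IsClosed ({p} : Set X))
    (hR : c.MemR p hp) :
    (c.MemRsm p hp →
      ∀ (x : Fin n → X.presheaf.stalk p) (ψ : MvPowerSeries (Fin n) k),
        IsParameterSystem x → IsExpansion x (c.phiAt p hp 0) ψ →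
          (hessianAtOrigin ψ).rank = n - 2) ∧
    (∀ ψ : Fin (m + 1) → MvPowerSeries (Fin n) k,
      (∀ i, IsExpansion (c.coords hnm p hp) (c.phiAt p hp i) (ψ i)) →
      c.IsAdapted hnm p hp (ψ 0) →
      (hessianAtOrigin (ψ 0)).rank = n - 2 →
        (c.MemRsm p hp ↔
          (∃ i ∈ Finset.Icc 1 (n - 2), squarefreeCoeff {i, n - 1, n} (ψ 0) ≠ 0) ∨
          (∃ j : Fin (m + 1), n + 1 ≤ (j : ℕ) ∧ (j : ℕ) ≤ m - 1 ∧
            squarefreeCoeff {n - 1, n} (ψ j) ≠ 0))) ∧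
    (c.MemRsm p hp →
      KernelIsSubbundleNear k c.y (c.pointOnR p hp) (m - 2) 2 ∧
      Module.finrank k (LinearMap.ker
        (differential (k := k) c.y (c.R ⧸ c.pointOnR p hp))) = 2) := by
  have hfin := hX.locallyOfFiniteType
  have hint := hX.integral
  have hne : Nonempty c.U := ⟨⟨p, hp⟩⟩
  have := finiteType_sections (k := k) c.isAffineOpen
  have := formallySmooth_sections (k := k) c.isAffineOpen
    fun q hq hqc => (c.good q hq hqc).smooth
  let _ : Algebra Γ(X, c.U) (X.presheaf.stalk p) := (X.presheaf.germ c.U p hp).hom.toAlgebra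
  have : IsScalarTower k Γ(X, c.U) (X.presheaf.stalk p) :=
    .of_algebraMap_eq fun r => (germ_algebraMap hp r).symm
  have hmax := c.isAffineOpen.primeIdealOf_isMaximal_of_isClosed ⟨p, hp⟩ hpc
  have hloc : IsLocalization.AtPrime (X.presheaf.stalk p)
      (c.isAffineOpen.primeIdealOf ⟨p, hp⟩).asIdeal := c.isAffineOpen.isLocalization_stalk ⟨p, hp⟩
  have hκ := bijective_algebraMap_residueField (k := k) (O := X.presheaf.stalk p)
    (c.isAffineOpen.primeIdealOf ⟨p, hp⟩).asIdeal
  have h2 : (2 : Γ(X, c.U)) = 0 := by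
    rw [← map_ofNat (algebraMap k Γ(X, c.U)), CharTwo.two_eq_zero, map_zero]
  -- From here on the ideal of maximal minors is replaced by the explicit equations `Φ` and `∂_iΦ`.
  have hI : degeneracyIdeal c.phi c.frame = rootIdeal c.phi c.frame := by
    rw [degeneracyIdeal, criticalIdeal_eq c.frame (by omega) c.phi_last]
    rfl
  obtain ⟨H1, H2, H3⟩ := degeneracy_point hκ
    (c.isAffineOpen.primeIdealOf ⟨p, hp⟩).asIdeal.primeCompl h2 hn hn0 hnm hI hR c.phi_last
    (c.eq_zero_of_forall_apply_eq_zero hp hpc)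
  refine ⟨fun h => H1 h.2, fun ψ hψ hc hrank => ?_, fun h => H3 h.2⟩
  exact (and_iff_right hR).trans (H2 ψ hψ hc.vanish hc.transverse
    (fun i hi him => hc.singular i (Or.inr ⟨hi, him⟩)) hc.admissible hrank)
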